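/- Let $G$ be a compact semisimple Lie group with Lie algebra $\mathfrak g$ and Killing form $B_{\mathfrak g}$, let $\sigma$ be an involutive automorphism of $G$, let $H$ be the identity component of the fixed point group of $\sigma$, with Lie algebra $\mathfrak h$, and let $\mathfrak p$ be the $B_{\mathfrak g}$-orthogonal complement of $\mathfrak h$ in $\mathfrak g$. Assume that $G$ acts almost effectively on $M=G/H$, in the sense that $\mathfrak h$ contains no nonzero ideal of $\mathfrak g$. Equip $M$ with the $G$-invariant submersion metric $g$ induced by $-B_{\mathfrak g}$, so that $T_oM\cong\mathfrak p$ at the base point $o=eH$ with $g_o=-B_{\mathfrak g}|_{\mathfrak p\times\mathfrak p}$. Let $R$ be its curvature tensor, with sign such that $\sec(X,Y)=R(X,Y,X,Y)$ for orthonormal $X,Y$. Identify $\bigwedge^2T_oM$ with $\mathfrak{so}(T_oM)$ by letting $X\wedge Y$ act as $Z\mapsto g(X,Z)Y-g(Y,Z)X$, with inner product $\langle A,B\rangle=-\operatorname{tr}(AB)$, and let $\mathfrak R\colon\mathfrak{so}(T_oM)\to\mathfrak{so}(T_oM)$ be the curvature operator, i.e. the linear map determined by $\langle\mathfrak R(X\wedge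 Y),Z\wedge W\rangle=2R(X,Y,Z,W)$. Then $\mathrm{Ric}=\frac12 g$, and the map $\mathfrak h\to\mathfrak{so}(T_oM)$, $Z\mapsto\operatorname{ad}_Z|_{\mathfrak p}$, is injective; regard $\mathfrak h$ as a subspace of $\mathfrak{so}(T_oM)$ through it. Let $\mathfrak h_0$ be the centre of $\mathfrak h$ and $\mathfrak h_1,\dots,\mathfrak h_n$ the distinct simple ideals of $\mathfrak h$. Then $\mathfrak h=\mathfrak h_0\oplus\mathfrak h_1\oplus\dots\oplus\mathfrak h_n$, and there are real numbers $\lambda_i\in(0,\frac12)$ such that $\mathfrak R=\frac12 I$ on $\mathfrak h_0$, $\mathfrak R=\lambda_iI$ on $\mathfrak h_i$ for $i\ge1$, and $\mathfrak R=0$ precisely on the orthogonal complement of $\mathfrak h$ in $\mathfrak{so}(T_oM)$. This is the eigenspace decomposition of $\mathfrak R$ on $\mathfrak h$, up to merging ideals with equal eigenvalue: the $\frac12$-eigenspace of $\mathfrak R$ is $\mathfrak h_0$, the $\lambda_i$-eigenspace is $\bigoplus_{j:\lambda_j=\lambda_i}\mathfrak h_j$, and $\mathfrak R$ has no eigenvalues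 other than $0$, $\frac12$ and the $\lambda_i$. Consequently, at every point of $M$, $$\tfrac12\dim_{\mathbb R}M=\mathrm{scal}=2\operatorname{tr}\mathfrak R=\dim\mathfrak h_0+2\sum_{i\ge1}\lambda_i\dim_{\mathbb R}\mathfrak h_i .$$ -/

import Mathlib

open scoped Manifold ContDiff
open Bundle

/-! ### Bivectors of a Euclidean vector space -/

/-- `𝔰𝔬(V)`: the skew-adjoint endomorphisms of the Euclidean space `V`; it is identified with
`⋀² V` through `wedge` below. -/
def soTangent (V : Type*) [NormedAddCommGroup V] [InnerProductSpace ℝ V] :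
    Submodule ℝ (V →ₗ[ℝ] V) where
  carrier := {A | ∀ u v : V, inner ℝ (A u) v = -inner ℝ u (A v)}
  add_mem' := by
    intro A B hA hB u v
    simp only [LinearMap.add_apply, inner_add_left, inner_add_right, hA u v, hB u v]
    ring
  zero_mem' := by
    intro u v
    simp
  smul_mem' := by
    intro c A hA u v
    simp only [LinearMap.smul_apply, real_inner_smul_left, real_inner_smul_right, hA u v]
    ring

/-- The bivector `X ∧ Y` as the skew endomorphism `Z ↦ ⟨X, Z⟩ Y - ⟨Y, Z⟩ X`. -/
noncomputable def wedge {V : Type*} [NormedAddCommGroup V] [InnerProductSpace ℝ V] (X Y : V) :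
    soTangent V :=
  ⟨(innerₗ V X).smulRight Y - (innerₗ V Y).smulRight X, by
    intro u v
    simp only [LinearMap.sub_apply, LinearMap.smulRight_apply, innerₗ_apply_apply, inner_sub_left,
      inner_sub_right, real_inner_smul_left, real_inner_smul_right]
    rw [real_inner_comm u X, real_inner_comm u Y]
    ring⟩

/-- The inner product `⟨A, B⟩ = -tr (A B)` of `𝔰𝔬(V)`; it is the tensor inner product of `⋀² V`,
so that `|X ∧ Y|² = 2` for orthonormal `X`, `Y`. -/
noncomputable def soInner {V : Type*} [NormedAddCommGroup V] [InnerProductSpace ℝ V]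
    (A B : soTangent V) : ℝ :=
  -LinearMap.trace ℝ V (A.1 ∘ₗ B.1)

/-! ### Curvature of a connection on the tangent bundle -/

section Curvature

/-- The curvature `R(X, Y) Z = ∇_X ∇_Y Z - ∇_Y ∇_X Z - ∇_{[X, Y]} Z` on vector fields. -/
noncomputable def curvatureField {E : Type*} [NormedAddCommGroup E] [NormedSpace ℝ E]
    {H : Type*} [TopologicalSpace H] {I : ModelWithCorners ℝ E H}
    {M : Type*} [TopologicalSpace M] [ChartedSpace H M] [IsManifold I 1 M]
    (cov : CovariantDerivative I E (TangentSpace I : M → Type _))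
    (X Y Z : Π x : M, TangentSpace I x) (x : M) : TangentSpace I x :=
  cov (fun y ↦ cov Z y (Y y)) x (X x) - cov (fun y ↦ cov Z y (X y)) x (Y x)
    - cov Z x (VectorField.mlieBracket I X Y x)

variable {E : Type*} [NormedAddCommGroup E] [NormedSpace ℝ E] [FiniteDimensional ℝ E]
  {H : Type*} [TopologicalSpace H] {I : ModelWithCorners ℝ E H}
  {M : Type*} [TopologicalSpace M] [ChartedSpace H M] [IsManifold I 1 M]
  [RiemannianBundle (fun x : M ↦ TangentSpace I x)]

/-- `∇` is the Levi-Civita connection: it is smooth, compatible with the metric and torsion free. -/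
structure IsLeviCivita [IsManifold I ∞ M]
    (cov : CovariantDerivative I E (TangentSpace I : M → Type _)) : Prop where
  smooth : CovariantDerivative.ContMDiffCovariantDerivative cov ∞
  metric : ∀ (x : M) (X Y Z : Π x : M, TangentSpace I x),
    MDiffAt (T% X) x → MDiffAt (T% Y) x → MDiffAt (T% Z) x →
      mvfderiv I (fun y ↦ (inner ℝ (Y y) (Z y) : ℝ)) x (X x) =
        inner ℝ (cov Y x (X x)) (Z x) + inner ℝ (Y x) (cov Z x (X x))
  torsion_free : ∀ (x : M) (X Y : Π x : M, TangentSpace I x),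
    MDiffAt (T% X) x → MDiffAt (T% Y) x →
      cov Y x (X x) - cov X x (Y x) = VectorField.mlieBracket I X Y x

/-- The curvature tensor `R(X, Y, Z, W) = ⟨R(X, Y) W, Z⟩` at the point `x` (so that
`sec (X, Y) = R(X, Y, X, Y)` for orthonormal `X`, `Y`), computed by extending the tangent vectors
to vector fields that are smooth near `x`. -/
noncomputable def riemannTensor (cov : CovariantDerivative I E (TangentSpace I : M → Type _))
    (x : M) (X Y Z W : TangentSpace I x) : ℝ :=
  inner ℝ (curvatureField cov (FiberBundle.extend E X) (FiberBundle.extend E Y)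
    (FiberBundle.extend E W) x) Z

/-- The Ricci curvature `Ric(X, Y) = ∑ᵢ R(eᵢ, X, eᵢ, Y)` at `x`, for an orthonormal basis `e`. -/
noncomputable def ricciTensor (cov : CovariantDerivative I E (TangentSpace I : M → Type _))
    (x : M) (X Y : TangentSpace I x) : ℝ :=
  haveI : FiniteDimensional ℝ (TangentSpace I x) := inferInstanceAs (FiniteDimensional ℝ E)
  ∑ i, riemannTensor cov x (stdOrthonormalBasis ℝ (TangentSpace I x) i) X
    (stdOrthonormalBasis ℝ (TangentSpace I x) i) Y

/-- The scalar curvature at `x`: the trace of the Ricci curvature. -/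
noncomputable def scalarCurvature (cov : CovariantDerivative I E (TangentSpace I : M → Type _))
    (x : M) : ℝ :=
  haveI : FiniteDimensional ℝ (TangentSpace I x) := inferInstanceAs (FiniteDimensional ℝ E)
  ∑ i, ricciTensor cov x (stdOrthonormalBasis ℝ (TangentSpace I x) i)
    (stdOrthonormalBasis ℝ (TangentSpace I x) i)

/-- `𝔯` is the curvature operator at `x`:
`⟨𝔯 (X ∧ Y), Z ∧ W⟩ = 2 R(X, Y, Z, W)` for all tangent vectors at `x`. -/
def IsCurvatureOperator (cov : CovariantDerivative I E (TangentSpace I : M → Type _))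
    (x : M) (𝔯 : soTangent (TangentSpace I x) →ₗ[ℝ] soTangent (TangentSpace I x)) : Prop :=
  ∀ X Y Z W : TangentSpace I x,
    soInner (𝔯 (wedge X Y)) (wedge Z W) = 2 * riemannTensor cov x X Y Z W

end Curvature

/-! ### Lie groups -/

instance lieGroup_minSmoothness_of_smooth {E : Type*} [NormedAddCommGroup E] [NormedSpace ℝ E]
    {H : Type*} [TopologicalSpace H] {I : ModelWithCorners ℝ E H}
    {G : Type*} [TopologicalSpace G] [ChartedSpace H G] [Group G] [LieGroup I ∞ G] :
    LieGroup I (minSmoothness ℝ 3) G :=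
  LieGroup.of_le (n := ∞) (by rw [minSmoothness_of_isRCLikeNormedField]; exact ENat.LEInfty.out)

/-- The identity component of the fixed point subgroup of an endomorphism `σ` of `G`. -/
def fixedSubgroupComponent {G : Type*} [TopologicalSpace G] [Group G] [IsTopologicalGroup G]
    (σ : G →* G) : Subgroup G :=
  (Subgroup.connectedComponentOfOne (σ.eqLocus (MonoidHom.id G))).map
    (σ.eqLocus (MonoidHom.id G)).subtype

section LieGroup

variable {E : Type*} [NormedAddCommGroup E] [NormedSpace ℝ E] [FiniteDimensional ℝ E]
  {G : Type*} [TopologicalSpace G] [ChartedSpace E G] [Group G] [LieGroup 𝓘(ℝ, E) ∞ G]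

/-- The Lie algebra of a subgroup `K` of `G`: it consists of the initial velocities of the smooth
one-parameter subgroups of `G` that lie in `K`. (For a closed subgroup these velocities already
form a Lie subalgebra, which is therefore equal to its Lie span.) -/
noncomputable def lieAlgebraOfSubgroup (K : Subgroup G) :
    LieSubalgebra ℝ (GroupLieAlgebra 𝓘(ℝ, E) G) :=
  LieSubalgebra.lieSpan ℝ (GroupLieAlgebra 𝓘(ℝ, E) G)
    {X | ∃ γ : ℝ → G, ContMDiff 𝓘(ℝ, ℝ) 𝓘(ℝ, E) ∞ γ ∧ γ 0 = 1 ∧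
      (∀ s t, γ (s + t) = γ s * γ t) ∧ (∀ t, γ t ∈ K) ∧
      (mfderiv 𝓘(ℝ, ℝ) 𝓘(ℝ, E) γ 0 (1 : ℝ) : E) = (X : E)}

/-- The orthogonal complement of a subalgebra with respect to the Killing form. -/
noncomputable def killingOrthogonal (𝔥 : LieSubalgebra ℝ (GroupLieAlgebra 𝓘(ℝ, E) G)) :
    Submodule ℝ (GroupLieAlgebra 𝓘(ℝ, E) G) :=
  LinearMap.BilinForm.orthogonal (killingForm ℝ (GroupLieAlgebra 𝓘(ℝ, E) G)) 𝔥.toSubmodule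

variable {F : Type*} [NormedAddCommGroup F] [NormedSpace ℝ F] [FiniteDimensional ℝ F]

/-- The differential at `a` of the projection `π : G → G ⧸ K`. -/
noncomputable def projDeriv (K : Subgroup G) [ChartedSpace F (G ⧸ K)] (a : G) :
    TangentSpace 𝓘(ℝ, E) a →L[ℝ] TangentSpace 𝓘(ℝ, F) (QuotientGroup.mk a : G ⧸ K) :=
  mfderiv 𝓘(ℝ, E) 𝓘(ℝ, F) (QuotientGroup.mk : G → G ⧸ K) a

/-- The Riemannian metric of `G ⧸ K` is the `G`-invariant submersion metric induced by minus the
Killing form `B`: at every `a`, the differential of the projection carries `B` on `𝔭` (translated to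
`a` from the left), where `𝔭` is the `B`-orthogonal complement of the Lie algebra of `K`, to minus
the metric. -/
def IsKillingSubmersionMetric (K : Subgroup G) [ChartedSpace F (G ⧸ K)]
    [RiemannianBundle (fun x : G ⧸ K ↦ TangentSpace 𝓘(ℝ, F) x)] : Prop :=
  ∀ (a : G), ∀ X ∈ killingOrthogonal (lieAlgebraOfSubgroup (E := E) K),
    ∀ Y ∈ killingOrthogonal (lieAlgebraOfSubgroup (E := E) K),
      inner ℝ (projDeriv (F := F) K a (mulInvariantVectorField X a))
        (projDeriv (F := F) K a (mulInvariantVectorField Y a)) =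
      -killingForm ℝ (GroupLieAlgebra 𝓘(ℝ, E) G) X Y

end LieGroup

/-! Let 𝔤 = 𝔥 ⊕ 𝔭 be the decomposition into the ±1-eigenspaces of dσ, and B the Killing form of 𝔤. A
geometric half shows R(X, Y)Z = -[[X, Y], Z] at every point; an algebraic half reads the spectrum
off this formula.

Geometry. A vector field on G/K is an equivariant 𝔭-valued function on G (`lift`). The Levi-Civita
derivative of W along U lifts to the derivative of the lift of W along the horizontal lift of U
(`covariantDerivative_eq_projInvariant`): this rule is metric, and it is torsion free because [𝔭, 𝔭]
⊆ 𝔥 projects to zero. The bracket of two horizontal lifts exceeds the horizontal lift of the bracket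
by the vertical vector [X, Y] ∈ 𝔥, along which a lift varies by minus the isotropy action
(`j_mvfderiv_lift`). This excess is the curvature (`curvatureField_eq_projInvariant`).

Algebra. The formula says 𝔯 = ι ∘ κ, where ι is the isotropy representation and κ(X ∧ Y) = [X, Y] is
half the adjoint of ι for -B on 𝔥 and -tr on 𝔰𝔬(𝔭). Since ι is injective, ker 𝔯 is the orthogonal
complement of 𝔥, and the nonzero spectrum of 𝔯 is that of C = κ ∘ ι on 𝔥 (`casimir`). Splitting a
trace over 𝔭 and 𝔥 gives B = -⟨ι, ι⟩ + B_𝔥 on 𝔥 (`killingForm_subalgebra`), so -B(CZ, Z') = ½(-B +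
B_𝔥)(Z, Z'). Hence C = ½ on the centre. On a simple ideal the symmetric operator C commutes with ad,
so it is a scalar by Schur's argument; it is positive because ι is injective and below ½ because B_𝔥
is negative there (`exists_casimir_eq_smul_of_isSimple`).

For X, Y ∈ 𝔭 the traces over 𝔭 and over 𝔥 agree, so each is half of B(X, Y)
(`two_mul_trace_proj_lie_lie`). This gives Ric = ½g and, after summation over a basis, dim M = 4 tr
C. -/

/-! ### Linear algebra of positive definite symmetric forms -/

section PositiveForms

variable {W : Type*} [AddCommGroup W] [Module ℝ W]

/-- The inner product space core given by a positive definite symmetric bilinear form. -/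
abbrev coreOfBilinForm (b : LinearMap.BilinForm ℝ W) (hsymm : ∀ x y, b x y = b y x)
    (hpos : ∀ x, x ≠ 0 → 0 < b x x) : InnerProductSpace.Core ℝ W where
  inner x y := b x y
  conj_inner_symm x y := by simpa using hsymm y x
  re_inner_nonneg x := by
    by_cases hx : x = 0
    · simp [hx]
    · exact (hpos x hx).le
  add_left x y z := by simp
  smul_left x y r := by simp
  definite x hx := by
    by_contra h
    exact (hpos x h).ne' hx

variable [FiniteDimensional ℝ W]

theorem exists_orthonormal_basis_of_posDef (b : LinearMap.BilinForm ℝ W)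
    (hsymm : ∀ x y, b x y = b y x) (hpos : ∀ x, x ≠ 0 → 0 < b x x) :
    ∃ e : Module.Basis (Fin (Module.finrank ℝ W)) ℝ W,
      ∀ i j, b (e i) (e j) = if i = j then 1 else 0 := by
  let c := coreOfBilinForm b hsymm hpos
  let _ := c.toNormedAddCommGroup
  let _ := InnerProductSpace.ofCore c.toCore
  let e := stdOrthonormalBasis ℝ W
  refine ⟨e.toBasis, fun i j ↦ ?_⟩
  have := orthonormal_iff_ite.1 e.orthonormal i j
  rw [e.coe_toBasis]
  exact this

theorem exists_eigenvector_of_symm [Nontrivial W] (b : LinearMap.BilinForm ℝ W)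
    (hsymm : ∀ x y, b x y = b y x) (hpos : ∀ x, x ≠ 0 → 0 < b x x) (T : W →ₗ[ℝ] W)
    (hT : ∀ x y, b (T x) y = b x (T y)) : ∃ (μ : ℝ) (x : W), x ≠ 0 ∧ T x = μ • x := by
  let c := coreOfBilinForm b hsymm hpos
  let _ := c.toNormedAddCommGroup
  let _ := InnerProductSpace.ofCore c.toCore
  have hT' : T.IsSymmetric := hT
  obtain ⟨x, hx⟩ := hT'.hasEigenvalue_iSup_of_finiteDimensional.exists_hasEigenvector
  exact ⟨_, x, hx.2, hx.apply_eq_smul⟩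

omit [FiniteDimensional ℝ W] in
theorem bilinForm_apply_eq_repr {ι : Type*} [Fintype ι] [DecidableEq ι]
    (b : LinearMap.BilinForm ℝ W) (e : Module.Basis ι ℝ W)
    (he : ∀ i j, b (e i) (e j) = if i = j then 1 else 0) (x : W) (i : ι) :
    b x (e i) = e.repr x i := by
  calc b x (e i) = b (∑ k, e.repr x k • e k) (e i) := by rw [e.sum_repr]
    _ = e.repr x i := by
      simp only [map_sum, map_smul, LinearMap.coe_sum, Finset.sum_apply, LinearMap.smul_apply, he]
      simp

omit [FiniteDimensional ℝ W] in
theorem trace_eq_sum_bilinForm {ι : Type*} [Fintype ι] [DecidableEq ι]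
    (b : LinearMap.BilinForm ℝ W) (e : Module.Basis ι ℝ W)
    (he : ∀ i j, b (e i) (e j) = if i = j then 1 else 0) (f : W →ₗ[ℝ] W) :
    LinearMap.trace ℝ W f = ∑ i, b (f (e i)) (e i) := by
  rw [LinearMap.trace_eq_matrix_trace ℝ e, Matrix.trace]
  refine Finset.sum_congr rfl fun i _ ↦ ?_
  rw [bilinForm_apply_eq_repr b e he, Matrix.diag_apply, LinearMap.toMatrix_apply]

omit [FiniteDimensional ℝ W] in
theorem iSupIndep_of_pairwise_orthogonal {ι : Type*} (b : LinearMap.BilinForm ℝ W)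
    (hpos : ∀ x, x ≠ 0 → 0 < b x x) (A : ι → Submodule ℝ W)
    (hA : ∀ i j, i ≠ j → ∀ x ∈ A i, ∀ y ∈ A j, b x y = 0) : iSupIndep A := by
  intro i
  rw [Submodule.disjoint_def]
  intro x hx hx'
  have hle : ⨆ j, ⨆ (_ : j ≠ i), A j ≤ LinearMap.BilinForm.orthogonal b (A i) :=
    iSup₂_le fun j hj y hy z hz ↦ hA i j hj.symm z hz y hy
  by_contra hne
  exact (hpos x hne).ne' (hle hx' x hx)

theorem isCompl_orthogonal_of_posDef (b : LinearMap.BilinForm ℝ W)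
    (hsymm : ∀ x y, b x y = b y x) (hpos : ∀ x, x ≠ 0 → 0 < b x x) (A : Submodule ℝ W) :
    IsCompl A (LinearMap.BilinForm.orthogonal b A) := by
  rw [LinearMap.BilinForm.isCompl_orthogonal_iff_disjoint
    (fun x y h ↦ (hsymm y x).trans h : b.IsRefl), Submodule.disjoint_def]
  intro x hx hx'
  by_contra hne
  exact (hpos x hne).ne' (hx' x hx)

end PositiveForms

/-! ### Structure of Lie algebras with an invariant inner product -/

section CompactLieAlgebra

variable {H : Type*} [LieRing H] [LieAlgebra ℝ H] [FiniteDimensional ℝ H]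

/-- In an orthonormal basis, tr(f²) = -∑ |f eᵢ|². Applied to f = ad Z, this makes the Killing form
of 𝔥 negative semidefinite, with the centre as its null vectors. -/
theorem trace_sq_nonpos_of_skew {W : Type*} [AddCommGroup W] [Module ℝ W] [FiniteDimensional ℝ W]
    (b : LinearMap.BilinForm ℝ W) (hsymm : ∀ x y, b x y = b y x) (hpos : ∀ x, x ≠ 0 → 0 < b x x)
    (f : W →ₗ[ℝ] W) (hf : ∀ x y, b (f x) y = -b x (f y)) :
    LinearMap.trace ℝ W (f ∘ₗ f) ≤ 0 ∧ (LinearMap.trace ℝ W (f ∘ₗ f) = 0 → f = 0) := by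
  obtain ⟨e, he⟩ := exists_orthonormal_basis_of_posDef b hsymm hpos
  have hnn : ∀ x, 0 ≤ b x x := fun x ↦ by
    by_cases hx : x = 0
    · simp [hx]
    · exact (hpos x hx).le
  have ht : LinearMap.trace ℝ W (f ∘ₗ f) = -∑ i, b (f (e i)) (f (e i)) := by
    rw [trace_eq_sum_bilinForm b e he, ← Finset.sum_neg_distrib]
    exact Finset.sum_congr rfl fun i _ ↦ hf _ _
  rw [ht]
  refine ⟨neg_nonpos.2 (Finset.sum_nonneg fun i _ ↦ hnn _), fun h ↦ e.ext fun i ↦ ?_⟩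
  have := (Finset.sum_eq_zero_iff_of_nonneg fun i _ ↦ hnn _).1 (neg_eq_zero.1 h) i (Finset.mem_univ i)
  by_contra hne
  exact (hpos _ hne).ne' this

omit [FiniteDimensional ℝ H] in
-- A perfect ideal is spanned by brackets [u, v], and invariance moves u onto y, which it
-- annihilates. This makes distinct simple ideals orthogonal to each other and to the centre.
theorem bilinForm_eq_zero_of_mem_perfect (b : LinearMap.BilinForm ℝ H)
    (hinv : ∀ x y z : H, b ⁅x, y⁆ z = -b y ⁅x, z⁆) {J : LieIdeal ℝ H} (hJ : ⁅J, J⁆ = J) {x y : H}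
    (hx : x ∈ J) (hy : ∀ u ∈ J, ⁅u, y⁆ = 0) : b x y = 0 := by
  rw [← hJ, ← LieSubmodule.mem_toSubmodule, LieSubmodule.lieIdeal_oper_eq_linear_span'] at hx
  induction hx using Submodule.span_induction with
  | mem z hz =>
    obtain ⟨u, hu, v, hv, rfl⟩ := hz
    rw [hinv, hy u hu, map_zero, neg_zero]
  | zero => simp
  | add u v _ _ hu hv => simp [hu, hv]
  | smul c u _ hu => simp [hu]

omit [FiniteDimensional ℝ H] in
theorem lie_self_eq_of_isAtom {J : LieIdeal ℝ H} (hJ : IsAtom J) (hna : ¬ IsLieAbelian J) :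
    ⁅J, J⁆ = J := by
  rcases hJ.le_iff.1 (LieSubmodule.lie_le_left J J) with h | h
  · refine absurd ⟨fun x y ↦ ?_⟩ hna
    have : ⁅(x : H), (y : H)⁆ ∈ ⁅J, J⁆ := LieSubmodule.lie_mem_lie x.2 y.2
    rw [h, LieSubmodule.mem_bot] at this
    exact Subtype.ext this
  · exact h

theorem exists_eq_add_of_ideal (b : LinearMap.BilinForm ℝ H) (hsymm : ∀ x y, b x y = b y x)
    (hpos : ∀ x, x ≠ 0 → 0 < b x x) (I : LieIdeal ℝ H) (x : H) :
    ∃ y ∈ I, ∃ z, (∀ w ∈ I, b w z = 0) ∧ x = y + z := by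
  have h := (isCompl_orthogonal_of_posDef b hsymm hpos I.toSubmodule).sup_eq_top
  obtain ⟨y, hy, z, hz, rfl⟩ := Submodule.mem_sup.1 (h ▸ Submodule.mem_top : x ∈ _)
  exact ⟨y, hy, z, hz, rfl⟩

variable (b : LinearMap.BilinForm ℝ H) (hsymm : ∀ x y, b x y = b y x)
  (hpos : ∀ x, x ≠ 0 → 0 < b x x) (hinv : ∀ x y z : H, b ⁅x, y⁆ z = -b y ⁅x, z⁆)

include hinv hpos hsymm

omit [FiniteDimensional ℝ H] in
-- By invariance |[x, y]|² equals the pairing of x with [y, [x, y]] ∈ I, which vanishes.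
theorem lie_eq_zero_of_mem_orthogonal (I : LieIdeal ℝ H) {x y : H} (hx : ∀ z ∈ I, b z x = 0)
    (hy : y ∈ I) : ⁅x, y⁆ = 0 := by
  by_contra hne
  refine (hpos _ hne).ne' ?_
  have h1 : ⁅x, y⁆ ∈ I := lie_mem_right ℝ H I x y hy
  have h2 : ⁅y, ⁅x, y⁆⁆ ∈ I := lie_mem_right ℝ H I y _ h1
  have h3 : ⁅x, y⁆ = -⁅y, x⁆ := (lie_skew x y).symm
  calc b ⁅x, y⁆ ⁅x, y⁆ = b (-⁅y, x⁆) ⁅x, y⁆ := congrArg (fun t ↦ b t ⁅x, y⁆) h3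
    _ = -b ⁅y, x⁆ ⁅x, y⁆ := by rw [map_neg, LinearMap.neg_apply]
    _ = b ⁅y, ⁅x, y⁆⁆ x := by rw [hinv, neg_neg, hsymm]
    _ = 0 := hx _ h2

/-- The orthogonal complement of J acts trivially on J, so an ideal of J is already an ideal of H.
Simplicity of J as a Lie algebra therefore becomes minimality among the ideals of H. -/
theorem isSimple_iff_isAtom_and_not_isLieAbelian (J : LieIdeal ℝ H) :
    LieAlgebra.IsSimple ℝ J ↔ IsAtom J ∧ ¬ IsLieAbelian J := by
  constructor
  · intro h
    refine ⟨⟨?_, fun I hI ↦ ?_⟩, h.non_abelian⟩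
    · rintro rfl
      exact h.non_abelian inferInstance
    · rcases h.eq_bot_or_eq_top (LieIdeal.comap J.incl I) with h0 | h0
      · rw [eq_bot_iff]
        intro x hx
        have : (⟨x, hI.le hx⟩ : J) ∈ LieIdeal.comap J.incl I := LieIdeal.mem_comap.2 hx
        rw [h0, LieSubmodule.mem_bot] at this
        exact (LieSubmodule.mem_bot _).2 congr(($this : H))
      · refine absurd ?_ hI.not_ge
        intro x hx
        have : (⟨x, hx⟩ : J) ∈ LieIdeal.comap J.incl I := h0 ▸ LieSubmodule.mem_top _
        exact LieIdeal.mem_comap.1 this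
  · rintro ⟨hJ, hna⟩
    refine ⟨fun K ↦ ?_, hna⟩
    let K' : LieIdeal ℝ H :=
      { K.toSubmodule.map J.toSubmodule.subtype with
        lie_mem := by
          rintro x _ ⟨y, hy, rfl⟩
          obtain ⟨u, hu, z, hz, rfl⟩ := exists_eq_add_of_ideal b hsymm hpos J x
          refine ⟨⁅(⟨u, hu⟩ : J), y⁆, lie_mem_right ℝ J K _ y hy, ?_⟩
          have h0 : ⁅z, (y : H)⁆ = 0 :=
            lie_eq_zero_of_mem_orthogonal b hsymm hpos hinv J hz y.2
          change ⁅u, (y : H)⁆ = ⁅u + z, (y : H)⁆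
          rw [add_lie, h0, add_zero] }
    have hK' : ∀ x : J, (x : H) ∈ K' ↔ x ∈ K := fun x ↦
      ⟨fun ⟨y, hy, hyx⟩ ↦ by rwa [← Subtype.ext hyx], fun hx ↦ ⟨x, hx, rfl⟩⟩
    have hle : K' ≤ J := by
      rintro _ ⟨y, -, rfl⟩
      exact y.2
    rcases hJ.le_iff.1 hle with h0 | h0
    · left
      rw [eq_bot_iff]
      intro x hx
      have := (hK' x).2 hx
      rw [h0, LieSubmodule.mem_bot] at this
      exact (LieSubmodule.mem_bot _).2 (Subtype.ext this)
    · right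
      rw [eq_top_iff]
      intro x _
      exact (hK' x).1 (by rw [h0]; exact x.2)

/-- A real Lie algebra with an invariant inner product is the direct sum of its centre and its
finitely many simple ideals. -/
theorem exists_isInternal_center_simple_ideals :
    ∃ (n : ℕ) (l : Fin n → LieIdeal ℝ H), Function.Injective l ∧
      (∀ J : LieIdeal ℝ H, LieAlgebra.IsSimple ℝ J ↔ ∃ i, l i = J) ∧
      (∀ i, ⁅l i, l i⁆ = l i) ∧
      DirectSum.IsInternal (fun j : Option (Fin n) ↦
        (j.elim (LieAlgebra.center ℝ H) l).toSubmodule) := by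
  classical
  let S := {J : LieIdeal ℝ H // LieAlgebra.IsSimple ℝ J}
  have hS : ∀ J : S, IsAtom J.1 ∧ ¬ IsLieAbelian J.1 := fun J ↦
    (isSimple_iff_isAtom_and_not_isLieAbelian b hsymm hpos hinv J.1).1 J.2
  have hperf : ∀ J : S, ⁅J.1, J.1⁆ = J.1 := fun J ↦ lie_self_eq_of_isAtom (hS J).1 (hS J).2
  have hcen : ∀ (J : S), ∀ x ∈ J.1, ∀ z ∈ LieAlgebra.center ℝ H, b x z = 0 := fun J x hx z hz ↦
    bilinForm_eq_zero_of_mem_perfect b hinv (hperf J) hx fun u _ ↦ hz u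
  have horth : ∀ J J' : S, J ≠ J' → ∀ x ∈ J.1, ∀ y ∈ J'.1, b x y = 0 := by
    intro J J' hne x hx y hy
    refine bilinForm_eq_zero_of_mem_perfect b hinv (hperf J) hx fun u hu ↦ ?_
    have h1 : ⁅u, y⁆ ∈ J.1 ⊓ J'.1 :=
      ⟨lie_mem_left ℝ H J.1 u y hu, lie_mem_right ℝ H J'.1 u y hy⟩
    rw [((hS J).1.disjoint_of_ne (hS J').1 fun h ↦ hne (Subtype.ext h)).eq_bot] at h1
    exact (LieSubmodule.mem_bot _).1 h1
  -- Pairwise orthogonal nonzero subspaces are independent, so finite dimension bounds their number.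
  have hfin : Finite S := by
    refine WellFoundedGT.finite_of_iSupIndep (t := fun J : S ↦ J.1.toSubmodule)
      (iSupIndep_of_pairwise_orthogonal b hpos _ horth) fun J h ↦ (hS J).1.1 ?_
    exact (LieSubmodule.toSubmodule_eq_bot _).1 h
  obtain ⟨n, ⟨eqv⟩⟩ := Finite.exists_equiv_fin S
  refine ⟨n, fun i ↦ (eqv.symm i).1, fun i j h ↦ eqv.symm.injective (Subtype.ext h), fun J ↦
    ⟨fun h ↦ ⟨eqv ⟨J, h⟩, by simp⟩, ?_⟩, fun i ↦ hperf _, ?_⟩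
  · rintro ⟨i, rfl⟩
    exact (eqv.symm i).2
  rw [DirectSum.isInternal_submodule_iff_iSupIndep_and_iSup_eq_top]
  refine ⟨iSupIndep_of_pairwise_orthogonal b hpos _ ?_, ?_⟩
  · rintro (_ | i) (_ | j) hij x hx y hy
    · exact absurd rfl hij
    · exact (hsymm x y).trans (hcen _ y hy x hx)
    · exact hcen _ x hx y hy
    · exact horth _ _ (fun h ↦ hij (congrArg some (eqv.symm.injective h))) x hx y hy
  set U : LieIdeal ℝ H := LieAlgebra.center ℝ H ⊔ ⨆ i, (eqv.symm i).1 with hU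
  have hUe : (⨆ j : Option (Fin n),
      (j.elim (LieAlgebra.center ℝ H) fun i ↦ (eqv.symm i).1).toSubmodule) = U.toSubmodule := by
    rw [iSup_option, hU, LieSubmodule.sup_toSubmodule, LieSubmodule.iSup_toSubmodule]
    rfl
  let O : LieIdeal ℝ H :=
    { LinearMap.BilinForm.orthogonal b U.toSubmodule with
      lie_mem := by
        intro x m hm w hw
        have h := hm _ (lie_mem_right ℝ H U x w hw)
        have h' := hinv x w m
        change b w ⁅x, m⁆ = 0
        change b ⁅x, w⁆ m = 0 at h
        linarith }
  have hUO : ∀ x ∈ U, x ∈ O → x = 0 := fun x hx hx' ↦ by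
    by_contra hne
    exact (hpos x hne).ne' (hx' x hx)
  -- A minimal ideal inside O would be abelian, hence central, or else simple. Either way it lies in
  -- U, which meets O trivially.
  have hO : O = ⊥ := by
    by_contra hne
    have : IsAtomic (LieIdeal ℝ H) := 
      isAtomic_of_orderBot_wellFounded_lt
        (LieSubmodule.wellFoundedLT_of_isArtinian ℝ H H).wf
    obtain ⟨A, hA, hAO⟩ := (eq_bot_or_exists_atom_le O).resolve_left hne
    have hAU : A ≤ U := by
      by_cases hab : IsLieAbelian A
      · refine le_trans (b := LieAlgebra.center ℝ H) ?_ le_sup_left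
        intro x hx h
        obtain ⟨y, hy, z, hz, rfl⟩ := exists_eq_add_of_ideal b hsymm hpos A h
        rw [add_lie, lie_eq_zero_of_mem_orthogonal b hsymm hpos hinv A hz hx, add_zero]
        exact congrArg Subtype.val (hab.trivial ⟨y, hy⟩ ⟨x, hx⟩)
      · refine le_trans ?_ (le_sup_right.trans' (le_iSup (fun i ↦ (eqv.symm i).1)
          (eqv ⟨A, (isSimple_iff_isAtom_and_not_isLieAbelian b hsymm hpos hinv A).2 ⟨hA, hab⟩⟩)))
        simp
    refine hA.1 ((LieSubmodule.eq_bot_iff _).2 fun x hx ↦ hUO x (hAU hx) (hAO hx))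
  have hOs : LinearMap.BilinForm.orthogonal b U.toSubmodule = ⊥ := by
    have : O.toSubmodule = ⊥ := by rw [hO]; rfl
    exact this
  have h := (isCompl_orthogonal_of_posDef b hsymm hpos U.toSubmodule).sup_eq_top
  rw [hOs, sup_bot_eq] at h
  exact hUe.trans h

end CompactLieAlgebra

/-! ### The trace inner product on bivectors -/

section SoTangent

variable {V : Type*} [NormedAddCommGroup V] [InnerProductSpace ℝ V] [FiniteDimensional ℝ V]

omit [FiniteDimensional ℝ V] in
theorem soInner_eq_sum {ι : Type*} [Fintype ι] (e : OrthonormalBasis ι ℝ V) (A B : soTangent V) :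
    soInner A B = ∑ i, inner ℝ (A.1 (e i)) (B.1 (e i)) := by
  rw [soInner, LinearMap.trace_eq_sum_inner _ e, ← Finset.sum_neg_distrib]
  refine Finset.sum_congr rfl fun i _ ↦ ?_
  rw [LinearMap.comp_apply, real_inner_comm, A.2, neg_neg, real_inner_comm]

omit [FiniteDimensional ℝ V] in
theorem soInner_comm (A B : soTangent V) : soInner A B = soInner B A := by
  rw [soInner, soInner, ← Module.End.mul_eq_comp, LinearMap.trace_mul_comm, Module.End.mul_eq_comp]

omit [FiniteDimensional ℝ V] in
theorem wedge_apply (X Y Z : V) : (wedge X Y).1 Z = inner ℝ X Z • Y - inner ℝ Y Z • X := rfl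

/-- The factor 2 appears because, S being skew, the two rank-one terms of the wedge contribute
equally. -/
theorem soInner_wedge (S : soTangent V) (X Y : V) :
    soInner S (wedge X Y) = -2 * inner ℝ X (S.1 Y) := by
  let e := stdOrthonormalBasis ℝ V
  have h1 : ∀ X Y : V, ∑ i, inner ℝ X (e i) * inner ℝ (S.1 (e i)) Y = -inner ℝ X (S.1 Y) := by
    intro X Y
    rw [← e.sum_inner_mul_inner X (S.1 Y), ← Finset.sum_neg_distrib]
    refine Finset.sum_congr rfl fun i _ ↦ ?_
    rw [S.2, mul_neg]
  rw [soInner_eq_sum e]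
  simp only [wedge_apply, inner_sub_right, real_inner_smul_right, Finset.sum_sub_distrib, h1]
  rw [← neg_eq_iff_eq_neg.2 (S.2 Y X), real_inner_comm]
  ring

theorem eq_of_forall_soInner_wedge {S S' : soTangent V}
    (h : ∀ X Y, soInner S (wedge X Y) = soInner S' (wedge X Y)) : S = S' := by
  refine Subtype.ext (LinearMap.ext fun Y ↦ ext_inner_left ℝ fun X ↦ ?_)
  have := h X Y
  rw [soInner_wedge, soInner_wedge] at this
  linarith

omit [FiniteDimensional ℝ V] in
-- Shows that wedges span 𝔰𝔬(V), so an operator on it is determined by its values on wedges. The sum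
-- counts A twice because each of the two terms of a wedge reproduces A.
theorem sum_wedge_apply {ι : Type*} [Fintype ι] (e : OrthonormalBasis ι ℝ V) (A : soTangent V) :
    ∑ i, wedge (e i) (A.1 (e i)) = (2 : ℝ) • A := by
  refine Subtype.ext (LinearMap.ext fun x ↦ ?_)
  have h1 : ∑ i, inner ℝ (e i) x • A.1 (e i) = A.1 x := by
    conv_rhs => rw [← e.sum_repr' x, map_sum]
    simp only [map_smul]
  have h2 : ∑ i, inner ℝ (A.1 (e i)) x • e i = -A.1 x := by
    conv_rhs => rw [← e.sum_repr' (A.1 x), ← Finset.sum_neg_distrib]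
    refine Finset.sum_congr rfl fun i _ ↦ ?_
    rw [A.2, neg_smul]
  have h3 : (∑ i, wedge (e i) (A.1 (e i))).1 x = ∑ i, (wedge (e i) (A.1 (e i))).1 x := by
    rw [AddSubmonoidClass.coe_finsetSum, LinearMap.sum_apply]
  rw [h3]
  simp only [wedge_apply, Finset.sum_sub_distrib, h1, h2]
  change _ = (2 : ℝ) • A.1 x
  rw [two_smul, sub_neg_eq_add]

theorem soTangent_hom_ext {W : Type*} [AddCommGroup W] [Module ℝ W] {f g : soTangent V →ₗ[ℝ] W}
    (h : ∀ X Y, f (wedge X Y) = g (wedge X Y)) : f = g := by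
  refine LinearMap.ext fun A ↦ ?_
  have h1 : f ((2 : ℝ) • A) = g ((2 : ℝ) • A) := by
    rw [← sum_wedge_apply (stdOrthonormalBasis ℝ V) A, map_sum, map_sum]
    exact Finset.sum_congr rfl fun i _ ↦ h _ _
  rw [map_smul, map_smul] at h1
  exact smul_right_injective W (two_ne_zero (α := ℝ)) h1

end SoTangent

/-! ### Orthogonal symmetric pairs and the isotropy representation -/

/-- `L = 𝔥 ⊕ j V` is an effective symmetric pair that is orthogonal for the Killing form, and `j` is
an isometry from the Euclidean space `V` onto its image with minus the Killing form. -/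
structure IsOrthogonalSymmetricPair {L : Type*} [LieRing L] [LieAlgebra ℝ L]
    (𝔥 : LieSubalgebra ℝ L) {V : Type*} [NormedAddCommGroup V] [InnerProductSpace ℝ V]
    (j : V →ₗ[ℝ] L) : Prop where
  isCompl : IsCompl 𝔥.toSubmodule (LinearMap.range j)
  inner_eq : ∀ u v, inner ℝ u v = -killingForm ℝ L (j u) (j v)
  orthogonal : ∀ Z ∈ 𝔥, ∀ u, killingForm ℝ L Z (j u) = 0
  lie_mem_range : ∀ Z ∈ 𝔥, ∀ u, ⁅Z, j u⁆ ∈ LinearMap.range j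
  lie_mem : ∀ u v, ⁅j u, j v⁆ ∈ 𝔥
  effective : ∀ J : LieIdeal ℝ L, J.toSubmodule ≤ 𝔥.toSubmodule → J = ⊥

namespace IsOrthogonalSymmetricPair

variable {L : Type*} [LieRing L] [LieAlgebra ℝ L] [FiniteDimensional ℝ L]
  {𝔥 : LieSubalgebra ℝ L} {V : Type*} [NormedAddCommGroup V] [InnerProductSpace ℝ V]
  [FiniteDimensional ℝ V] {j : V →ₗ[ℝ] L}

/-- Minus the adjoint of `j` for the Killing form. -/
noncomputable def proj (j : V →ₗ[ℝ] L) : L →ₗ[ℝ] V :=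
  ∑ i, ((killingForm ℝ L).flip (-j (stdOrthonormalBasis ℝ V i))).smulRight
    (stdOrthonormalBasis ℝ V i)

omit [FiniteDimensional ℝ L] in
theorem proj_apply (x : L) : proj j x =
    ∑ i, (-killingForm ℝ L x (j (stdOrthonormalBasis ℝ V i))) • stdOrthonormalBasis ℝ V i := by
  simp [proj, LinearMap.sum_apply]

variable (h : IsOrthogonalSymmetricPair 𝔥 j)

include h

omit [FiniteDimensional ℝ L]

omit [FiniteDimensional ℝ V] in
theorem injective : Function.Injective j := by
  refine (injective_iff_map_eq_zero j).2 fun u hu ↦ ?_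
  have := h.inner_eq u u
  rw [hu] at this
  simpa using this

theorem proj_j (u : V) : proj j (j u) = u := by
  rw [proj_apply]
  conv_rhs => rw [← (stdOrthonormalBasis ℝ V).sum_repr' u]
  refine Finset.sum_congr rfl fun i _ ↦ ?_
  rw [← h.inner_eq, real_inner_comm]

theorem proj_eq_zero {Z : L} (hZ : Z ∈ 𝔥) : proj j Z = 0 := by
  rw [proj_apply]
  exact Finset.sum_eq_zero fun i _ ↦ by rw [h.orthogonal Z hZ, neg_zero, zero_smul]

theorem j_proj {x : L} (hx : x ∈ LinearMap.range j) : j (proj j x) = x := by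
  obtain ⟨u, rfl⟩ := hx
  rw [h.proj_j]

theorem sub_mem (x : L) : x - j (proj j x) ∈ 𝔥.toSubmodule := by
  obtain ⟨Z, hZ, _, ⟨u, rfl⟩, rfl⟩ := Submodule.mem_sup.1
    (h.isCompl.sup_eq_top ▸ Submodule.mem_top : x ∈ 𝔥.toSubmodule ⊔ LinearMap.range j)
  rw [map_add, h.proj_eq_zero hZ, h.proj_j, zero_add, add_sub_cancel_right]
  exact hZ

theorem inner_proj (x : L) (u : V) : inner ℝ (proj j x) u = -killingForm ℝ L x (j u) := by
  have h1 := h.orthogonal _ (h.sub_mem x) u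
  rw [map_sub, LinearMap.sub_apply] at h1
  rw [h.inner_eq]
  linarith

/-- The projection onto `𝔥` along the image of `j`. -/
noncomputable def projSubalgebra : L →ₗ[ℝ] 𝔥 :=
  (LinearMap.id - j ∘ₗ proj j).codRestrict 𝔥.toSubmodule h.sub_mem

/-- Insert the decomposition of the identity into the two projections after f, then use cyclicity of
the trace on each term. No invariance of the summands under f is needed. -/
theorem trace_eq_add [FiniteDimensional ℝ L] (f : L →ₗ[ℝ] L) : LinearMap.trace ℝ L f =
    LinearMap.trace ℝ V (proj j ∘ₗ f ∘ₗ j) +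
      LinearMap.trace ℝ 𝔥 (h.projSubalgebra ∘ₗ f ∘ₗ (𝔥.incl : 𝔥 →ₗ[ℝ] L)) := by
  have h1 : f = (f ∘ₗ j) ∘ₗ proj j + (f ∘ₗ (𝔥.incl : 𝔥 →ₗ[ℝ] L)) ∘ₗ h.projSubalgebra := by
    refine LinearMap.ext fun x ↦ ?_
    change f x = f (j (proj j x)) + f (x - j (proj j x))
    rw [← map_add, add_sub_cancel]
  conv_lhs => rw [h1, map_add]
  rw [LinearMap.trace_comp_comm' (f ∘ₗ j), LinearMap.trace_comp_comm' (f ∘ₗ _)]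

/-- The isotropy representation of the symmetric pair. -/
noncomputable def isotropy : 𝔥 →ₗ[ℝ] soTangent V :=
  LinearMap.codRestrict (soTangent V)
    { toFun := fun Z ↦ proj j ∘ₗ (LieAlgebra.ad ℝ L Z : L →ₗ[ℝ] L) ∘ₗ j
      map_add' := fun Z Z' ↦ by ext u; simp
      map_smul' := fun c Z ↦ by ext u; simp } fun Z u v ↦ by
    change inner ℝ (proj j ⁅(Z : L), j u⁆) v = -inner ℝ u (proj j ⁅(Z : L), j v⁆)
    rw [h.inner_proj, real_inner_comm, h.inner_proj, ← lie_skew, map_neg, LinearMap.neg_apply,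
      LieModule.traceForm_apply_lie_apply, LieModule.traceForm_comm]

theorem j_isotropy (Z : 𝔥) (u : V) : j ((h.isotropy Z).1 u) = ⁅(Z : L), j u⁆ :=
  h.j_proj (h.lie_mem_range Z Z.2 u)

/-- The elements of 𝔥 that annihilate 𝔭 form an ideal of all of L: bracketing with 𝔭 gives zero, and
bracketing with 𝔥 stays inside because 𝔥 preserves 𝔭. Effectiveness kills this ideal. -/
theorem isotropy_injective : Function.Injective h.isotropy := by
  refine (injective_iff_map_eq_zero _).2 fun Z hZ ↦ ?_
  let J : LieIdeal ℝ L :=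
    { carrier := {Z | Z ∈ 𝔥 ∧ ∀ u, ⁅Z, j u⁆ = 0}
      add_mem' := fun {a b} ha hb ↦ ⟨add_mem ha.1 hb.1, fun u ↦ by
        rw [add_lie, ha.2, hb.2, add_zero]⟩
      zero_mem' := ⟨zero_mem 𝔥, fun u ↦ zero_lie _⟩
      smul_mem' := fun c a ha ↦ ⟨𝔥.smul_mem c ha.1, fun u ↦ by rw [smul_lie, ha.2, smul_zero]⟩
      lie_mem := by
        intro x a ha
        have hx : x = (x - j (proj j x)) + j (proj j x) := (sub_add_cancel _ _).symm
        have h1 : ⁅x, a⁆ = ⁅x - j (proj j x), a⁆ := by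
          conv_lhs => rw [hx]
          rw [add_lie, ← lie_skew (j (proj j x)) a, ha.2, neg_zero, add_zero]
        change ⁅x, a⁆ ∈ 𝔥 ∧ ∀ u, ⁅⁅x, a⁆, j u⁆ = 0
        rw [h1]
        refine ⟨𝔥.lie_mem (h.sub_mem x) ha.1, fun u ↦ ?_⟩
        obtain ⟨v, hv⟩ := h.lie_mem_range _ (h.sub_mem x) u
        rw [lie_lie, ha.2, ← hv, ha.2, lie_zero, sub_zero] }
  have hJ : J = ⊥ := h.effective J fun Z hZ ↦ hZ.1
  have : (Z : L) ∈ J := ⟨Z.2, fun u ↦ by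
    rw [← h.j_isotropy, hZ]
    exact map_zero j⟩
  rw [hJ, LieSubmodule.mem_bot] at this
  exact Subtype.ext this

end IsOrthogonalSymmetricPair

/-! ### Positivity of the trace form -/

section SoForm

variable {V : Type*} [NormedAddCommGroup V] [InnerProductSpace ℝ V]

/-- The inner product of `𝔰𝔬(V)` as a bilinear form. -/
noncomputable def soForm (V : Type*) [NormedAddCommGroup V] [InnerProductSpace ℝ V] :
    LinearMap.BilinForm ℝ (soTangent V) :=
  LinearMap.mk₂ ℝ soInner
    (fun A B C ↦ by simp [soInner, LinearMap.add_comp]; ring)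
    (fun c A B ↦ by simp [soInner, LinearMap.smul_comp])
    (fun A B C ↦ by simp [soInner, LinearMap.comp_add]; ring)
    (fun c A B ↦ by simp [soInner, LinearMap.comp_smul])

theorem soInner_self_pos [FiniteDimensional ℝ V] {A : soTangent V} (hA : A ≠ 0) :
    0 < soInner A A := by
  rw [soInner_eq_sum (stdOrthonormalBasis ℝ V)]
  refine lt_of_le_of_ne (Finset.sum_nonneg fun i _ ↦ real_inner_self_nonneg) fun h0 ↦ hA ?_
  refine Subtype.ext ((stdOrthonormalBasis ℝ V).toBasis.ext fun i ↦ ?_)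
  have := (Finset.sum_eq_zero_iff_of_nonneg fun i _ ↦ real_inner_self_nonneg).1 h0.symm i
    (Finset.mem_univ i)
  simpa using this

end SoForm

/-! ### The Killing form on 𝔥 and the operator C = κ ∘ ι -/

namespace IsOrthogonalSymmetricPair

variable {L : Type*} [LieRing L] [LieAlgebra ℝ L] [FiniteDimensional ℝ L]
  {𝔥 : LieSubalgebra ℝ L} {V : Type*} [NormedAddCommGroup V] [InnerProductSpace ℝ V]
  [FiniteDimensional ℝ V] {j : V →ₗ[ℝ] L} (h : IsOrthogonalSymmetricPair 𝔥 j)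

omit [FiniteDimensional ℝ L] in
theorem isotropy_lie (Z Z' : 𝔥) : (h.isotropy ⁅Z, Z'⁆).1 =
    (h.isotropy Z).1 * (h.isotropy Z').1 - (h.isotropy Z').1 * (h.isotropy Z).1 := by
  refine LinearMap.ext fun u ↦ h.injective ?_
  rw [LinearMap.sub_apply, map_sub, Module.End.mul_apply, Module.End.mul_apply]
  simp only [h.j_isotropy]
  exact lie_lie _ _ _

omit [FiniteDimensional ℝ L] in
-- The isotropy map is a homomorphism and the trace is cyclic, so the pulled-back form is invariant.
-- By injectivity it is also an inner product on 𝔥.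
theorem soInner_isotropy_lie (Z x y : 𝔥) : soInner (h.isotropy ⁅Z, x⁆) (h.isotropy y) =
    -soInner (h.isotropy x) (h.isotropy ⁅Z, y⁆) := by
  simp only [soInner, isotropy_lie, ← Module.End.mul_eq_comp, sub_mul, mul_sub, map_sub]
  have := LinearMap.trace_mul_comm ℝ (h.isotropy Z).1 ((h.isotropy x).1 * (h.isotropy y).1)
  simp only [mul_assoc] at this ⊢
  linarith

/-- Both 𝔭 and 𝔥 are stable under 𝔥, so the trace splits into blocks: the 𝔭-block is the trace form
of the isotropy representation, the 𝔥-block the intrinsic Killing form. -/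
theorem killingForm_subalgebra (Z Z' : 𝔥) : killingForm ℝ L Z Z' =
    -soInner (h.isotropy Z) (h.isotropy Z') + killingForm ℝ 𝔥 Z Z' := by
  rw [killingForm_apply_apply, h.trace_eq_add, killingForm_apply_apply, soInner, neg_neg]
  congr 2
  · refine LinearMap.ext fun u ↦ ?_
    change proj j ⁅(Z : L), ⁅(Z' : L), j u⁆⁆ = (h.isotropy Z).1 ((h.isotropy Z').1 u)
    refine h.injective ?_
    rw [h.j_isotropy, h.j_isotropy, h.j_proj]
    rw [← h.j_isotropy]
    exact h.lie_mem_range Z Z.2 _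
  · refine LinearMap.ext fun W ↦ Subtype.ext ?_
    change ⁅(Z : L), ⁅(Z' : L), (W : L)⁆⁆ - j (proj j ⁅(Z : L), ⁅(Z' : L), (W : L)⁆⁆) =
      ⁅(Z : L), ⁅(Z' : L), (W : L)⁆⁆
    rw [h.proj_eq_zero (𝔥.lie_mem Z.2 (𝔥.lie_mem Z'.2 W.2)), map_zero, sub_zero]

include h in
-- On 𝔥, ad Z is skew for the inner product pulled back from 𝔰𝔬(V).
theorem killingForm_self_nonpos (Z : 𝔥) : killingForm ℝ 𝔥 Z Z ≤ 0 ∧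
    (killingForm ℝ 𝔥 Z Z = 0 → ∀ x : 𝔥, ⁅Z, x⁆ = 0) := by
  have := trace_sq_nonpos_of_skew ((soForm V).compl₁₂ h.isotropy h.isotropy)
    (fun x y ↦ soInner_comm _ _)
    (fun x hx ↦ soInner_self_pos fun h0 ↦ hx (h.isotropy_injective (h0.trans (map_zero _).symm)))
    (LieAlgebra.ad ℝ 𝔥 Z) (fun x y ↦ h.soInner_isotropy_lie Z x y)
  rw [killingForm_apply_apply]
  exact ⟨this.1, fun h0 x ↦ congrArg (fun f : 𝔥 →ₗ[ℝ] 𝔥 ↦ f x) (this.2 h0)⟩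

/-- Minus the Killing form of `L`, restricted to `𝔥`. -/
noncomputable def _root_.LieSubalgebra.negKillingForm (𝔥 : LieSubalgebra ℝ L) :
    LinearMap.BilinForm ℝ 𝔥 :=
  -(killingForm ℝ L).compl₁₂ (𝔥.incl : 𝔥 →ₗ[ℝ] L) (𝔥.incl : 𝔥 →ₗ[ℝ] L)

omit [FiniteDimensional ℝ L] in
theorem _root_.LieSubalgebra.negKillingForm_apply (Z Z' : 𝔥) :
    𝔥.negKillingForm Z Z' = -killingForm ℝ L Z Z' := rfl

omit [FiniteDimensional ℝ L] in
theorem _root_.LieSubalgebra.negKillingForm_comm (Z Z' : 𝔥) :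
    𝔥.negKillingForm Z Z' = 𝔥.negKillingForm Z' Z := by
  rw [LieSubalgebra.negKillingForm_apply, LieModule.traceForm_comm]
  rfl

omit [FiniteDimensional ℝ L] in
theorem _root_.LieSubalgebra.negKillingForm_lie (Z x y : 𝔥) :
    𝔥.negKillingForm ⁅Z, x⁆ y = -𝔥.negKillingForm x ⁅Z, y⁆ := by
  simp only [LieSubalgebra.negKillingForm_apply, LieSubalgebra.coe_bracket]
  rw [← lie_skew, map_neg, LinearMap.neg_apply, LieModule.traceForm_apply_lie_apply]

include h in
theorem negKillingForm_pos (Z : 𝔥) (hZ : Z ≠ 0) : 0 < 𝔥.negKillingForm Z Z := by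
  have h1 : 0 < soInner (h.isotropy Z) (h.isotropy Z) :=
    soInner_self_pos fun h0 ↦ hZ (h.isotropy_injective (h0.trans (map_zero _).symm))
  have h2 := (h.killingForm_self_nonpos Z).1
  rw [LieSubalgebra.negKillingForm_apply, h.killingForm_subalgebra]
  linarith

include h in
theorem ext_negKillingForm {Z Z' : 𝔥}
    (hZ : ∀ x, 𝔥.negKillingForm Z x = 𝔥.negKillingForm Z' x) : Z = Z' := by
  by_contra hne
  refine (h.negKillingForm_pos (Z - Z') (sub_ne_zero.2 hne)).ne' ?_
  rw [map_sub (𝔥.negKillingForm), LinearMap.sub_apply, hZ, sub_self]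

include h in
theorem negKillingForm_nondegenerate : 𝔥.negKillingForm.Nondegenerate :=
  ⟨fun x hx ↦ by_contra fun h0 ↦ (h.negKillingForm_pos x h0).ne' (hx x),
    fun x hx ↦ by_contra fun h0 ↦ (h.negKillingForm_pos x h0).ne' (hx x)⟩

/-- Half the adjoint of the isotropy representation. -/
noncomputable def coIsotropy : soTangent V →ₗ[ℝ] 𝔥 :=
  (𝔥.negKillingForm.toDual h.negKillingForm_nondegenerate).symm.toLinearMap ∘ₗ
    ((1 / 2 : ℝ) • (soForm V).compl₂ h.isotropy)

theorem negKillingForm_coIsotropy (A : soTangent V) (Z : 𝔥) :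
    𝔥.negKillingForm (h.coIsotropy A) Z = 1 / 2 * soInner A (h.isotropy Z) :=
  LinearMap.BilinForm.apply_toDual_symm_apply (hB := h.negKillingForm_nondegenerate) _ _

/-- Pairing with Z turns this into invariance of the Killing form. The half in `coIsotropy` cancels
the 2 of `soInner_wedge`. -/
theorem coIsotropy_wedge (X Y : V) : h.coIsotropy (wedge X Y) = ⟨⁅j X, j Y⁆, h.lie_mem X Y⟩ := by
  refine h.ext_negKillingForm fun Z ↦ ?_
  rw [h.negKillingForm_coIsotropy, soInner_comm, soInner_wedge, h.inner_eq, h.j_isotropy,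
    LieSubalgebra.negKillingForm_apply, LieModule.traceForm_apply_lie_apply,
    ← lie_skew (j Y) (Z : L), map_neg]
  ring

/-- The operator on `𝔥` that corresponds to the curvature operator. -/
noncomputable def casimir : 𝔥 →ₗ[ℝ] 𝔥 := h.coIsotropy ∘ₗ h.isotropy

theorem negKillingForm_casimir (Z Z' : 𝔥) : 𝔥.negKillingForm (h.casimir Z) Z' =
    1 / 2 * soInner (h.isotropy Z) (h.isotropy Z') :=
  h.negKillingForm_coIsotropy _ _

/-- The identity that determines the spectrum: the deviation of C from one half is measured by the
intrinsic Killing form of 𝔥. -/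
theorem negKillingForm_casimir_eq_add (Z Z' : 𝔥) : 𝔥.negKillingForm (h.casimir Z) Z' =
    1 / 2 * 𝔥.negKillingForm Z Z' + 1 / 2 * killingForm ℝ 𝔥 Z Z' := by
  rw [h.negKillingForm_casimir, LieSubalgebra.negKillingForm_apply, h.killingForm_subalgebra]
  ring

theorem negKillingForm_casimir_comm (Z Z' : 𝔥) : 𝔥.negKillingForm (h.casimir Z) Z' =
    𝔥.negKillingForm Z (h.casimir Z') := by
  rw [LieSubalgebra.negKillingForm_comm Z, h.negKillingForm_casimir, h.negKillingForm_casimir,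
    soInner_comm]

/-- C compares two invariant forms, so it commutes with the adjoint action. -/
theorem casimir_lie (Z x : 𝔥) : h.casimir ⁅Z, x⁆ = ⁅Z, h.casimir x⁆ := by
  refine h.ext_negKillingForm fun y ↦ ?_
  rw [LieSubalgebra.negKillingForm_lie, h.negKillingForm_casimir, h.negKillingForm_casimir,
    h.soInner_isotropy_lie]
  ring

theorem casimir_of_mem_center {Z : 𝔥} (hZ : Z ∈ LieAlgebra.center ℝ 𝔥) :
    h.casimir Z = (1 / 2 : ℝ) • Z := by
  refine h.ext_negKillingForm fun y ↦ ?_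
  have h0 : LieAlgebra.ad ℝ 𝔥 Z = 0 := by
    refine LinearMap.ext fun x ↦ ?_
    rw [LieAlgebra.ad_apply, ← lie_skew, hZ x, neg_zero]
    rfl
  rw [h.negKillingForm_casimir_eq_add, killingForm_apply_apply, h0, LinearMap.zero_comp]
  simp

/-- Schur's argument over ℝ: symmetry supplies a real eigenvalue, and its eigenspace in J is a
nonzero ideal, hence J. -/
theorem exists_casimir_eq_smul_of_isSimple (J : LieIdeal ℝ 𝔥) (hJ : LieAlgebra.IsSimple ℝ J) :
    ∃ c : ℝ, 0 < c ∧ c < 1 / 2 ∧ ∀ Z ∈ J, h.casimir Z = c • Z := by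
  have hJ' := (isSimple_iff_isAtom_and_not_isLieAbelian 𝔥.negKillingForm
    LieSubalgebra.negKillingForm_comm h.negKillingForm_pos LieSubalgebra.negKillingForm_lie J).1 hJ
  have hperf := lie_self_eq_of_isAtom hJ'.1 hJ'.2
  -- J is perfect and C[u, v] = [u, Cv], which stays in J because u does.
  have hmap : ∀ Z ∈ J, h.casimir Z ∈ J := by
    intro Z hZ
    rw [← hperf, ← LieSubmodule.mem_toSubmodule,
      LieSubmodule.lieIdeal_oper_eq_linear_span'] at hZ
    induction hZ using Submodule.span_induction with
    | mem z hz =>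
      obtain ⟨u, hu, v, hv, rfl⟩ := hz
      rw [h.casimir_lie]
      exact lie_mem_left ℝ 𝔥 J _ _ hu
    | zero => rw [map_zero]; exact zero_mem J
    | add u v _ _ hu hv => rw [map_add]; exact add_mem hu hv
    | smul c u _ hu => rw [map_smul]; exact J.smul_mem c hu
  have hnt : Nontrivial J := by
    rw [LieSubmodule.nontrivial_iff_ne_bot]
    exact hJ'.1.1
  obtain ⟨c, x, hx, hxc⟩ := exists_eigenvector_of_symm
    (𝔥.negKillingForm.compl₁₂ J.toSubmodule.subtype J.toSubmodule.subtype)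
    (fun x y ↦ LieSubalgebra.negKillingForm_comm _ _)
    (fun x hx ↦ h.negKillingForm_pos _ fun h0 ↦ hx (Subtype.ext h0))
    (h.casimir.restrict hmap) (fun x y ↦ h.negKillingForm_casimir_comm _ _)
  have hx0 : (x : 𝔥) ≠ 0 := fun h0 ↦ hx (Subtype.ext h0)
  have hxc' : h.casimir x = c • (x : 𝔥) := congrArg Subtype.val hxc
  let A : LieIdeal ℝ 𝔥 :=
    { carrier := {Z | Z ∈ J ∧ h.casimir Z = c • Z}
      add_mem' := fun {a b} ha hb ↦ ⟨add_mem ha.1 hb.1, by rw [map_add, ha.2, hb.2, smul_add]⟩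
      zero_mem' := ⟨zero_mem J, by simp⟩
      smul_mem' := fun r a ha ↦ ⟨J.smul_mem r ha.1, by rw [map_smul, ha.2, smul_comm]⟩
      lie_mem := fun {y a} ha ↦ ⟨lie_mem_right ℝ 𝔥 J y a ha.1, by
        rw [h.casimir_lie, ha.2, lie_smul]⟩ }
  have hA : A = J := by
    refine (hJ'.1.le_iff.1 (show A ≤ J from fun Z hZ ↦ hZ.1)).resolve_left fun h0 ↦ hx0 ?_
    have : (x : 𝔥) ∈ A := ⟨x.2, hxc'⟩
    rw [h0, LieSubmodule.mem_bot] at this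
    exact this
  have hb := h.negKillingForm_pos _ hx0
  have h1 : 0 < soInner (h.isotropy x) (h.isotropy x) :=
    soInner_self_pos fun h0 ↦ hx0 (h.isotropy_injective (h0.trans (map_zero _).symm))
  have h2 := h.negKillingForm_casimir x x
  have h3 := h.negKillingForm_casimir_eq_add x x
  rw [hxc', map_smul, LinearMap.smul_apply, smul_eq_mul] at h2 h3
  refine ⟨c, ?_, ?_, fun Z hZ ↦ (show Z ∈ A from hA.symm ▸ hZ).2⟩
  -- `h2` reads c·(-B)(x, x) = ½|ιx|², with both norms positive.
  · by_contra hc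
    nlinarith
  · obtain ⟨h4, h5⟩ := h.killingForm_self_nonpos (x : 𝔥)
    -- A null vector of the Killing form of 𝔥 is central. Minimality would then put J inside the
    -- centre, making it abelian.
    have h6 : killingForm ℝ 𝔥 x x ≠ 0 := fun h0 ↦ by
      have hz := h5 h0
      refine hJ'.2 ?_
      have hc : (x : 𝔥) ∈ J ⊓ LieAlgebra.center ℝ 𝔥 :=
        ⟨x.2, fun y ↦ by rw [← lie_skew, hz, neg_zero]⟩
      have hle : J ≤ LieAlgebra.center ℝ 𝔥 := by
        rw [← inf_eq_left]
        refine (hJ'.1.le_iff.1 inf_le_left).resolve_left fun h0 ↦ hx0 ?_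
        rw [h0, LieSubmodule.mem_bot] at hc
        exact hc
      exact ⟨fun u v ↦ Subtype.ext (hle v.2 u)⟩
    have h7 := lt_of_le_of_ne h4 h6
    by_contra hc
    nlinarith

end IsOrthogonalSymmetricPair

/-! ### Eigenspaces and traces of operators scalar on the summands -/

section Eigenspaces

variable {W : Type*} [AddCommGroup W] [Module ℝ W]

/-- The summands with scalar c lie in the c-eigenspace, the others in the sum of the remaining
eigenspaces, which is independent of it. The modular law then gives equality. -/
theorem eigenspace_eq_iSup_of_isInternal {ι : Type*} [DecidableEq ι] {N : ι → Submodule ℝ W}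
    (hN : DirectSum.IsInternal N) (T : W →ₗ[ℝ] W) (s : ι → ℝ)
    (hT : ∀ i, ∀ x ∈ N i, T x = s i • x) (c : ℝ) :
    Module.End.eigenspace T c = ⨆ i : {i // s i = c}, N i := by
  have hle : ∀ i, N i ≤ Module.End.eigenspace T (s i) := fun i x hx ↦
    Module.End.mem_eigenspace_iff.2 (hT i x hx)
  have h1 : (⨆ i : {i // s i = c}, N i) ≤ Module.End.eigenspace T c :=
    iSup_le fun i ↦ (hle i).trans_eq (congrArg _ i.2)
  have h2 : (⨆ i : {i // s i ≠ c}, N i) ≤ ⨆ (d : ℝ) (_ : d ≠ c), Module.End.eigenspace T d :=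
    iSup_le fun i ↦ (hle i).trans (le_iSup₂_of_le (s i) i.2 le_rfl)
  have h3 : (⨆ i : {i // s i = c}, N i) ⊔ (⨆ i : {i // s i ≠ c}, N i) = ⊤ := by
    rw [eq_top_iff, ← hN.submodule_iSup_eq_top]
    refine iSup_le fun i ↦ ?_
    by_cases hi : s i = c
    · exact le_sup_of_le_left (le_iSup (fun i : {i // s i = c} ↦ N i) ⟨i, hi⟩)
    · exact le_sup_of_le_right (le_iSup (fun i : {i // s i ≠ c} ↦ N i) ⟨i, hi⟩)
  have h4 := (Module.End.eigenspaces_iSupIndep T c).mono_right h2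
  refine le_antisymm ?_ h1
  calc Module.End.eigenspace T c
      = ((⨆ i : {i // s i = c}, N i) ⊔ (⨆ i : {i // s i ≠ c}, N i)) ⊓
          Module.End.eigenspace T c := by rw [h3, top_inf_eq]
    _ = (⨆ i : {i // s i = c}, N i) ⊔
          ((⨆ i : {i // s i ≠ c}, N i) ⊓ Module.End.eigenspace T c) := sup_inf_assoc_of_le _ h1
    _ ≤ ⨆ i : {i // s i = c}, N i := by rw [inf_comm, h4.eq_bot, sup_bot_eq]

theorem trace_eq_sum_of_isInternal [FiniteDimensional ℝ W] {ι : Type*} [DecidableEq ι] [Fintype ι]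
    {N : ι → Submodule ℝ W} (hN : DirectSum.IsInternal N) (T : W →ₗ[ℝ] W) (s : ι → ℝ)
    (hT : ∀ i, ∀ x ∈ N i, T x = s i • x) :
    LinearMap.trace ℝ W T = ∑ i, s i * Module.finrank ℝ (N i) := by
  have hmap : ∀ i, Set.MapsTo T (N i) (N i) := fun i x hx ↦ by
    rw [hT i x hx]
    exact (N i).smul_mem _ hx
  rw [LinearMap.trace_eq_sum_trace_restrict hN hmap]
  refine Finset.sum_congr rfl fun i _ ↦ ?_
  have : T.restrict (hmap i) = s i • LinearMap.id := LinearMap.ext fun x ↦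
    Subtype.ext (hT i x x.2)
  rw [this, map_smul, LinearMap.trace_id, smul_eq_mul]

end Eigenspaces

/-! ### Spectrum of the curvature operator, Ricci sum and trace identity -/

namespace IsOrthogonalSymmetricPair

variable {L : Type*} [LieRing L] [LieAlgebra ℝ L] [FiniteDimensional ℝ L]
  {𝔥 : LieSubalgebra ℝ L} {V : Type*} [NormedAddCommGroup V] [InnerProductSpace ℝ V]
  [FiniteDimensional ℝ V] {j : V →ₗ[ℝ] L} (h : IsOrthogonalSymmetricPair 𝔥 j)

/-- The curvature operator of the symmetric pair. -/
noncomputable def curvatureOperator : soTangent V →ₗ[ℝ] soTangent V := h.isotropy ∘ₗ h.coIsotropy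

theorem curvatureOperator_isotropy (Z : 𝔥) :
    h.curvatureOperator (h.isotropy Z) = h.isotropy (h.casimir Z) := rfl

theorem soInner_curvatureOperator_wedge (X Y Z W : V) :
    soInner (h.curvatureOperator (wedge X Y)) (wedge Z W) =
      2 * killingForm ℝ L ⁅⁅j X, j Y⁆, j W⁆ (j Z) := by
  rw [soInner_wedge, h.inner_eq, curvatureOperator, LinearMap.comp_apply, h.j_isotropy,
    h.coIsotropy_wedge, LieModule.traceForm_comm]
  ring

theorem eq_curvatureOperator_iff (𝔯 : soTangent V →ₗ[ℝ] soTangent V) :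
    (∀ X Y Z W, soInner (𝔯 (wedge X Y)) (wedge Z W) =
      2 * killingForm ℝ L ⁅⁅j X, j Y⁆, j W⁆ (j Z)) ↔ 𝔯 = h.curvatureOperator := by
  constructor
  · exact fun h𝔯 ↦ soTangent_hom_ext fun X Y ↦ eq_of_forall_soInner_wedge fun Z W ↦
      (h𝔯 X Y Z W).trans (h.soInner_curvatureOperator_wedge X Y Z W).symm
  · rintro rfl
    exact h.soInner_curvatureOperator_wedge

/-- For c ≠ 0 the c-eigenspaces of ι ∘ κ and κ ∘ ι correspond under ι; the preimage of A is c⁻¹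
κ(A). -/
theorem eigenspace_curvatureOperator {c : ℝ} (hc : c ≠ 0) :
    Module.End.eigenspace h.curvatureOperator c =
      (Module.End.eigenspace h.casimir c).map h.isotropy := by
  ext A
  rw [Module.End.mem_eigenspace_iff, Submodule.mem_map]
  constructor
  · intro hA
    have hA' : h.isotropy (c⁻¹ • h.coIsotropy A) = A := by
      rw [map_smul, inv_smul_eq_iff₀ hc]
      exact hA
    refine ⟨_, Module.End.mem_eigenspace_iff.2 (h.isotropy_injective ?_), hA'⟩
    rw [← curvatureOperator_isotropy, map_smul h.isotropy c, hA', hA]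
  · rintro ⟨Z, hZ, rfl⟩
    rw [curvatureOperator_isotropy, Module.End.mem_eigenspace_iff.1 hZ, map_smul]

/-- Injectivity of ι reduces the kernel of ι ∘ κ to that of κ, and the kernel of an adjoint is the
orthogonal complement of the image. -/
theorem mem_eigenspace_zero_curvatureOperator_iff (A : soTangent V) :
    A ∈ Module.End.eigenspace h.curvatureOperator 0 ↔ ∀ Z, soInner A (h.isotropy Z) = 0 := by
  rw [Module.End.mem_eigenspace_iff, zero_smul, curvatureOperator, LinearMap.comp_apply,
    map_eq_zero_iff _ h.isotropy_injective]
  constructor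
  · intro hA Z
    have := h.negKillingForm_coIsotropy A Z
    rw [hA, map_zero, LinearMap.zero_apply] at this
    linarith
  · intro hA
    refine h.ext_negKillingForm fun Z ↦ ?_
    rw [h.negKillingForm_coIsotropy, hA, mul_zero, map_zero, LinearMap.zero_apply]

omit [FiniteDimensional ℝ L] in
include h in
-- In an orthonormal basis the 𝔭-trace is ∑ B([Y, eᵢ], [X, eᵢ]), visibly symmetric in X and Y.
theorem trace_proj_lie_lie_comm (X Y : L) :
    LinearMap.trace ℝ V (proj j ∘ₗ (LieAlgebra.ad ℝ L X ∘ₗ LieAlgebra.ad ℝ L Y) ∘ₗ j) =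
      LinearMap.trace ℝ V (proj j ∘ₗ (LieAlgebra.ad ℝ L Y ∘ₗ LieAlgebra.ad ℝ L X) ∘ₗ j) := by
  have key : ∀ X Y : L, LinearMap.trace ℝ V
      (proj j ∘ₗ (LieAlgebra.ad ℝ L X ∘ₗ LieAlgebra.ad ℝ L Y) ∘ₗ j) =
        ∑ i, killingForm ℝ L ⁅Y, j (stdOrthonormalBasis ℝ V i)⁆
          ⁅X, j (stdOrthonormalBasis ℝ V i)⁆ := by
    intro X Y
    rw [LinearMap.trace_eq_sum_inner _ (stdOrthonormalBasis ℝ V)]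
    refine Finset.sum_congr rfl fun i _ ↦ ?_
    rw [real_inner_comm]
    change inner ℝ (proj j ⁅X, ⁅Y, j (stdOrthonormalBasis ℝ V i)⁆⁆) _ = _
    rw [h.inner_proj, ← lie_skew, map_neg, LinearMap.neg_apply, neg_neg,
      LieModule.traceForm_apply_lie_apply]
  rw [key, key]
  exact Finset.sum_congr rfl fun i _ ↦ LieModule.traceForm_comm ..

include h in
-- Elements of 𝔭 interchange 𝔭 and 𝔥, so cyclicity identifies the 𝔥-trace of ad u ad v with the
-- 𝔭-trace of ad v ad u. With the symmetry above, each block carries half of the Killing form; this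
-- is the source of the Einstein constant.
theorem two_mul_trace_proj_lie_lie (u v : V) : 2 * LinearMap.trace ℝ V
    (proj j ∘ₗ (LieAlgebra.ad ℝ L (j u) ∘ₗ LieAlgebra.ad ℝ L (j v)) ∘ₗ j) =
      killingForm ℝ L (j u) (j v) := by
  rw [killingForm_apply_apply, h.trace_eq_add, two_mul]
  congr 1
  rw [h.trace_proj_lie_lie_comm]
  have h1 : h.projSubalgebra ∘ₗ (LieAlgebra.ad ℝ L (j u) ∘ₗ LieAlgebra.ad ℝ L (j v)) ∘ₗ
      (𝔥.incl : 𝔥 →ₗ[ℝ] L) = (h.projSubalgebra ∘ₗ LieAlgebra.ad ℝ L (j u) ∘ₗ j) ∘ₗ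
        (proj j ∘ₗ LieAlgebra.ad ℝ L (j v) ∘ₗ (𝔥.incl : 𝔥 →ₗ[ℝ] L)) := by
    refine LinearMap.ext fun Z ↦ congrArg (fun x ↦ h.projSubalgebra ⁅j u, x⁆) ?_
    refine (h.j_proj (x := ⁅j v, (Z : L)⁆) ?_).symm
    rw [← lie_skew]
    exact neg_mem (h.lie_mem_range Z Z.2 v)
  have h2 : proj j ∘ₗ (LieAlgebra.ad ℝ L (j v) ∘ₗ LieAlgebra.ad ℝ L (j u)) ∘ₗ j =
      (proj j ∘ₗ LieAlgebra.ad ℝ L (j v) ∘ₗ (𝔥.incl : 𝔥 →ₗ[ℝ] L)) ∘ₗ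
        (h.projSubalgebra ∘ₗ LieAlgebra.ad ℝ L (j u) ∘ₗ j) := by
    refine LinearMap.ext fun w ↦ congrArg (fun x ↦ proj j ⁅j v, x⁆) ?_
    change ⁅j u, j w⁆ = ⁅j u, j w⁆ - j (proj j ⁅j u, j w⁆)
    rw [h.proj_eq_zero (h.lie_mem u w), map_zero, sub_zero]
  rw [h1, h2, LinearMap.trace_comp_comm']

include h in
-- The sum is the Ricci contraction of the algebraic curvature tensor, and equals minus the 𝔭-trace
-- of ad Y ad X.
theorem sum_killingForm_eq_inner {ι : Type*} [Fintype ι] (e : OrthonormalBasis ι ℝ V) (X Y : V) :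
    ∑ i, killingForm ℝ L ⁅⁅j (e i), j X⁆, j Y⁆ (j (e i)) = 1 / 2 * inner ℝ X Y := by
  have h1 := h.two_mul_trace_proj_lie_lie Y X
  rw [LieModule.traceForm_comm, LinearMap.trace_eq_sum_inner _ e] at h1
  rw [h.inner_eq, ← h1, mul_neg, ← mul_assoc, one_div_mul_cancel two_ne_zero, one_mul,
    ← Finset.sum_neg_distrib]
  refine Finset.sum_congr rfl fun i _ ↦ ?_
  rw [real_inner_comm]
  change _ = -inner ℝ (proj j ⁅j Y, ⁅j X, j (e i)⁆⁆) _
  rw [h.inner_proj, neg_neg, ← lie_skew (j Y), ← lie_skew (j X), neg_lie, neg_neg]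

/-- Both sides are 2 ∑ₐ |ι zₐ|² for a (-B)-orthonormal basis z of 𝔥. On the left, 1 = |eᵢ|² = 2 ∑ₖ
|[eᵢ, eₖ]|² by the half-trace formula, and each bracket is expanded in z; on the right, C has
diagonal entries ½|ι zₐ|². -/
theorem finrank_eq_four_mul_trace_casimir :
    (Module.finrank ℝ V : ℝ) = 4 * LinearMap.trace ℝ 𝔥 h.casimir := by
  obtain ⟨z, hz⟩ := exists_orthonormal_basis_of_posDef 𝔥.negKillingForm
    LieSubalgebra.negKillingForm_comm h.negKillingForm_pos
  let e := stdOrthonormalBasis ℝ V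
  have h1 : ∀ i k, (-killingForm ℝ L ⁅j (e i), j (e k)⁆ ⁅j (e i), j (e k)⁆ : ℝ) =
      ∑ a, inner ℝ (e i) ((h.isotropy (z a)).1 (e k)) ^ 2 := by
    intro i k
    let w : 𝔥 := ⟨⁅j (e i), j (e k)⁆, h.lie_mem _ _⟩
    have hw : 𝔥.negKillingForm w w = ∑ a, z.repr w a * 𝔥.negKillingForm w (z a) := by
      conv_lhs => rw [← z.sum_repr w]
      conv_lhs => rw [z.sum_repr w]
      nth_rewrite 2 [← z.sum_repr w]
      simp only [map_sum, map_smul, smul_eq_mul]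
    refine hw.trans (Finset.sum_congr rfl fun a _ ↦ ?_)
    rw [← bilinForm_apply_eq_repr 𝔥.negKillingForm z hz, ← sq, ← neg_sq]
    congr 1
    rw [LieSubalgebra.negKillingForm_apply, h.inner_eq, h.j_isotropy, neg_neg,
      LieModule.traceForm_apply_lie_apply, ← lie_skew, map_neg]
  have h2 : ∀ i, (1 : ℝ) = ∑ k, 2 * ∑ a, inner ℝ (e i) ((h.isotropy (z a)).1 (e k)) ^ 2 := by
    intro i
    have h3 : inner ℝ (e i) (e i) = (1 : ℝ) := by simp
    rw [← h3, h.inner_eq, ← h.two_mul_trace_proj_lie_lie, LinearMap.trace_eq_sum_inner _ e,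
      Finset.mul_sum, ← Finset.sum_neg_distrib]
    refine Finset.sum_congr rfl fun k _ ↦ ?_
    rw [← h1, real_inner_comm]
    change -(2 * inner ℝ (proj j ⁅j (e i), ⁅j (e i), j (e k)⁆⁆) _) = _
    rw [h.inner_proj, ← lie_skew (j (e i)) ⁅_, _⁆, map_neg, LinearMap.neg_apply,
      LieModule.traceForm_apply_lie_apply]
    ring
  have h4 : (Module.finrank ℝ V : ℝ) = ∑ _i : Fin (Module.finrank ℝ V), (1 : ℝ) := by simp
  rw [h4, Finset.sum_congr rfl fun i _ ↦ h2 i, trace_eq_sum_bilinForm _ z hz, Finset.mul_sum,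
    Finset.sum_congr rfl fun i _ ↦ Finset.sum_congr rfl fun k _ ↦ Finset.mul_sum _ _ _]
  rw [Finset.sum_congr rfl fun i _ ↦ Finset.sum_comm, Finset.sum_comm]
  refine Finset.sum_congr rfl fun a _ ↦ ?_
  rw [h.negKillingForm_casimir, soInner_eq_sum e, Finset.sum_comm, ← mul_assoc, Finset.mul_sum]
  refine Finset.sum_congr rfl fun k _ ↦ ?_
  rw [← Finset.mul_sum, e.sum_sq_inner_right, real_inner_self_eq_norm_sq]
  ring

include h in
theorem exists_curvatureOperator_spectrum (R : V → V → V → V → ℝ)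
    (hR : ∀ X Y Z W, R X Y Z W = killingForm ℝ L ⁅⁅j X, j Y⁆, j W⁆ (j Z)) :
    ∃ ι : 𝔥 →ₗ[ℝ] soTangent V, (∀ Z u, j ((ι Z).1 u) = ⁅(Z : L), j u⁆) ∧ Function.Injective ι ∧
    ∃ 𝔯 : soTangent V →ₗ[ℝ] soTangent V,
      (∀ 𝔯' : soTangent V →ₗ[ℝ] soTangent V,
        (∀ X Y Z W, soInner (𝔯' (wedge X Y)) (wedge Z W) = 2 * R X Y Z W) ↔ 𝔯' = 𝔯) ∧
    ∃ (n : ℕ) (𝔩 : Fin n → LieIdeal ℝ 𝔥) (eig : Fin n → ℝ),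
      Function.Injective 𝔩 ∧
      (∀ J : LieIdeal ℝ 𝔥, LieAlgebra.IsSimple ℝ J ↔ ∃ i, 𝔩 i = J) ∧
      DirectSum.IsInternal (fun j : Option (Fin n) ↦
        (j.elim (LieAlgebra.center ℝ 𝔥) 𝔩).toSubmodule) ∧
      (∀ i, 0 < eig i ∧ eig i < 1 / 2) ∧
      (∀ Z ∈ LieAlgebra.center ℝ 𝔥, 𝔯 (ι Z) = (1 / 2 : ℝ) • ι Z) ∧
      (∀ i, ∀ Z ∈ 𝔩 i, 𝔯 (ι Z) = eig i • ι Z) ∧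
      Module.End.eigenspace 𝔯 (1 / 2) = (LieAlgebra.center ℝ 𝔥).toSubmodule.map ι ∧
      (∀ i, Module.End.eigenspace 𝔯 (eig i) =
        (⨆ j : {j : Fin n // eig j = eig i}, (𝔩 j).toSubmodule).map ι) ∧
      (∀ A, A ∈ Module.End.eigenspace 𝔯 0 ↔ ∀ Z : 𝔥, soInner A (ι Z) = 0) ∧
      (∀ μ : ℝ, Module.End.HasEigenvalue 𝔯 μ → μ = 0 ∨ μ = 1 / 2 ∨ ∃ i, μ = eig i) ∧
      1 / 2 * (Module.finrank ℝ V : ℝ) = 2 * LinearMap.trace ℝ _ 𝔯 ∧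
      2 * LinearMap.trace ℝ _ 𝔯 =
        (Module.finrank ℝ (LieAlgebra.center ℝ 𝔥) : ℝ)
          + 2 * ∑ i, eig i * (Module.finrank ℝ (𝔩 i) : ℝ) := by
  obtain ⟨n, l, hl, hsimple, -, hint⟩ := exists_isInternal_center_simple_ideals 𝔥.negKillingForm
    LieSubalgebra.negKillingForm_comm h.negKillingForm_pos LieSubalgebra.negKillingForm_lie
  choose eig heig0 heig1 heig using fun i ↦
    h.exists_casimir_eq_smul_of_isSimple (l i) ((hsimple (l i)).2 ⟨i, rfl⟩)
  -- The index `none` stands for the centre.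
  let s : Option (Fin n) → ℝ := fun o ↦ o.elim (1 / 2) eig
  have hs : ∀ o, ∀ x ∈ (o.elim (LieAlgebra.center ℝ 𝔥) l).toSubmodule, h.casimir x = s o • x := by
    rintro (_ | i) x hx
    · exact h.casimir_of_mem_center hx
    · exact heig i x hx
  have htr : LinearMap.trace ℝ _ h.curvatureOperator = LinearMap.trace ℝ _ h.casimir := by
    rw [curvatureOperator, LinearMap.trace_comp_comm']
    rfl
  have heigen : ∀ c, c ≠ 0 → Module.End.eigenspace h.curvatureOperator c =
      (⨆ o : {o // s o = c}, (o.1.elim (LieAlgebra.center ℝ 𝔥) l).toSubmodule).map h.isotropy :=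
    fun c hc ↦ by
      rw [h.eigenspace_curvatureOperator hc, eigenspace_eq_iSup_of_isInternal hint h.casimir s hs]
  refine ⟨h.isotropy, h.j_isotropy, h.isotropy_injective, h.curvatureOperator, fun 𝔯' ↦ ?_, n, l,
    eig, hl, hsimple, hint, fun i ↦ ⟨heig0 i, heig1 i⟩, fun Z hZ ↦ ?_, fun i Z hZ ↦ ?_, ?_,
    fun i ↦ ?_, h.mem_eigenspace_zero_curvatureOperator_iff, fun c hc ↦ ?_, ?_, ?_⟩
  · simp only [hR]
    exact h.eq_curvatureOperator_iff 𝔯'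
  · rw [curvatureOperator_isotropy, h.casimir_of_mem_center hZ, map_smul]
  · rw [curvatureOperator_isotropy, heig i Z hZ, map_smul]
  · rw [heigen _ (by norm_num)]
    congr 1
    -- The strict bound `heig1` keeps every simple ideal out of the ½-eigenspace.
    refine le_antisymm (iSup_le ?_)
      (le_iSup (fun o : {o // s o = 1 / 2} ↦
        (o.1.elim (LieAlgebra.center ℝ 𝔥) l).toSubmodule) ⟨none, rfl⟩)
    rintro ⟨_ | i, hi⟩
    · exact le_rfl
    · exact absurd hi (heig1 i).ne
  · rw [heigen _ (heig0 i).ne']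
    congr 1
    refine le_antisymm (iSup_le ?_) (iSup_le ?_)
    · rintro ⟨_ | k, hk⟩
      · exact absurd hk (heig1 i).ne'
      · exact le_iSup (fun j : {j : Fin n // eig j = eig i} ↦ (l j).toSubmodule) ⟨k, hk⟩
    · rintro ⟨k, hk⟩
      exact le_iSup (fun o : {o // s o = eig i} ↦
        (o.1.elim (LieAlgebra.center ℝ 𝔥) l).toSubmodule) ⟨some k, hk⟩
  · by_contra! hne
    refine hc ?_
    have : IsEmpty {o // s o = c} := ⟨by
      rintro ⟨_ | i, hi⟩
      · exact hne.2.1 hi.symm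
      · exact hne.2.2 i hi.symm⟩
    exact (heigen c hne.1).trans (by rw [iSup_of_empty, Submodule.map_bot])
  · rw [htr, h.finrank_eq_four_mul_trace_casimir]
    ring
  · rw [htr, trace_eq_sum_of_isInternal hint h.casimir s hs, Fintype.sum_option, mul_add]
    change 2 * (1 / 2 * _) + _ = _
    rw [← mul_assoc, mul_one_div_cancel two_ne_zero, one_mul]
    rfl

end IsOrthogonalSymmetricPair

/-! ### Lie brackets as commutators of derivations, and related vector fields -/

section FunctionBracket

open VectorField Set Filter Topology

variable {E : Type*} [NormedAddCommGroup E] [NormedSpace ℝ E] [CompleteSpace E]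
  {M : Type*} [TopologicalSpace M] [ChartedSpace E M] [IsManifold 𝓘(ℝ, E) 2 M]
  {V : Type*} [NormedAddCommGroup V] [NormedSpace ℝ V]

omit [CompleteSpace E] in
theorem mvfderiv_eq_fderiv_comp_extChartAt_symm {f : M → V} {x y : M}
    (hy : y ∈ (extChartAt 𝓘(ℝ, E) x).source) (hf : MDiffAt f y) (v : TangentSpace 𝓘(ℝ, E) y) :
    mvfderiv 𝓘(ℝ, E) f y v = fderiv ℝ (f ∘ (extChartAt 𝓘(ℝ, E) x).symm) (extChartAt 𝓘(ℝ, E) x y)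
      (mfderiv 𝓘(ℝ, E) 𝓘(ℝ, E) (extChartAt 𝓘(ℝ, E) x) y v) := by
  have : IsManifold 𝓘(ℝ, E) 1 M := IsManifold.of_le one_le_two
  have hy' : y ∈ (chartAt E x).source := by simpa using hy
  have hsymm : MDifferentiableAt 𝓘(ℝ, E) 𝓘(ℝ, E) (extChartAt 𝓘(ℝ, E) x).symm
      (extChartAt 𝓘(ℝ, E) x y) := by
    have := mdifferentiableWithinAt_extChartAt_symm (I := 𝓘(ℝ, E))
      ((extChartAt 𝓘(ℝ, E) x).map_source hy)
    simpa [mdifferentiableWithinAt_univ] using this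
  have hg : MDifferentiableAt 𝓘(ℝ, E) 𝓘(ℝ, V) (f ∘ (extChartAt 𝓘(ℝ, E) x).symm)
      (extChartAt 𝓘(ℝ, E) x y) := by
    refine MDifferentiableAt.comp _ ?_ hsymm
    rwa [(extChartAt 𝓘(ℝ, E) x).left_inv hy]
  have heq : f =ᶠ[𝓝 y] (f ∘ (extChartAt 𝓘(ℝ, E) x).symm) ∘ extChartAt 𝓘(ℝ, E) x := by
    filter_upwards [extChartAt_source_mem_nhds' (I := 𝓘(ℝ, E)) hy] with z hz
    rw [Function.comp_apply, Function.comp_apply, (extChartAt 𝓘(ℝ, E) x).left_inv hz]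
  have h1 : mfderiv 𝓘(ℝ, E) 𝓘(ℝ, V) f y v =
      mfderiv 𝓘(ℝ, E) 𝓘(ℝ, V) ((f ∘ (extChartAt 𝓘(ℝ, E) x).symm) ∘ extChartAt 𝓘(ℝ, E) x) y v := by
    rw [heq.mfderiv_eq]; rfl
  change mfderiv 𝓘(ℝ, E) 𝓘(ℝ, V) f y v = _
  rw [h1, mfderiv_comp y hg (mdifferentiableAt_extChartAt hy'), ← mfderiv_eq_fderiv]
  rfl

/-- A vector field on a manifold, read in the extended chart at `x`. -/
noncomputable def chartField (x : M) (Z : Π x : M, TangentSpace 𝓘(ℝ, E) x) : E → E :=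
  mpullbackWithin 𝓘(ℝ, E) 𝓘(ℝ, E) (extChartAt 𝓘(ℝ, E) x).symm Z (range 𝓘(ℝ, E))

omit [CompleteSpace E] in
theorem mfderiv_extChartAt_apply_eq_chartField (x : M) (Z : Π x : M, TangentSpace 𝓘(ℝ, E) x) {y : M}
    (hy : y ∈ (extChartAt 𝓘(ℝ, E) x).source) :
    mfderiv 𝓘(ℝ, E) 𝓘(ℝ, E) (extChartAt 𝓘(ℝ, E) x) y (Z y) =
      chartField x Z (extChartAt 𝓘(ℝ, E) x y) := by
  have : IsManifold 𝓘(ℝ, E) 1 M := IsManifold.of_le one_le_two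
  have h1 := ContinuousLinearMap.inverse_eq
    (mfderivWithin_extChartAt_symm_comp_mfderiv_extChartAt' (I := 𝓘(ℝ, E)) hy)
    (mfderiv_extChartAt_comp_mfderivWithin_extChartAt_symm' (I := 𝓘(ℝ, E)) hy)
  simp only [chartField, mpullbackWithin_apply]
  rw [(extChartAt 𝓘(ℝ, E) x).left_inv hy] at *
  exact congr($h1.symm (Z y))

theorem differentiableAt_chartField {x : M} {Z : Π x : M, TangentSpace 𝓘(ℝ, E) x}
    (hZ : MDiffAt (T% Z) x) :
    DifferentiableAt ℝ (chartField x Z) (extChartAt 𝓘(ℝ, E) x x) := by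
  have h := MDifferentiableWithinAt.differentiableWithinAt_mpullbackWithin_vectorField
    (I := 𝓘(ℝ, E)) (s := univ) hZ.mdifferentiableWithinAt
  rw [preimage_univ, univ_inter, modelWithCornersSelf_coe, range_id] at h
  rw [← differentiableWithinAt_univ]
  convert h
  simp [chartField]

omit [CompleteSpace E] in
theorem mfderiv_extChartAt_mlieBracket (x : M) (X Y : Π x : M, TangentSpace 𝓘(ℝ, E) x) :
    mfderiv 𝓘(ℝ, E) 𝓘(ℝ, E) (extChartAt 𝓘(ℝ, E) x) x (mlieBracket 𝓘(ℝ, E) X Y x) =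
      lieBracket ℝ (chartField x X) (chartField x Y) (extChartAt 𝓘(ℝ, E) x x) := by
  have : IsManifold 𝓘(ℝ, E) 1 M := IsManifold.of_le one_le_two
  refine ((isInvertible_mfderiv_extChartAt (I := 𝓘(ℝ, E))
    (mem_extChartAt_source x)).self_apply_inverse _).trans ?_
  rw [← lieBracketWithin_univ, preimage_univ, univ_inter, modelWithCornersSelf_coe, range_id]
  simp only [chartField, modelWithCornersSelf_coe, range_id]
  rfl

omit [CompleteSpace E] in
theorem contDiffAt_comp_extChartAt_symm {f : M → V} {x : M}
    (hf : ContMDiffAt 𝓘(ℝ, E) 𝓘(ℝ, V) 2 f x) :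
    ContDiffAt ℝ 2 (f ∘ (extChartAt 𝓘(ℝ, E) x).symm) (extChartAt 𝓘(ℝ, E) x x) := by
  have hsymm : ContMDiffAt 𝓘(ℝ, E) 𝓘(ℝ, E) 2 (extChartAt 𝓘(ℝ, E) x).symm
      (extChartAt 𝓘(ℝ, E) x x) := by
    have h := contMDiffWithinAt_extChartAt_symm_range (I := 𝓘(ℝ, E)) (n := 2) x
      (mem_extChartAt_target x)
    rwa [modelWithCornersSelf_coe, range_id, contMDiffWithinAt_univ] at h
  rw [← contMDiffAt_iff_contDiffAt]
  refine ContMDiffAt.comp _ ?_ hsymm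
  rwa [extChartAt_to_inv x]

omit [CompleteSpace E] in
theorem mvfderiv_apply_eventuallyEq {f : M → V} {x : M} (hf : ContMDiffAt 𝓘(ℝ, E) 𝓘(ℝ, V) 2 f x)
    (Z : Π x : M, TangentSpace 𝓘(ℝ, E) x) :
    (fun y ↦ mvfderiv 𝓘(ℝ, E) f y (Z y)) =ᶠ[𝓝 x]
      (fun u ↦ fderiv ℝ (f ∘ (extChartAt 𝓘(ℝ, E) x).symm) u (chartField x Z u)) ∘
        extChartAt 𝓘(ℝ, E) x := by
  filter_upwards [(contMDiffAt_iff_contMDiffAt_nhds (by simp)).1 hf,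
    extChartAt_source_mem_nhds (I := 𝓘(ℝ, E)) x] with y hy hys
  rw [mvfderiv_eq_fderiv_comp_extChartAt_symm hys (hy.mdifferentiableAt two_ne_zero),
    mfderiv_extChartAt_apply_eq_chartField x Z hys]
  rfl

theorem mdifferentiableAt_mvfderiv_apply {f : M → V} {x : M} {Z : Π x : M, TangentSpace 𝓘(ℝ, E) x}
    (hf : ContMDiffAt 𝓘(ℝ, E) 𝓘(ℝ, V) 2 f x) (hZ : MDiffAt (T% Z) x) :
    MDiffAt (fun y ↦ mvfderiv 𝓘(ℝ, E) f y (Z y)) x := by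
  have : IsManifold 𝓘(ℝ, E) 1 M := IsManifold.of_le one_le_two
  have hg := ((contDiffAt_comp_extChartAt_symm hf).fderiv_right (m := 1)
    (by norm_num)).differentiableAt one_ne_zero
  refine MDifferentiableAt.congr_of_eventuallyEq ?_ (mvfderiv_apply_eventuallyEq hf Z)
  exact (hg.clm_apply (differentiableAt_chartField hZ)).mdifferentiableAt.comp x
    (mdifferentiableAt_extChartAt (mem_chart_source E x))

/-- The Lie bracket of vector fields acts on functions as the commutator of derivations. -/
theorem mvfderiv_mlieBracket {f : M → V} {x : M} {X Y : Π x : M, TangentSpace 𝓘(ℝ, E) x}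
    (hf : ContMDiffAt 𝓘(ℝ, E) 𝓘(ℝ, V) 2 f x)
    (hX : MDiffAt (T% X) x) (hY : MDiffAt (T% Y) x) :
    mvfderiv 𝓘(ℝ, E) f x (mlieBracket 𝓘(ℝ, E) X Y x) =
      mvfderiv 𝓘(ℝ, E) (fun y ↦ mvfderiv 𝓘(ℝ, E) f y (Y y)) x (X x) -
      mvfderiv 𝓘(ℝ, E) (fun y ↦ mvfderiv 𝓘(ℝ, E) f y (X y)) x (Y x) := by
  have : IsManifold 𝓘(ℝ, E) 1 M := IsManifold.of_le one_le_two
  set φ := extChartAt 𝓘(ℝ, E) x with hφ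
  set g : E → V := f ∘ φ.symm with hgdef
  have hg : ContDiffAt ℝ 2 g (φ x) := contDiffAt_comp_extChartAt_symm hf
  have hg' : DifferentiableAt ℝ (fderiv ℝ g) (φ x) :=
    (hg.fderiv_right (m := 1) (by norm_num)).differentiableAt one_ne_zero
  -- In the chart, W(Zf) is a second derivative of g plus a derivative of the coefficients of Z.
  -- Antisymmetrizing cancels the former by symmetry and leaves the bracket from the latter.
  have hD : ∀ Z W : Π x : M, TangentSpace 𝓘(ℝ, E) x, MDiffAt (T% Z) x →
      mvfderiv 𝓘(ℝ, E) (fun y ↦ mvfderiv 𝓘(ℝ, E) f y (Z y)) x (W x) =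
      fderiv ℝ (fderiv ℝ g) (φ x) (chartField x W (φ x)) (chartField x Z (φ x)) +
      fderiv ℝ g (φ x) (fderiv ℝ (chartField x Z) (φ x) (chartField x W (φ x))) := by
    intro Z W hZ
    have hloc := mvfderiv_apply_eventuallyEq hf Z
    have hh : DifferentiableAt ℝ (fun u ↦ fderiv ℝ g u (chartField x Z u)) (φ x) :=
      hg'.clm_apply (differentiableAt_chartField hZ)
    change mfderiv 𝓘(ℝ, E) 𝓘(ℝ, V) (fun y ↦ mvfderiv 𝓘(ℝ, E) f y (Z y)) x (W x) = _
    have h1 : mfderiv 𝓘(ℝ, E) 𝓘(ℝ, V) (fun y ↦ mvfderiv 𝓘(ℝ, E) f y (Z y)) x (W x) =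
        mfderiv 𝓘(ℝ, E) 𝓘(ℝ, V) ((fun u ↦ fderiv ℝ g u (chartField x Z u)) ∘ φ) x (W x) := by
      rw [hloc.mfderiv_eq]; rfl
    rw [h1, mfderiv_comp_apply x hh.mdifferentiableAt
      (mdifferentiableAt_extChartAt (mem_chart_source E x)),
      mfderiv_extChartAt_apply_eq_chartField x W (mem_extChartAt_source x), mfderiv_eq_fderiv]
    rw [fderiv_clm_apply hg' (differentiableAt_chartField hZ)]
    exact add_comm _ _
  rw [hD Y X hY, hD X Y hX, (hg.isSymmSndFDerivAt (by simp)).eq,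
    mvfderiv_eq_fderiv_comp_extChartAt_symm (mem_extChartAt_source x)
      (hf.mdifferentiableAt two_ne_zero),
    mfderiv_extChartAt_mlieBracket, lieBracket_eq]
  simp [hgdef, hφ]

/-- The Lie bracket of vector fields is compatible with `f`-related vector fields. -/
theorem mfderiv_mlieBracket_of_related
    {F : Type*} [NormedAddCommGroup F] [NormedSpace ℝ F] [CompleteSpace F]
    {N : Type*} [TopologicalSpace N] [ChartedSpace F N] [IsManifold 𝓘(ℝ, F) 2 N]
    {f : M → N} {x : M} (hf : ContMDiffAt 𝓘(ℝ, E) 𝓘(ℝ, F) 2 f x)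
    {X Y : Π x : M, TangentSpace 𝓘(ℝ, E) x} {X' Y' : Π y : N, TangentSpace 𝓘(ℝ, F) y}
    (hX : MDiffAt (T% X) x) (hY : MDiffAt (T% Y) x)
    (hX' : MDiffAt (T% X') (f x)) (hY' : MDiffAt (T% Y') (f x))
    (hXX' : ∀ᶠ y in 𝓝 x, mfderiv 𝓘(ℝ, E) 𝓘(ℝ, F) f y (X y) = X' (f y))
    (hYY' : ∀ᶠ y in 𝓝 x, mfderiv 𝓘(ℝ, E) 𝓘(ℝ, F) f y (Y y) = Y' (f y)) :
    mfderiv 𝓘(ℝ, E) 𝓘(ℝ, F) f x (mlieBracket 𝓘(ℝ, E) X Y x) = mlieBracket 𝓘(ℝ, F) X' Y' (f x) := by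
  have : IsManifold 𝓘(ℝ, E) 1 M := IsManifold.of_le one_le_two
  have : IsManifold 𝓘(ℝ, F) 1 N := IsManifold.of_le one_le_two
  set φ : N → F := ↑(extChartAt 𝓘(ℝ, F) (f x)) with hφ
  have hφ2 : ContMDiffAt 𝓘(ℝ, F) 𝓘(ℝ, F) 2 φ (f x) := contMDiffAt_extChartAt
  have hsrc : ∀ᶠ y in 𝓝 x, f y ∈ (chartAt F (f x)).source :=
    hf.continuousAt.preimage_mem_nhds (chart_source_mem_nhds F (f x))
  have hfd : ∀ᶠ y in 𝓝 x, MDifferentiableAt 𝓘(ℝ, E) 𝓘(ℝ, F) f y := by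
    filter_upwards [(contMDiffAt_iff_contMDiffAt_nhds (by simp)).1 hf] with y hy
    exact hy.mdifferentiableAt two_ne_zero
  have key : ∀ (Z : Π x : M, TangentSpace 𝓘(ℝ, E) x) (Z' : Π y : N, TangentSpace 𝓘(ℝ, F) y)
      (W : Π x : M, TangentSpace 𝓘(ℝ, E) x) (W' : Π y : N, TangentSpace 𝓘(ℝ, F) y),
      MDiffAt (T% Z') (f x) →
      (∀ᶠ y in 𝓝 x, mfderiv 𝓘(ℝ, E) 𝓘(ℝ, F) f y (Z y) = Z' (f y)) →
      (∀ᶠ y in 𝓝 x, mfderiv 𝓘(ℝ, E) 𝓘(ℝ, F) f y (W y) = W' (f y)) →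
      mvfderiv 𝓘(ℝ, E) (fun y ↦ mvfderiv 𝓘(ℝ, E) (φ ∘ f) y (Z y)) x (W x) =
        mvfderiv 𝓘(ℝ, F) (fun y ↦ mvfderiv 𝓘(ℝ, F) φ y (Z' y)) (f x) (W' (f x)) := by
    intro Z Z' W W' hZ' hZZ' hWW'
    have h1 : (fun y ↦ mvfderiv 𝓘(ℝ, E) (φ ∘ f) y (Z y)) =ᶠ[𝓝 x]
        (fun y ↦ mvfderiv 𝓘(ℝ, F) φ y (Z' y)) ∘ f := by
      filter_upwards [hZZ', hfd, hsrc] with y hy hfy hys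
      rw [Function.comp_apply, ← hy]
      exact mfderiv_comp_apply y (mdifferentiableAt_extChartAt hys) hfy (Z y)
    have hdiff : MDifferentiableAt 𝓘(ℝ, F) 𝓘(ℝ, F) (fun y ↦ mvfderiv 𝓘(ℝ, F) φ y (Z' y)) (f x) := by
      have h2 : (fun y ↦ mvfderiv 𝓘(ℝ, F) φ y (Z' y)) =ᶠ[𝓝 (f x)] chartField (f x) Z' ∘ φ := by
        filter_upwards [extChartAt_source_mem_nhds (I := 𝓘(ℝ, F)) (f x)] with y hys
        exact mfderiv_extChartAt_apply_eq_chartField (f x) Z' hys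
      refine MDifferentiableAt.congr_of_eventuallyEq ?_ h2
      exact (differentiableAt_chartField hZ').mdifferentiableAt.comp _
        (mdifferentiableAt_extChartAt (mem_chart_source F (f x)))
    have h3 : mfderiv 𝓘(ℝ, E) 𝓘(ℝ, F) (fun y ↦ mvfderiv 𝓘(ℝ, E) (φ ∘ f) y (Z y)) x (W x) =
        mfderiv 𝓘(ℝ, E) 𝓘(ℝ, F) ((fun y ↦ mvfderiv 𝓘(ℝ, F) φ y (Z' y)) ∘ f) x (W x) := by
      rw [h1.mfderiv_eq]; rfl
    rw [← hWW'.self_of_nhds]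
    exact h3.trans (mfderiv_comp_apply x hdiff hfd.self_of_nhds (W x))
  -- A chart has invertible differential, so the vector-valued test function φ separates tangent
  -- vectors; the brackets need only be compared as derivations of φ.
  apply (isInvertible_mfderiv_extChartAt (I := 𝓘(ℝ, F)) (mem_extChartAt_source (f x))).injective
  have h4 := mvfderiv_mlieBracket (f := φ ∘ f) (hφ2.comp x hf) hX hY
  have h5 := mvfderiv_mlieBracket hφ2 hX' hY'
  rw [key Y Y' X X' hY' hYY' hXX', key X X' Y Y' hX' hXX' hYY', ← h5] at h4
  rw [← mfderiv_comp_apply x (mdifferentiableAt_extChartAt (mem_chart_source F (f x)))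
    hfd.self_of_nhds]
  exact h4
end FunctionBracket

/-! ### Local sections of submersions -/

section Submersion

open Set Filter Topology

variable {E : Type*} [NormedAddCommGroup E] [NormedSpace ℝ E]
  {F : Type*} [NormedAddCommGroup F] [NormedSpace ℝ F]
  {M : Type*} [TopologicalSpace M] [ChartedSpace E M]
  {N : Type*} [TopologicalSpace N] [ChartedSpace F N] {n : ℕ∞ω}

/-- In adapted charts f is a linear projection; the section freezes the complementary coordinate at
its value at x. -/
theorem Manifold.IsSubmersionAt.exists_local_section {f : M → N} {x : M}
    (hf : Manifold.IsSubmersionAt 𝓘(ℝ, E) 𝓘(ℝ, F) n f x) :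
    ∃ s : N → M, s (f x) = x ∧ ContMDiffAt 𝓘(ℝ, F) 𝓘(ℝ, E) n s (f x) ∧
      ∀ᶠ y in 𝓝 (f x), f (s y) = y := by
  obtain ⟨C, _, _, h⟩ := hf
  set φ := h.domChart
  set ψ := h.codChart
  set c : C := (h.equiv (φ x)).2
  have hw := h.writtenInCharts
  have hfst : ∀ z ∈ φ.source, ψ (f z) = (h.equiv (φ z)).1 := by
    intro z hz
    have := hw (x := φ z) (by simpa using φ.map_source hz)
    simpa [φ, ψ, h.domChart.left_inv hz] using this
  set t : F → E := fun u ↦ h.equiv.symm (u, c)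
  have htx : t (ψ (f x)) = φ x := by
    simp only [t, c, hfst x h.mem_domChart_source]
    exact h.equiv.symm_apply_apply _
  have htc : ContDiff ℝ n t := by
    fun_prop
  refine ⟨fun y ↦ φ.symm (t (ψ y)), by simp only [htx, φ.left_inv h.mem_domChart_source], ?_, ?_⟩
  · have h1 : ContMDiffAt 𝓘(ℝ, F) 𝓘(ℝ, F) n ψ (f x) :=
      contMDiffAt_of_mem_maximalAtlas h.codChart_mem_maximalAtlas h.mem_codChart_source
    have h2 : ContMDiffAt 𝓘(ℝ, E) 𝓘(ℝ, E) n φ.symm (t (ψ (f x))) := by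
      rw [htx]
      exact contMDiffAt_symm_of_mem_maximalAtlas h.domChart_mem_maximalAtlas
        (φ.map_source h.mem_domChart_source)
    exact h2.comp (f x) (htc.contMDiff.contMDiffAt.comp (f x) h1)
  · have hcont : ContinuousAt (fun y ↦ t (ψ y)) (f x) :=
      htc.continuous.continuousAt.comp (ψ.continuousAt h.mem_codChart_source)
    have hmem : ∀ᶠ y in 𝓝 (f x), t (ψ y) ∈ φ.target := by
      refine hcont.preimage_mem_nhds (φ.open_target.mem_nhds ?_)
      rw [htx]
      exact φ.map_source h.mem_domChart_source
    filter_upwards [hmem, ψ.open_source.mem_nhds h.mem_codChart_source] with y hy hys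
    have h3 := φ.map_target hy
    apply ψ.injOn (h.mapsto_domChart_source_codChart_source h3) hys
    rw [hfst _ h3, φ.right_inv hy]
    simp [t]

theorem Manifold.IsSubmersionAt.mfderiv_surjective [IsManifold 𝓘(ℝ, E) n M]
    [IsManifold 𝓘(ℝ, F) n N] (hn : n ≠ 0) {f : M → N} {x : M}
    (hf : Manifold.IsSubmersionAt 𝓘(ℝ, E) 𝓘(ℝ, F) n f x) :
    Function.Surjective (mfderiv 𝓘(ℝ, E) 𝓘(ℝ, F) f x) := by
  obtain ⟨s, hsx, hs, hfs⟩ := hf.exists_local_section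
  intro v
  have hfd : MDifferentiableAt 𝓘(ℝ, E) 𝓘(ℝ, F) f (s (f x)) := by
    rw [hsx]
    exact hf.contMDiffAt.mdifferentiableAt hn
  have h1 : HasMFDerivAt 𝓘(ℝ, F) 𝓘(ℝ, F) (f ∘ s) (f x)
      (ContinuousLinearMap.id ℝ (TangentSpace 𝓘(ℝ, F) (f x))) :=
    (hasMFDerivAt_id (f x)).congr_of_eventuallyEq hfs
  have h2 := hfd.hasMFDerivAt.comp (f x) (hs.mdifferentiableAt hn).hasMFDerivAt
  have h3 := hasMFDerivAt_unique h1 h2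
  rw [hsx] at h3
  exact ⟨mfderiv 𝓘(ℝ, F) 𝓘(ℝ, E) s (f x) v, congr($h3.symm v)⟩

end Submersion

/-! ### Left-invariant fields and one-parameter subgroups -/

section LeftInvariant

open Set Filter Topology

variable {E : Type*} [NormedAddCommGroup E] [NormedSpace ℝ E]
  {G : Type*} [TopologicalSpace G] [ChartedSpace E G] [Group G] [LieGroup 𝓘(ℝ, E) ∞ G]

/-- Left-invariant vector fields on a smooth Lie group are smooth. -/
theorem contMDiff_infty_mulInvariantVectorField (v : GroupLieAlgebra 𝓘(ℝ, E) G) :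
    ContMDiff 𝓘(ℝ, E) 𝓘(ℝ, E).tangent ∞
      (fun g : G ↦ (⟨g, mulInvariantVectorField v g⟩ : TangentBundle 𝓘(ℝ, E) G)) := by
  -- The field at g is the tangent map of multiplication applied to the pair (0 at g, v at 1), a
  -- composite of smooth maps.
  let fg : G → TangentBundle 𝓘(ℝ, E) G := fun g ↦ TotalSpace.mk' E g 0
  have sfg : CMDiff ∞ fg := contMDiff_zeroSection _ _
  let fv : G → TangentBundle 𝓘(ℝ, E) G := fun _ ↦ TotalSpace.mk' E 1 v
  have sfv : CMDiff ∞ fv := contMDiff_const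
  let F₁ : G → (TangentBundle 𝓘(ℝ, E) G × TangentBundle 𝓘(ℝ, E) G) := fun g ↦ (fg g, fv g)
  have S₁ : CMDiff ∞ F₁ := sfg.prodMk sfv
  let F₂ : (TangentBundle 𝓘(ℝ, E) G × TangentBundle 𝓘(ℝ, E) G) →
      TangentBundle (𝓘(ℝ, E).prod 𝓘(ℝ, E)) (G × G) :=
    (equivTangentBundleProd 𝓘(ℝ, E) G 𝓘(ℝ, E) G).symm
  have S₂ : CMDiff ∞ F₂ := contMDiff_equivTangentBundleProd_symm
  let F₃ : TangentBundle (𝓘(ℝ, E).prod 𝓘(ℝ, E)) (G × G) → TangentBundle 𝓘(ℝ, E) G :=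
    tangentMap (𝓘(ℝ, E).prod 𝓘(ℝ, E)) 𝓘(ℝ, E) (fun p : G × G ↦ p.1 * p.2)
  have S₃ : CMDiff ∞ F₃ := by
    apply ContMDiff.contMDiff_tangentMap _ (m := ∞) (n := ∞) le_rfl
    exact contMDiff_mul 𝓘(ℝ, E) ∞
  let S := (S₃.comp S₂).comp S₁
  convert! S with g
  · simp [F₁, F₂, F₃, fg, fv]
  · simp only [Function.comp_apply, tangentMap, F₃, F₂, F₁, fg, fv]
    rw [mfderiv_prod_eq_add_apply ((contMDiff_mul 𝓘(ℝ, E) ∞).mdifferentiableAt (by simp))]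
    simp only [mulInvariantVectorField]
    exact ((congrArg₂ (· + ·) (map_zero _) rfl).trans (zero_add _)).symm

omit [LieGroup 𝓘(ℝ, E) ∞ G] in
theorem mulInvariantVectorField_one (v : GroupLieAlgebra 𝓘(ℝ, E) G) :
    mulInvariantVectorField v (1 : G) = v := by
  have : (fun x : G ↦ 1 * x) = id := by ext; simp
  simp only [mulInvariantVectorField]
  rw [this, mfderiv_id]
  rfl

theorem mfderiv_mul_left_mulInvariantVectorField (v : GroupLieAlgebra 𝓘(ℝ, E) G) (g h : G) :
    mfderiv 𝓘(ℝ, E) 𝓘(ℝ, E) (g * ·) h (mulInvariantVectorField v h) =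
      mulInvariantVectorField v (g * h) := by
  have hd : ∀ a b : G, MDifferentiableAt 𝓘(ℝ, E) 𝓘(ℝ, E) (a * ·) b := fun a b ↦
    (contMDiff_mul_left (I := 𝓘(ℝ, E)) (n := ∞)).contMDiffAt.mdifferentiableAt (by simp)
  have hc : (fun x : G ↦ g * h * x) = (g * ·) ∘ (h * ·) := by ext x; simp [mul_assoc]
  simp only [mulInvariantVectorField]
  rw [hc]
  exact (mfderiv_comp_apply_of_eq (1 : G) (hd g h) (hd h 1) (mul_one h) v).symm

theorem HasMFDerivAt.comp_of_eq {E₁ E₂ E₃ : Type*} [NormedAddCommGroup E₁] [NormedSpace ℝ E₁]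
    [NormedAddCommGroup E₂] [NormedSpace ℝ E₂] [NormedAddCommGroup E₃] [NormedSpace ℝ E₃]
    {M₁ M₂ M₃ : Type*} [TopologicalSpace M₁] [ChartedSpace E₁ M₁] [TopologicalSpace M₂]
    [ChartedSpace E₂ M₂] [TopologicalSpace M₃] [ChartedSpace E₃ M₃]
    {g : M₂ → M₃} {f : M₁ → M₂} {x : M₁} {y : M₂} {g' : E₂ →L[ℝ] E₃} {f' : E₁ →L[ℝ] E₂}
    (hg : HasMFDerivAt 𝓘(ℝ, E₂) 𝓘(ℝ, E₃) g y g') (hf : HasMFDerivAt 𝓘(ℝ, E₁) 𝓘(ℝ, E₂) f x f')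
    (hy : f x = y) : HasMFDerivAt 𝓘(ℝ, E₁) 𝓘(ℝ, E₃) (g ∘ f) x (g'.comp f' : E₁ →L[ℝ] E₃) := by
  subst hy
  exact HasMFDerivAt.comp x hg hf

/-- Bootstrapping: in a chart f' = w ∘ f with w smooth, so each order of differentiability of f
yields the next. -/
theorem contMDiff_of_isMIntegralCurve {M : Type*} [TopologicalSpace M] [ChartedSpace E M]
    [IsManifold 𝓘(ℝ, E) ∞ M] {v : Π x : M, TangentSpace 𝓘(ℝ, E) x}
    (hv : ContMDiff 𝓘(ℝ, E) 𝓘(ℝ, E).tangent ∞ (fun x ↦ (⟨x, v x⟩ : TangentBundle 𝓘(ℝ, E) M)))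
    {γ : ℝ → M} (hγ : IsMIntegralCurve γ v) : ContMDiff 𝓘(ℝ, ℝ) 𝓘(ℝ, E) ∞ γ := by
  intro t₀
  have : IsManifold 𝓘(ℝ, E) 1 M := IsManifold.of_le (n := ∞) (by simp)
  set x₀ := γ t₀ with hx₀
  set φ := extChartAt 𝓘(ℝ, E) x₀ with hφ
  set w : E → E := fun u ↦ tangentCoordChange 𝓘(ℝ, E) (φ.symm u) x₀ (φ.symm u) (v (φ.symm u))
  have hw : ContDiffAt ℝ ∞ w (φ x₀) := by
    have h1 := (contMDiffAt_iff.1 (hv x₀)).2.contDiffAt (by simp)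
    exact h1.snd
  have hder := hγ.isMIntegralCurveAt t₀ |>.eventually_hasDerivAt
  set f : ℝ → E := φ ∘ γ with hf
  have hfcont : ContinuousAt f t₀ :=
    (continuousAt_extChartAt x₀).comp hγ.continuous.continuousAt
  have hsrc : ∀ᶠ t in 𝓝 t₀, γ t ∈ φ.source :=
    hγ.continuous.continuousAt.preimage_mem_nhds (extChartAt_source_mem_nhds x₀)
  have hfder : ∀ᶠ t in 𝓝 t₀, HasDerivAt f (w (f t)) t := by
    filter_upwards [hder, hsrc] with t ht hts
    convert ht using 1
    simp only [w, hf, Function.comp_apply]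
    rw [φ.left_inv hts]
  have hfs : ContDiffAt ℝ ∞ f t₀ := by
    rw [contDiffAt_infty]
    -- A finite order is fixed so that the regularity of w at one point spreads to a neighbourhood,
    -- on which the induction runs.
    intro n
    have hwn : ∀ᶠ t in 𝓝 t₀, ContDiffAt ℝ n w (f t) :=
      hfcont.eventually ((hw.of_le (by exact_mod_cast le_top)).eventually (by simp))
    obtain ⟨U, hU, hUo, htU⟩ := eventually_nhds_iff.1 (hfder.and hwn)
    have : ∀ k : ℕ, k ≤ n → ContDiffOn ℝ k f U := by
      intro k
      induction k with
      | zero =>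
        intro _
        exact contDiffOn_zero.2 fun t ht ↦ (hU t ht).1.continuousAt.continuousWithinAt
      | succ k ih =>
        intro hk
        push_cast
        rw [contDiffOn_succ_iff_deriv_of_isOpen hUo]
        refine ⟨fun t ht ↦ (hU t ht).1.differentiableAt.differentiableWithinAt, by simp, ?_⟩
        refine ContDiffOn.congr (f := w ∘ f) ?_ fun t ht ↦ (hU t ht).1.deriv
        intro t ht
        exact ((hU t ht).2.of_le (by exact_mod_cast (by omega))).comp_contDiffWithinAt t
          (ih (by omega) t ht)
    exact (this n le_rfl).contDiffAt (hUo.mem_nhds htU)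
  have hγf : γ =ᶠ[𝓝 t₀] φ.symm ∘ f := by
    filter_upwards [hsrc] with t ht
    exact (φ.left_inv ht).symm
  refine ContMDiffAt.congr_of_eventuallyEq ?_ hγf
  refine ContMDiffAt.comp t₀ ?_ hfs.contMDiffAt
  have h := contMDiffWithinAt_extChartAt_symm_range (I := 𝓘(ℝ, E)) (n := ∞) x₀
      (mem_extChartAt_target x₀)
  rwa [modelWithCornersSelf_coe, range_id, contMDiffWithinAt_univ] at h

theorem IsMIntegralCurveOn.mul_left {v : GroupLieAlgebra 𝓘(ℝ, E) G} {γ : ℝ → G} {s : Set ℝ}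
    (hγ : IsMIntegralCurveOn γ (mulInvariantVectorField v) s) (g : G) :
    IsMIntegralCurveOn (fun t ↦ g * γ t) (mulInvariantVectorField v) s := by
  intro t ht
  have hd : MDifferentiableAt 𝓘(ℝ, E) 𝓘(ℝ, E) (g * ·) (γ t) :=
    (contMDiff_mul_left (I := 𝓘(ℝ, E)) (n := ∞)).contMDiffAt.mdifferentiableAt (by simp)
  have h := hd.hasMFDerivAt.comp_hasMFDerivWithinAt t (hγ t ht)
  refine h.congr_mfderiv (ContinuousLinearMap.ext fun (c : ℝ) ↦ ?_)
  exact (ContinuousLinearMap.map_smul (mfderiv 𝓘(ℝ, E) 𝓘(ℝ, E) (g * ·) (γ t)) c _).trans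
    (congrArg (c • ·) (mfderiv_mul_left_mulInvariantVectorField v g (γ t)))

theorem IsMIntegralCurve.mul_left {v : GroupLieAlgebra 𝓘(ℝ, E) G} {γ : ℝ → G}
    (hγ : IsMIntegralCurve γ (mulInvariantVectorField v)) (g : G) :
    IsMIntegralCurve (fun t ↦ g * γ t) (mulInvariantVectorField v) := by
  rw [isMIntegralCurve_iff_isMIntegralCurveOn] at *
  exact hγ.mul_left g

variable [FiniteDimensional ℝ E]

/-- Every left-invariant vector field on a Lie group has a global integral curve through `1`. -/
theorem exists_isMIntegralCurve_mulInvariantVectorField [T2Space G]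
    (v : GroupLieAlgebra 𝓘(ℝ, E) G) :
    ∃ γ : ℝ → G, γ 0 = 1 ∧ IsMIntegralCurve γ (mulInvariantVectorField v) := by
  have hv := (contMDiff_infty_mulInvariantVectorField v).of_le (n := ∞) (m := 1) (by simp)
  obtain ⟨γ, hγ0, hγ⟩ := exists_isMIntegralCurveAt_of_contMDiffAt_boundaryless 0 (hv (1 : G))
  obtain ⟨ε, hε, hγ⟩ := isMIntegralCurveAt_iff'.1 hγ
  -- Left translates of one local solution exist for the same time ε at every point, and this
  -- uniform time gives completeness.
  refine exists_isMIntegralCurve_of_isMIntegralCurveOn hv hε (fun g ↦ ?_) 1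
  refine ⟨fun t ↦ g * γ t, by simp [hγ0], ?_⟩
  rw [Real.ball_eq_Ioo, zero_sub, zero_add] at hγ
  exact hγ.mul_left g

omit [FiniteDimensional ℝ E] in
-- Both sides, as functions of t, are integral curves of the same field through γ s.
theorem IsMIntegralCurve.map_add [T2Space G] {v : GroupLieAlgebra 𝓘(ℝ, E) G} {γ : ℝ → G}
    (hγ : IsMIntegralCurve γ (mulInvariantVectorField v)) (hγ0 : γ 0 = 1) (s t : ℝ) :
    γ (s + t) = γ s * γ t := by
  have hv := (contMDiff_infty_mulInvariantVectorField v).of_le (n := ∞) (m := 1) (by simp)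
  have := isMIntegralCurve_Ioo_eq_of_contMDiff_boundaryless (t₀ := 0) hv (hγ.comp_add s)
    (hγ.mul_left (γ s)) (by simp [hγ0])
  simpa [add_comm] using congrFun this t

end LeftInvariant

/-! ### The differential of σ and the Lie algebra of its fixed group -/

section Automorphism

open Set Filter Topology VectorField

variable {E : Type*} [NormedAddCommGroup E] [NormedSpace ℝ E] [FiniteDimensional ℝ E]
  {G : Type*} [TopologicalSpace G] [ChartedSpace E G] [Group G] [LieGroup 𝓘(ℝ, E) ∞ G]

omit [FiniteDimensional ℝ E] [LieGroup 𝓘(ℝ, E) ∞ G] in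
theorem mulInvariantVectorField_eq_of_eq_one {a : G} (ha : a = 1) (g : G)
    (v : GroupLieAlgebra 𝓘(ℝ, E) G) :
    mfderiv 𝓘(ℝ, E) 𝓘(ℝ, E) (g * ·) a (v : E) = mulInvariantVectorField v g := by
  subst ha
  rfl

/-- The differential at the identity of a group endomorphism, as a linear map. -/
noncomputable def endDifferential (σ : G →* G) :
    GroupLieAlgebra 𝓘(ℝ, E) G →ₗ[ℝ] GroupLieAlgebra 𝓘(ℝ, E) G where
  toFun v := (mfderiv 𝓘(ℝ, E) 𝓘(ℝ, E) σ 1 v : E)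
  map_add' v w := (mfderiv 𝓘(ℝ, E) 𝓘(ℝ, E) σ 1).map_add v w
  map_smul' c v := (mfderiv 𝓘(ℝ, E) 𝓘(ℝ, E) σ 1).map_smul c v

omit [FiniteDimensional ℝ E] in
theorem mfderiv_mulInvariantVectorField {σ : G →* G} (hσ : ContMDiff 𝓘(ℝ, E) 𝓘(ℝ, E) ∞ σ)
    (v : GroupLieAlgebra 𝓘(ℝ, E) G) (g : G) :
    mfderiv 𝓘(ℝ, E) 𝓘(ℝ, E) σ g (mulInvariantVectorField v g) =
      mulInvariantVectorField (endDifferential σ v) (σ g) := by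
  have hd : ∀ a b : G, MDifferentiableAt 𝓘(ℝ, E) 𝓘(ℝ, E) (a * ·) b := fun a b ↦
    (contMDiff_mul_left (I := 𝓘(ℝ, E)) (n := ∞)).contMDiffAt.mdifferentiableAt (by simp)
  have hσd : ∀ a, MDifferentiableAt 𝓘(ℝ, E) 𝓘(ℝ, E) σ a := fun a ↦
    (hσ a).mdifferentiableAt (by simp)
  have h1 := mfderiv_comp_apply_of_eq (1 : G) (hσd g) (hd g 1) (mul_one g) v
  have h2 := mfderiv_comp_apply (1 : G) (hd (σ g) (σ 1)) (hσd 1) v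
  have hc : (σ ∘ fun x : G ↦ g * x) = (σ g * ·) ∘ σ := by ext x; simp
  rw [hc] at h1
  refine h1.symm.trans (h2.trans ?_)
  exact mulInvariantVectorField_eq_of_eq_one (map_one σ) (σ g) (endDifferential σ v)

/-- Left-invariant fields of v and dσ v are σ-related, and brackets respect relatedness. -/
theorem endDifferential_lie {σ : G →* G} (hσ : ContMDiff 𝓘(ℝ, E) 𝓘(ℝ, E) ∞ σ)
    (v w : GroupLieAlgebra 𝓘(ℝ, E) G) :
    endDifferential σ ⁅v, w⁆ = ⁅endDifferential σ v, endDifferential σ w⁆ := by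
  have hm : ∀ (u : GroupLieAlgebra 𝓘(ℝ, E) G) (g : G),
      MDiffAt (T% (mulInvariantVectorField u)) g := fun u g ↦
    (contMDiff_infty_mulInvariantVectorField u g).mdifferentiableAt (by simp)
  have h := mfderiv_mlieBracket_of_related (f := σ) (x := (1 : G))
    ((hσ 1).of_le ENat.LEInfty.out) (hm v 1) (hm w 1) (hm (endDifferential σ v) (σ 1))
    (hm (endDifferential σ w) (σ 1))
    (.of_forall (mfderiv_mulInvariantVectorField hσ v))
    (.of_forall (mfderiv_mulInvariantVectorField hσ w))
  rw [← mulInvariantVector_mlieBracket, ← GroupLieAlgebra.bracket_def] at h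
  rw [← mulInvariantVector_mlieBracket, ← GroupLieAlgebra.bracket_def, mulInvariantVectorField_one,
    map_one] at h
  rw [mulInvariantVectorField_one] at h
  exact h

omit [FiniteDimensional ℝ E] [LieGroup 𝓘(ℝ, E) ∞ G] in
theorem endDifferential_involutive {σ : G →* G} (hσ : ContMDiff 𝓘(ℝ, E) 𝓘(ℝ, E) ∞ σ)
    (hσσ : ∀ g, σ (σ g) = g) (v : GroupLieAlgebra 𝓘(ℝ, E) G) :
    endDifferential σ (endDifferential σ v) = v := by
  have hσd : ∀ a, MDifferentiableAt 𝓘(ℝ, E) 𝓘(ℝ, E) σ a := fun a ↦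
    (hσ a).mdifferentiableAt (by simp)
  have hc : (σ ∘ σ : G → G) = id := by ext x; simp [hσσ]
  have h := mfderiv_comp_apply_of_eq (1 : G) (hσd 1) (hσd 1) (map_one σ) v
  rw [hc, mfderiv_id] at h
  exact h.symm

/-- The differential at the identity of an involutive automorphism. -/
noncomputable def involutionDifferential {σ : G →* G} (hσ : ContMDiff 𝓘(ℝ, E) 𝓘(ℝ, E) ∞ σ)
    (hσσ : ∀ g, σ (σ g) = g) :
    GroupLieAlgebra 𝓘(ℝ, E) G ≃ₗ⁅ℝ⁆ GroupLieAlgebra 𝓘(ℝ, E) G :=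
  { endDifferential σ with
    map_lie' := fun {v w} ↦ endDifferential_lie hσ v w
    invFun := endDifferential σ
    left_inv := endDifferential_involutive hσ hσσ
    right_inv := endDifferential_involutive hσ hσσ }

/-- If dσ v = v, then σ carries the integral curve of v through 1 to another one, so the two
coincide by uniqueness. A connected curve of fixed points through 1 stays in the identity component.
-/
theorem exists_oneParameterSubgroup_of_fixed [IsTopologicalGroup G] [T2Space G] {σ : G →* G}
    (hσ : ContMDiff 𝓘(ℝ, E) 𝓘(ℝ, E) ∞ σ) {v : GroupLieAlgebra 𝓘(ℝ, E) G}
    (hv : endDifferential σ v = v) :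
    ∃ γ : ℝ → G, γ 0 = 1 ∧ IsMIntegralCurve γ (mulInvariantVectorField v) ∧
      ∀ t, γ t ∈ fixedSubgroupComponent σ := by
  obtain ⟨γ, hγ0, hγ⟩ := exists_isMIntegralCurve_mulInvariantVectorField v
  refine ⟨γ, hγ0, hγ, ?_⟩
  have hv1 := (contMDiff_infty_mulInvariantVectorField v).of_le (n := ∞) (m := 1) (by simp)
  have hσγ : IsMIntegralCurve (σ ∘ γ) (mulInvariantVectorField v) := by
    intro t
    have h := HasMFDerivAt.comp t ((hσ (γ t)).mdifferentiableAt (by simp)).hasMFDerivAt (hγ t)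
    refine h.congr_mfderiv (ContinuousLinearMap.ext fun (c : ℝ) ↦ ?_)
    refine (ContinuousLinearMap.map_smul (mfderiv 𝓘(ℝ, E) 𝓘(ℝ, E) σ (γ t)) c _).trans
      (congrArg (c • ·) ?_)
    rw [mfderiv_mulInvariantVectorField hσ, hv]
    rfl
  have hfix : σ ∘ γ = γ :=
    isMIntegralCurve_Ioo_eq_of_contMDiff_boundaryless (t₀ := 0) hv1 hσγ hγ (by simp [hγ0])
  let γ' : ℝ → σ.eqLocus (MonoidHom.id G) := fun t ↦ ⟨γ t, congrFun hfix t⟩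
  have hγ' : Continuous γ' := hγ.continuous.subtype_mk _
  intro t
  refine ⟨γ' t, ?_, rfl⟩
  have h0 : γ' 0 = 1 := Subtype.ext hγ0
  have : γ' t ∈ connectedComponent (γ' 0) :=
    (isPreconnected_univ.image γ' hγ'.continuousOn).subset_connectedComponent
      (mem_image_of_mem γ' (mem_univ 0)) (mem_image_of_mem γ' (mem_univ t))
  rw [h0] at this
  exact this

/-- The Lie algebra of the identity component of the fixed point group of `σ` consists of the fixed
vectors of the differential of `σ`. -/
theorem mem_lieAlgebraOfSubgroup_fixedSubgroupComponent [IsTopologicalGroup G] [T2Space G]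
    {σ : G →* G} (hσ : ContMDiff 𝓘(ℝ, E) 𝓘(ℝ, E) ∞ σ) (v : GroupLieAlgebra 𝓘(ℝ, E) G) :
    v ∈ lieAlgebraOfSubgroup (E := E) (fixedSubgroupComponent σ) ↔ endDifferential σ v = v := by
  constructor
  · intro hv
    -- The fixed vectors form a subalgebra, so it is enough to treat the generating velocities of
    -- the Lie span.
    let fixed : LieSubalgebra ℝ (GroupLieAlgebra 𝓘(ℝ, E) G) :=
      { LinearMap.eqLocus (endDifferential σ) LinearMap.id with
        lie_mem' := fun {x y} hx hy ↦ by
          change endDifferential σ ⁅x, y⁆ = ⁅x, y⁆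
          rw [endDifferential_lie hσ]
          exact congrArg₂ _ hx hy }
    suffices lieAlgebraOfSubgroup (E := E) (fixedSubgroupComponent σ) ≤ fixed from this hv
    refine LieSubalgebra.lieSpan_le.2 ?_
    rintro X ⟨γ, hγ, hγ0, -, hmem, hX⟩
    have hfix : σ ∘ γ = γ := by
      ext t
      obtain ⟨k, -, hk⟩ := hmem t
      rw [Function.comp_apply, ← hk]
      exact k.2
    have h := mfderiv_comp_apply_of_eq (0 : ℝ) ((hσ 1).mdifferentiableAt (by simp))
      ((hγ 0).mdifferentiableAt (by simp)) hγ0 (1 : ℝ)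
    rw [hfix] at h
    have h2 : (mfderiv 𝓘(ℝ, E) 𝓘(ℝ, E) σ 1 (X : E) : E) = X := by
      rw [← hX]
      exact h.symm
    exact h2
  · intro hv
    obtain ⟨γ, hγ0, hγ, hmem⟩ := exists_oneParameterSubgroup_of_fixed hσ hv
    refine LieSubalgebra.subset_lieSpan ⟨γ, contMDiff_of_isMIntegralCurve
      (contMDiff_infty_mulInvariantVectorField v) hγ, hγ0, hγ.map_add hγ0, hmem, ?_⟩
    rw [(hγ 0).mfderiv, hγ0, mulInvariantVectorField_one]
    exact one_smul ℝ (v : E)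

end Automorphism

theorem exists_linearEquiv_euclideanSpace_of_posDef {W : Type*} [AddCommGroup W] [Module ℝ W]
    [FiniteDimensional ℝ W] (b : LinearMap.BilinForm ℝ W) (hsymm : ∀ x y, b x y = b y x)
    (hpos : ∀ x, x ≠ 0 → 0 < b x x) :
    ∃ φ : EuclideanSpace ℝ (Fin (Module.finrank ℝ W)) ≃ₗ[ℝ] W,
      ∀ u v, inner ℝ u v = b (φ u) (φ v) := by
  let c := coreOfBilinForm b hsymm hpos
  let _ := c.toNormedAddCommGroup
  let _ := InnerProductSpace.ofCore c.toCore
  let e := stdOrthonormalBasis ℝ W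
  exact ⟨e.repr.symm.toLinearEquiv, fun u v ↦ (e.repr.symm.inner_map_map u v).symm⟩

/-! ### From an involution to an orthogonal symmetric pair -/

section Involution

variable {L : Type*} [LieRing L] [LieAlgebra ℝ L]
  [LieAlgebra.IsKilling ℝ L]

theorem mem_killing_orthogonal_iff_of_involutive (θ : L ≃ₗ⁅ℝ⁆ L) (hθ : ∀ x, θ (θ x) = x)
    {𝔥 : LieSubalgebra ℝ L} (h𝔥 : ∀ x, x ∈ 𝔥 ↔ θ x = x) (x : L) :
    x ∈ LinearMap.BilinForm.orthogonal (killingForm ℝ L) 𝔥.toSubmodule ↔ θ x = -x := by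
  have hκ := LieAlgebra.killingForm_of_equiv_apply θ
  rw [LinearMap.BilinForm.mem_orthogonal_iff]
  constructor
  · intro hx
    rw [← sub_eq_zero, sub_neg_eq_add]
    refine (LieAlgebra.IsKilling.killingForm_nondegenerate ℝ L).1 _ fun y ↦ ?_
    -- Invariance of B under θ turns B(y + θy, x) = 0 into B(y, x + θx) = 0 for all y; nondegeneracy
    -- finishes.
    have h1 := hx (y + θ y) ((h𝔥 _).2 (by rw [map_add, hθ, add_comm]))
    have h1 : killingForm ℝ L (y + θ y) x = 0 := h1
    have h2 := hκ y (θ x)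
    rw [hθ] at h2
    rw [map_add, LinearMap.add_apply] at h1
    rw [LieModule.traceForm_comm, map_add, ← h2]
    linarith
  · intro hx Z hZ
    have h1 := hκ Z x
    rw [(h𝔥 Z).1 hZ, hx, map_neg] at h1
    change killingForm ℝ L Z x = 0
    linarith

theorem exists_eq_add_of_involutive (θ : L ≃ₗ⁅ℝ⁆ L) (hθ : ∀ x, θ (θ x) = x)
    {𝔥 : LieSubalgebra ℝ L} (h𝔥 : ∀ x, x ∈ 𝔥 ↔ θ x = x) (x : L) :
    ∃ Z ∈ 𝔥, ∃ Y ∈ LinearMap.BilinForm.orthogonal (killingForm ℝ L) 𝔥.toSubmodule, x = Z + Y := by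
  refine ⟨(1 / 2 : ℝ) • (x + θ x), (h𝔥 _).2 ?_, (1 / 2 : ℝ) • (x - θ x),
    (mem_killing_orthogonal_iff_of_involutive θ hθ h𝔥 _).2 ?_, ?_⟩
  · rw [map_smul, map_add, hθ, add_comm]
  · rw [map_smul, map_sub, hθ, ← smul_neg, neg_sub]
  · rw [← smul_add, add_add_sub_cancel, ← two_smul ℝ x, smul_smul]
    norm_num

/-- With 𝔥 and 𝔭 the ±1-eigenspaces of θ, the relations [𝔥, 𝔭] ⊆ 𝔭 and [𝔭, 𝔭] ⊆ 𝔥 are sign counts.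
-/
theorem isOrthogonalSymmetricPair_of_involutive (θ : L ≃ₗ⁅ℝ⁆ L) (hθ : ∀ x, θ (θ x) = x)
    {𝔥 : LieSubalgebra ℝ L} (h𝔥 : ∀ x, x ∈ 𝔥 ↔ θ x = x)
    (heff : ∀ J : LieIdeal ℝ L, J.toSubmodule ≤ 𝔥.toSubmodule → J = ⊥)
    {V : Type*} [NormedAddCommGroup V] [InnerProductSpace ℝ V] (j : V →ₗ[ℝ] L)
    (hj : LinearMap.range j = LinearMap.BilinForm.orthogonal (killingForm ℝ L) 𝔥.toSubmodule)
    (hinner : ∀ u v, inner ℝ u v = -killingForm ℝ L (j u) (j v)) :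
    IsOrthogonalSymmetricPair 𝔥 j := by
  have hp : ∀ x, x ∈ LinearMap.range j ↔ θ x = -x := fun x ↦ by
    rw [hj, mem_killing_orthogonal_iff_of_involutive θ hθ h𝔥]
  have hju : ∀ u, θ (j u) = -j u := fun u ↦ (hp _).1 ⟨u, rfl⟩
  refine ⟨⟨?_, ?_⟩, hinner, fun Z hZ u ↦ ?_, fun Z hZ u ↦ ?_, fun u v ↦ ?_, heff⟩
  · rw [Submodule.disjoint_def]
    intro x hx hx'
    have := IsAddTorsionFree.of_isTorsionFree ℝ L
    exact self_eq_neg.1 (((h𝔥 x).1 hx).symm.trans ((hp x).1 hx'))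
  · rw [codisjoint_iff, eq_top_iff]
    intro x _
    obtain ⟨Z, hZ, Y, hY, rfl⟩ := exists_eq_add_of_involutive θ hθ h𝔥 x
    exact Submodule.mem_sup.2 ⟨Z, hZ, Y, hj ▸ hY, rfl⟩
  · have : j u ∈ LinearMap.BilinForm.orthogonal (killingForm ℝ L) 𝔥.toSubmodule := hj ▸ ⟨u, rfl⟩
    exact this Z hZ
  · rw [hp, LieEquiv.map_lie, (h𝔥 Z).1 hZ, hju, lie_neg]
  · rw [h𝔥, LieEquiv.map_lie, hju, hju, lie_neg, neg_lie, neg_neg]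

end Involution

/-! ### The differential of G → G/K on left-invariant fields -/

section Projection

variable {E : Type*} [NormedAddCommGroup E] [NormedSpace ℝ E]
  {G : Type*} [TopologicalSpace G] [ChartedSpace E G] [Group G] [LieGroup 𝓘(ℝ, E) ∞ G]
  {F : Type*} [NormedAddCommGroup F] [NormedSpace ℝ F]
  {K : Subgroup G} [ChartedSpace F (G ⧸ K)]

theorem mulInvariantVectorField_surjective (a : G) (w : TangentSpace 𝓘(ℝ, E) a) :
    ∃ v : GroupLieAlgebra 𝓘(ℝ, E) G, mulInvariantVectorField v a = w := by
  have hd : ∀ a b : G, MDifferentiableAt 𝓘(ℝ, E) 𝓘(ℝ, E) (a * ·) b := fun a b ↦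
    (contMDiff_mul_left (I := 𝓘(ℝ, E)) (n := ∞)).contMDiffAt.mdifferentiableAt (by simp)
  have hc : (fun x : G ↦ a * x) ∘ (fun x : G ↦ a⁻¹ * x) = id := by ext x; simp
  have h := mfderiv_comp_apply_of_eq a (hd a (a⁻¹ * a)) (hd a⁻¹ a) rfl w
  rw [hc, mfderiv_id] at h
  exact ⟨(mfderiv 𝓘(ℝ, E) 𝓘(ℝ, E) (a⁻¹ * ·) a w : E),
    (mulInvariantVectorField_eq_of_eq_one (inv_mul_cancel a) a _).symm.trans h.symm⟩

/-- The differential of the projection `G → G ⧸ K` at `a`, composed with the left translation from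
the Lie algebra. -/
noncomputable def projInvariant (K : Subgroup G) [ChartedSpace F (G ⧸ K)] (a : G) :
    GroupLieAlgebra 𝓘(ℝ, E) G →ₗ[ℝ] TangentSpace 𝓘(ℝ, F) (QuotientGroup.mk a : G ⧸ K) where
  toFun v := projDeriv K a (mulInvariantVectorField v a)
  map_add' v w := (congrArg _ (map_add (mfderiv 𝓘(ℝ, E) 𝓘(ℝ, E) (a * ·) (1 : G)) v w)).trans
    (map_add (projDeriv K a) _ _)
  map_smul' c v := (congrArg _ (ContinuousLinearMap.map_smul
    (mfderiv 𝓘(ℝ, E) 𝓘(ℝ, E) (a * ·) (1 : G)) c v)).trans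
      (ContinuousLinearMap.map_smul (projDeriv K a) c _)

variable [IsManifold 𝓘(ℝ, F) ∞ (G ⧸ K)]
  (hπ : Manifold.IsSubmersion 𝓘(ℝ, E) 𝓘(ℝ, F) ∞ (QuotientGroup.mk : G → G ⧸ K))

include hπ

theorem projInvariant_surjective (a : G) :
    Function.Surjective (projInvariant (E := E) (F := F) K a) := by
  intro w
  obtain ⟨x, hx⟩ := (hπ.isSubmersionAt a).mfderiv_surjective (by simp) w
  obtain ⟨v, rfl⟩ := mulInvariantVectorField_surjective a x
  exact ⟨v, hx⟩

omit [IsManifold 𝓘(ℝ, F) ∞ (G ⧸ K)] in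
-- The curve t ↦ a γ(t) stays in the coset aK, so its projection is constant.
theorem projInvariant_eq_zero {v : GroupLieAlgebra 𝓘(ℝ, E) G} {γ : ℝ → G} (hγ0 : γ 0 = 1)
    (hγ : IsMIntegralCurve γ (mulInvariantVectorField v)) (hmem : ∀ t, γ t ∈ K) (a : G) :
    projInvariant (F := F) K a v = 0 := by
  have h1 := (hγ.mul_left a) 0
  have h2 := ((hπ.isSubmersionAt a).contMDiffAt.mdifferentiableAt (by simp)).hasMFDerivAt
  have h3 := h2.comp_of_eq h1 (by simp [hγ0])
  have h4 : (QuotientGroup.mk : G → G ⧸ K) ∘ (fun t ↦ a * γ t) =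
      fun _ ↦ (QuotientGroup.mk a : G ⧸ K) := by
    ext t
    rw [Function.comp_apply, QuotientGroup.eq]
    simpa using K.inv_mem (hmem t)
  rw [h4] at h3
  have h5 := hasMFDerivAt_unique h3
    (hasMFDerivAt_const (I := 𝓘(ℝ, ℝ)) (QuotientGroup.mk a : G ⧸ K) (0 : ℝ))
  have h6 : mfderiv 𝓘(ℝ, E) 𝓘(ℝ, F) (QuotientGroup.mk : G → G ⧸ K) a
      ((1 : ℝ) • mulInvariantVectorField v (a * γ 0)) = 0 :=
    congrArg (fun f : ℝ →L[ℝ] F ↦ f 1) h5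
  rw [hγ0, mul_one, one_smul] at h6
  exact h6

end Projection

/-! ### Isometric frames of G/K parametrized by G -/

section SymmetricFrame

variable {E : Type*} [NormedAddCommGroup E] [NormedSpace ℝ E] [FiniteDimensional ℝ E]
  {G : Type*} [TopologicalSpace G] [ChartedSpace E G] [Group G] [LieGroup 𝓘(ℝ, E) ∞ G]
  {F : Type*} [NormedAddCommGroup F] [NormedSpace ℝ F]
  {K : Subgroup G} [ChartedSpace F (G ⧸ K)]
  [RiemannianBundle (fun x : G ⧸ K ↦ TangentSpace 𝓘(ℝ, F) x)]
  {V : Type*} [NormedAddCommGroup V] [InnerProductSpace ℝ V]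

instance finiteDimensional_groupLieAlgebra :
    FiniteDimensional ℝ (GroupLieAlgebra 𝓘(ℝ, E) G) :=
  inferInstanceAs (FiniteDimensional ℝ E)

/-- `j` is an isometry of `V` onto the complement of `𝔥` in an orthogonal symmetric pair, and at
every `a` the differential of the projection vanishes on `𝔥` and identifies `V` isometrically with
the tangent space of `G ⧸ K`. -/
structure IsSymmetricFrame (K : Subgroup G) [ChartedSpace F (G ⧸ K)]
    [RiemannianBundle (fun x : G ⧸ K ↦ TangentSpace 𝓘(ℝ, F) x)]
    (𝔥 : LieSubalgebra ℝ (GroupLieAlgebra 𝓘(ℝ, E) G))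
    (j : V →ₗ[ℝ] GroupLieAlgebra 𝓘(ℝ, E) G) : Prop where
  pair : IsOrthogonalSymmetricPair 𝔥 j
  projInvariant_eq_zero : ∀ a : G, ∀ Z ∈ 𝔥, projInvariant (F := F) K a Z = 0
  inner_projInvariant : ∀ (a : G) (u v : V),
    inner ℝ (projInvariant (F := F) K a (j u)) (projInvariant K a (j v)) = inner ℝ u v
  surjective : ∀ a : G, Function.Surjective fun u ↦ projInvariant (F := F) K a (j u)

theorem exists_isSymmetricFrame [IsTopologicalGroup G] [T2Space G]
    [LieAlgebra.IsSemisimple ℝ (GroupLieAlgebra 𝓘(ℝ, E) G)]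
    (σ : G →* G) (hσ : ContMDiff 𝓘(ℝ, E) 𝓘(ℝ, E) ∞ σ) (hσσ : ∀ g, σ (σ g) = g)
    (hK : K = fixedSubgroupComponent σ)
    (𝔥 : LieSubalgebra ℝ (GroupLieAlgebra 𝓘(ℝ, E) G)) (h𝔥 : 𝔥 = lieAlgebraOfSubgroup K)
    (heff : ∀ J : LieIdeal ℝ (GroupLieAlgebra 𝓘(ℝ, E) G),
      J.toSubmodule ≤ 𝔥.toSubmodule → J = ⊥)
    [IsManifold 𝓘(ℝ, F) ∞ (G ⧸ K)]
    (hπ : Manifold.IsSubmersion 𝓘(ℝ, E) 𝓘(ℝ, F) ∞ (QuotientGroup.mk : G → G ⧸ K))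
    (hg : IsKillingSubmersionMetric (E := E) (F := F) K) :
    ∃ (n : ℕ) (j : EuclideanSpace ℝ (Fin n) →ₗ[ℝ] GroupLieAlgebra 𝓘(ℝ, E) G),
      LinearMap.range j = killingOrthogonal 𝔥 ∧ IsSymmetricFrame (F := F) K 𝔥 j := by
  have hmem : ∀ x, x ∈ 𝔥 ↔ involutionDifferential hσ hσσ x = x := fun x ↦ by
    rw [h𝔥, hK]
    exact mem_lieAlgebraOfSubgroup_fixedSubgroupComponent hσ x
  have hθ := endDifferential_involutive hσ hσσ
  have hzero : ∀ a : G, ∀ Z ∈ 𝔥, projInvariant (F := F) K a Z = 0 := by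
    intro a Z hZ
    obtain ⟨γ, hγ0, hγ, hγK⟩ := exists_oneParameterSubgroup_of_fixed hσ ((hmem Z).1 hZ)
    exact projInvariant_eq_zero hπ hγ0 hγ (fun t ↦ hK ▸ hγK t) a
  have hginner : ∀ a : G, ∀ X ∈ killingOrthogonal 𝔥, ∀ Y ∈ killingOrthogonal 𝔥,
      inner ℝ (projInvariant (F := F) K a X) (projInvariant K a Y) =
        -killingForm ℝ (GroupLieAlgebra 𝓘(ℝ, E) G) X Y := by
    rw [h𝔥]
    exact hg
  have hκ := LieAlgebra.IsKilling.killingForm_nondegenerate ℝ (GroupLieAlgebra 𝓘(ℝ, E) G)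
  have hsplit : ∀ x : GroupLieAlgebra 𝓘(ℝ, E) G, ∃ Z ∈ 𝔥, ∃ Y ∈ killingOrthogonal 𝔥,
      x = Z + Y := exists_eq_add_of_involutive _ hθ hmem
  let b : LinearMap.BilinForm ℝ (killingOrthogonal 𝔥) :=
    -(killingForm ℝ (GroupLieAlgebra 𝓘(ℝ, E) G)).compl₁₂ (killingOrthogonal 𝔥).subtype
      (killingOrthogonal 𝔥).subtype
  have hb : ∀ X Y, b X Y = -killingForm ℝ (GroupLieAlgebra 𝓘(ℝ, E) G) X Y := fun X Y ↦ rfl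
  -- Positivity of -B on 𝔭 is inherited from the metric. If X projects to zero at the identity, it
  -- is B-orthogonal to 𝔭 by `hginner` and to 𝔥 by definition, so it lies in the radical of B.
  have hpos : ∀ X, X ≠ 0 → 0 < b X X := by
    intro X hX
    rw [hb, ← hginner 1 X X.2 X X.2]
    refine real_inner_self_pos.2 fun h0 ↦ hX (Subtype.ext (hκ.1 _ fun y ↦ ?_))
    obtain ⟨Z, hZ, Y, hY, rfl⟩ := hsplit y
    have h1 := hginner 1 X X.2 Y hY
    rw [h0, inner_zero_left] at h1
    have h2 : killingForm ℝ (GroupLieAlgebra 𝓘(ℝ, E) G) Z X = 0 := X.2 Z hZ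
    rw [LieModule.traceForm_comm] at h2
    rw [map_add, h2]
    linarith
  obtain ⟨φ, hφ⟩ := exists_linearEquiv_euclideanSpace_of_posDef b
    (fun X Y ↦ congrArg _ (LieModule.traceForm_comm ..)) hpos
  let j := (killingOrthogonal 𝔥).subtype ∘ₗ φ.toLinearMap
  have hj : LinearMap.range j = killingOrthogonal 𝔥 := by
    rw [LinearMap.range_comp, LinearEquiv.range, Submodule.map_top, Submodule.range_subtype]
  have hpair : IsOrthogonalSymmetricPair 𝔥 j :=
    isOrthogonalSymmetricPair_of_involutive _ hθ hmem heff j hj hφ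
  refine ⟨_, j, hj, hpair, hzero, fun a u v ↦ ?_, fun a w ↦ ?_⟩
  · rw [hpair.inner_eq]
    exact hginner a _ (φ u).2 _ (φ v).2
  · obtain ⟨x, rfl⟩ := projInvariant_surjective hπ a w
    refine ⟨IsOrthogonalSymmetricPair.proj j x, ?_⟩
    have h1 := hzero a _ (hpair.sub_mem x)
    rw [map_sub, sub_eq_zero] at h1
    exact h1.symm

namespace IsSymmetricFrame

variable {𝔥 : LieSubalgebra ℝ (GroupLieAlgebra 𝓘(ℝ, E) G)}
  {j : V →ₗ[ℝ] GroupLieAlgebra 𝓘(ℝ, E) G} (h : IsSymmetricFrame (F := F) K 𝔥 j)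

/-- The isometry from `V` to the tangent space of `G ⧸ K` at `a K`. -/
noncomputable def frame (a : G) : V ≃ₗᵢ[ℝ] TangentSpace 𝓘(ℝ, F) (QuotientGroup.mk a : G ⧸ K) :=
  LinearIsometryEquiv.ofSurjective
    ((projInvariant (F := F) K a ∘ₗ j).isometryOfInner (h.inner_projInvariant a)) (h.surjective a)

theorem frame_apply (a : G) (u : V) : h.frame a u = projInvariant (F := F) K a (j u) := rfl

include h in
theorem finrank_eq : Module.finrank ℝ V = Module.finrank ℝ F :=
  (h.frame 1).toLinearEquiv.finrank_eq

/-- Translating the frame to another point of `G` gives an orthogonal symmetric pair whose Euclidean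
space is the tangent space there. -/
theorem isOrthogonalSymmetricPair_tangentSpace (a : G) :
    IsOrthogonalSymmetricPair 𝔥 (j ∘ₗ (h.frame a).symm.toLinearEquiv.toLinearMap) where
  isCompl := by
    rw [LinearMap.range_comp, LinearEquiv.range, Submodule.map_top]
    exact h.pair.isCompl
  inner_eq u v := by
    rw [← (h.frame a).symm.inner_map_map u v]
    exact h.pair.inner_eq _ _
  orthogonal Z hZ u := h.pair.orthogonal Z hZ _
  lie_mem_range Z hZ u := by
    rw [LinearMap.range_comp, LinearEquiv.range, Submodule.map_top]
    exact h.pair.lie_mem_range Z hZ _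
  lie_mem u v := h.pair.lie_mem _ _
  effective := h.pair.effective

end IsSymmetricFrame

end SymmetricFrame

/-! ### Leibniz rule for brackets -/

section VectorFieldCalculus

open VectorField Set Filter Topology

variable {E : Type*} [NormedAddCommGroup E] [NormedSpace ℝ E] [CompleteSpace E]
  {M : Type*} [TopologicalSpace M] [ChartedSpace E M] [IsManifold 𝓘(ℝ, E) 2 M]

theorem mlieBracket_sum_smul_right {ι : Type*} (s : Finset ι) {f : ι → M → ℝ}
    {B : ι → Π x : M, TangentSpace 𝓘(ℝ, E) x} {X : Π x : M, TangentSpace 𝓘(ℝ, E) x} {x : M}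
    (hf : ∀ i, MDiffAt (f i) x) (hB : ∀ i, MDiffAt (T% (B i)) x) :
    mlieBracket 𝓘(ℝ, E) X (fun y ↦ ∑ i ∈ s, f i y • B i y) x =
      ∑ i ∈ s, (mvfderiv 𝓘(ℝ, E) (f i) x (X x) • B i x +
        f i x • mlieBracket 𝓘(ℝ, E) X (B i) x) := by
  have : IsManifold 𝓘(ℝ, E) 1 M := IsManifold.of_le one_le_two
  classical
  induction s using Finset.induction_on with
  | empty =>
    simp only [Finset.sum_empty]
    exact congrFun mlieBracket_zero_right x
  | insert i s hi ih =>
    simp only [Finset.sum_insert hi]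
    rw [← ih, ← mlieBracket_smul_right (hf i) (hB i)]
    exact mlieBracket_add_right ((hf i).smul_section (hB i))
      (MDifferentiableAt.sum_section fun i _ ↦ (hf i).smul_section (hB i))

end VectorFieldCalculus

/-! ### Brackets of horizontal fields on G -/

section HorizontalFields

open VectorField Set Filter Topology

variable {E : Type*} [NormedAddCommGroup E] [NormedSpace ℝ E] [FiniteDimensional ℝ E]
  {G : Type*} [TopologicalSpace G] [ChartedSpace E G] [Group G] [LieGroup 𝓘(ℝ, E) ∞ G]
  {V : Type*} [NormedAddCommGroup V] [InnerProductSpace ℝ V] [FiniteDimensional ℝ V]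
  (j : V →ₗ[ℝ] GroupLieAlgebra 𝓘(ℝ, E) G)

/-- Left translation of the Lie algebra to `a`, as a linear map. -/
noncomputable def leftTranslation (a : G) :
    GroupLieAlgebra 𝓘(ℝ, E) G →ₗ[ℝ] TangentSpace 𝓘(ℝ, E) a where
  toFun v := mulInvariantVectorField v a
  map_add' v w := map_add (mfderiv 𝓘(ℝ, E) 𝓘(ℝ, E) (a * ·) (1 : G)) v w
  map_smul' c v := ContinuousLinearMap.map_smul (mfderiv 𝓘(ℝ, E) 𝓘(ℝ, E) (a * ·) (1 : G)) c v

/-- The vector field `b ↦ b • j (x b)` on `G`. -/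
noncomputable def horizontalField (x : G → V) (b : G) : TangentSpace 𝓘(ℝ, E) b :=
  mulInvariantVectorField (j (x b)) b

omit [FiniteDimensional ℝ E] [LieGroup 𝓘(ℝ, E) ∞ G] in
theorem horizontalField_eq_sum (x : G → V) : horizontalField j x = fun b ↦
    ∑ i, inner ℝ (stdOrthonormalBasis ℝ V i) (x b) •
      mulInvariantVectorField (j (stdOrthonormalBasis ℝ V i)) b := by
  ext b
  change leftTranslation b (j (x b)) =
    ∑ i, inner ℝ (stdOrthonormalBasis ℝ V i) (x b) •
      leftTranslation b (j (stdOrthonormalBasis ℝ V i))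
  conv_lhs => rw [← (stdOrthonormalBasis ℝ V).sum_repr' (x b)]
  simp only [map_sum, map_smul]

variable {j} {x y : G → V} {a : G}

omit [FiniteDimensional ℝ E] [Group G] [LieGroup 𝓘(ℝ, E) ∞ G] [FiniteDimensional ℝ V] in
theorem mdifferentiableAt_inner_left (v : V) (hx : MDiffAt x a) :
    MDiffAt (fun b ↦ inner ℝ v (x b)) a :=
  ((innerSL ℝ v).differentiableAt.mdifferentiableAt (x := x a)).comp a hx

omit [FiniteDimensional ℝ E] [Group G] [LieGroup 𝓘(ℝ, E) ∞ G] [FiniteDimensional ℝ V] in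
theorem mvfderiv_inner_left (v : V) (hx : MDiffAt x a) (w : TangentSpace 𝓘(ℝ, E) a) :
    mvfderiv 𝓘(ℝ, E) (fun b ↦ inner ℝ v (x b)) a w = inner ℝ v (mvfderiv 𝓘(ℝ, E) x a w) := by
  have := mfderiv_comp_apply a ((innerSL ℝ v).differentiableAt.mdifferentiableAt (x := x a)) hx w
  rw [mfderiv_eq_fderiv, ContinuousLinearMap.fderiv] at this
  exact this

omit [FiniteDimensional ℝ E] in
theorem mdifferentiableAt_horizontalField (hx : MDiffAt x a) :
    MDiffAt (T% (horizontalField j x)) a := by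
  rw [horizontalField_eq_sum]
  exact MDifferentiableAt.sum_section fun i _ ↦ (mdifferentiableAt_inner_left _ hx).smul_section
    (mdifferentiableAt_mulInvariantVectorField _)

theorem mlieBracket_mulInvariantVectorField_horizontalField (v : GroupLieAlgebra 𝓘(ℝ, E) G)
    (hx : MDiffAt x a) :
    mlieBracket 𝓘(ℝ, E) (mulInvariantVectorField v) (horizontalField j x) a =
      leftTranslation a
        (⁅v, j (x a)⁆ + j (mvfderiv 𝓘(ℝ, E) x a (mulInvariantVectorField v a))) := by
  rw [horizontalField_eq_sum, mlieBracket_sum_smul_right _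
    (fun i ↦ mdifferentiableAt_inner_left _ hx)
    (fun i ↦ mdifferentiableAt_mulInvariantVectorField _)]
  simp only [mvfderiv_inner_left _ hx, ← mulInvariantVector_mlieBracket,
    ← GroupLieAlgebra.bracket_def]
  have h1 := fun u : V ↦ congrArg j ((stdOrthonormalBasis ℝ V).sum_repr' u)
  conv_rhs => 
    rw [← h1 (x a), ← h1 (mvfderiv 𝓘(ℝ, E) x a _), map_sum, map_sum, lie_sum, map_add, map_sum,
      map_sum, add_comm]
  simp only [map_smul, lie_smul, Finset.sum_add_distrib]
  rfl

/-- Expand y in a basis with function coefficients, then treat x by antisymmetry and the preceding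
formula. The term in the Lie bracket of values becomes vertical in a symmetric pair and later
produces the curvature. -/
theorem mlieBracket_horizontalField (hx : MDiffAt x a) (hy : MDiffAt y a) :
    mlieBracket 𝓘(ℝ, E) (horizontalField j x) (horizontalField j y) a =
      leftTranslation a (⁅j (x a), j (y a)⁆ +
        j (mvfderiv 𝓘(ℝ, E) y a (horizontalField j x a) -
          mvfderiv 𝓘(ℝ, E) x a (horizontalField j y a))) := by
  have h0 := mlieBracket_sum_smul_right (X := horizontalField j x) Finset.univ
    (fun i ↦ mdifferentiableAt_inner_left (stdOrthonormalBasis ℝ V i) hy)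
    (fun i ↦ mdifferentiableAt_mulInvariantVectorField (j (stdOrthonormalBasis ℝ V i)))
  rw [← horizontalField_eq_sum] at h0
  have h1 := fun u : V ↦ congrArg j ((stdOrthonormalBasis ℝ V).sum_repr' u)
  have h2 : mvfderiv 𝓘(ℝ, E) x a (horizontalField j y a) =
      ∑ i, inner ℝ (stdOrthonormalBasis ℝ V i) (y a) • mvfderiv 𝓘(ℝ, E) x a
        (mulInvariantVectorField (j (stdOrthonormalBasis ℝ V i)) a) := by
    rw [horizontalField_eq_sum, map_sum]
    exact Finset.sum_congr rfl fun i _ ↦ ContinuousLinearMap.map_smul _ _ _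
  have h3 : ⁅j (x a), j (y a)⁆ = ∑ i, inner ℝ (stdOrthonormalBasis ℝ V i) (y a) •
      ⁅j (x a), j (stdOrthonormalBasis ℝ V i)⁆ := by
    conv_lhs => rw [← h1 (y a), map_sum, lie_sum]
    simp only [map_smul, lie_smul]
  have h4 := h1 (mvfderiv 𝓘(ℝ, E) y a (horizontalField j x a))
  rw [map_sum] at h4
  simp only [map_smul] at h4
  rw [h0, h2, h3, map_sub, ← h4, map_sum, ← Finset.sum_sub_distrib, ← Finset.sum_add_distrib, map_sum]
  refine Finset.sum_congr rfl fun i _ ↦ ?_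
  rw [mlieBracket_swap_apply, mlieBracket_mulInvariantVectorField_horizontalField _ hx,
    mvfderiv_inner_left _ hy, ← lie_skew]
  simp only [map_smul, map_add, map_sub, map_neg, smul_neg, smul_add, neg_add]
  change _ • leftTranslation a _ + _ = _
  abel

end HorizontalFields

/-! ### Lifting vector fields and the Levi-Civita connection to G -/

section Lift

open VectorField Set Filter Topology

variable {E : Type*} [NormedAddCommGroup E] [NormedSpace ℝ E] [FiniteDimensional ℝ E]
  {G : Type*} [TopologicalSpace G] [ChartedSpace E G] [Group G] [LieGroup 𝓘(ℝ, E) ∞ G]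
  {F : Type*} [NormedAddCommGroup F] [NormedSpace ℝ F] [FiniteDimensional ℝ F]
  {K : Subgroup G} [ChartedSpace F (G ⧸ K)] [IsManifold 𝓘(ℝ, F) ∞ (G ⧸ K)]
  {V : Type*} [NormedAddCommGroup V] [InnerProductSpace ℝ V] [FiniteDimensional ℝ V]
  (hπ : Manifold.IsSubmersion 𝓘(ℝ, E) 𝓘(ℝ, F) ∞ (QuotientGroup.mk : G → G ⧸ K))

include hπ

omit [FiniteDimensional ℝ E] [LieGroup 𝓘(ℝ, E) ∞ G] [FiniteDimensional ℝ F]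
  [IsManifold 𝓘(ℝ, F) ∞ (G ⧸ K)] in
theorem contMDiff_quotientMk : ContMDiff 𝓘(ℝ, E) 𝓘(ℝ, F) ∞ (QuotientGroup.mk : G → G ⧸ K) :=
  fun a ↦ (hπ.isSubmersionAt a).contMDiffAt

omit [FiniteDimensional ℝ E] [LieGroup 𝓘(ℝ, E) ∞ G] [FiniteDimensional ℝ F]
  [IsManifold 𝓘(ℝ, F) ∞ (G ⧸ K)] in
theorem mdifferentiableAt_quotientMk (a : G) :
    MDifferentiableAt 𝓘(ℝ, E) 𝓘(ℝ, F) (QuotientGroup.mk : G → G ⧸ K) a :=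
  (contMDiff_quotientMk hπ a).mdifferentiableAt (by simp)

omit [FiniteDimensional ℝ E] [FiniteDimensional ℝ F] in
theorem contMDiff_projInvariant (v : GroupLieAlgebra 𝓘(ℝ, E) G) :
    ContMDiff 𝓘(ℝ, E) 𝓘(ℝ, F).tangent ∞ (fun b : G ↦
      (⟨QuotientGroup.mk b, projInvariant K b v⟩ : TangentBundle 𝓘(ℝ, F) (G ⧸ K))) :=
  ((contMDiff_quotientMk hπ).contMDiff_tangentMap (m := ∞) le_rfl).comp
    (contMDiff_infty_mulInvariantVectorField v)

omit [FiniteDimensional ℝ E] [FiniteDimensional ℝ F] in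
theorem mdifferentiableAt_projInvariant {j : V →ₗ[ℝ] GroupLieAlgebra 𝓘(ℝ, E) G} {x : G → V} {a : G}
    (hx : MDiffAt x a) : MDifferentiableAt 𝓘(ℝ, E) 𝓘(ℝ, F).tangent (fun b : G ↦
      (⟨QuotientGroup.mk b, projInvariant K b (j (x b))⟩ : TangentBundle 𝓘(ℝ, F) (G ⧸ K))) a :=
  (((contMDiff_quotientMk hπ).contMDiff_tangentMap (m := ∞) le_rfl).mdifferentiable (by simp)
    _).comp a (mdifferentiableAt_horizontalField hx)

omit hπ

variable [RiemannianBundle (fun x : G ⧸ K ↦ TangentSpace 𝓘(ℝ, F) x)]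
  {𝔥 : LieSubalgebra ℝ (GroupLieAlgebra 𝓘(ℝ, E) G)}
  {j : V →ₗ[ℝ] GroupLieAlgebra 𝓘(ℝ, E) G} (h : IsSymmetricFrame (F := F) K 𝔥 j)

namespace IsSymmetricFrame

/-- A vector field on `G ⧸ K`, read in the frame over `G`. -/
noncomputable def lift (U : Π x : G ⧸ K, TangentSpace 𝓘(ℝ, F) x) (b : G) : V :=
  (h.frame b).symm (U (QuotientGroup.mk b))

omit [FiniteDimensional ℝ F] [IsManifold 𝓘(ℝ, F) ∞ (G ⧸ K)] [FiniteDimensional ℝ V] in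
theorem projInvariant_lift (U : Π x : G ⧸ K, TangentSpace 𝓘(ℝ, F) x) (b : G) :
    projInvariant K b (j (h.lift U b)) = U (QuotientGroup.mk b) :=
  (h.frame b).apply_symm_apply _

omit [FiniteDimensional ℝ F] [IsManifold 𝓘(ℝ, F) ∞ (G ⧸ K)] in
-- Writing the coefficients as metric inner products lets the regularity of a lift follow from that
-- of the metric.
theorem lift_eq_sum (U : Π x : G ⧸ K, TangentSpace 𝓘(ℝ, F) x) : h.lift U = fun b ↦
    ∑ i, (inner ℝ (U (QuotientGroup.mk b)) (projInvariant K b (j (stdOrthonormalBasis ℝ V i))) : ℝ)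
      • stdOrthonormalBasis ℝ V i := by
  ext1 b
  rw [← (stdOrthonormalBasis ℝ V).sum_repr' (h.lift U b)]
  refine Finset.sum_congr rfl fun i _ ↦ ?_
  rw [← h.inner_projInvariant b, h.projInvariant_lift, real_inner_comm]

variable [IsContMDiffRiemannianBundle 𝓘(ℝ, F) ∞ F (fun x : G ⧸ K ↦ TangentSpace 𝓘(ℝ, F) x)]
  {U : Π x : G ⧸ K, TangentSpace 𝓘(ℝ, F) x} {a : G}

include hπ

omit [FiniteDimensional ℝ F] in
theorem contMDiffAt_lift (hU : CMDiffAt ∞ (T% U) (QuotientGroup.mk a)) :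
    ContMDiffAt 𝓘(ℝ, E) 𝓘(ℝ, V) ∞ (h.lift U) a := by
  rw [h.lift_eq_sum]
  refine contMDiffAt_finsetSum fun i _ ↦ (ContinuousLinearMap.toSpanSingleton ℝ
    (stdOrthonormalBasis ℝ V i)).contMDiff.contMDiffAt.comp a ?_
  exact ContMDiffAt.inner_bundle (F := F) (E := fun x : G ⧸ K ↦ TangentSpace 𝓘(ℝ, F) x)
    (b := fun b : G ↦ (QuotientGroup.mk b : G ⧸ K))
    (hU.comp a (contMDiff_quotientMk hπ a)) (contMDiff_projInvariant hπ _ a)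

omit [FiniteDimensional ℝ F] in
theorem mdifferentiableAt_lift (hU : MDiffAt (T% U) (QuotientGroup.mk a)) :
    MDiffAt (h.lift U) a := by
  have : h.lift U = ∑ i, fun b ↦ (inner ℝ (U (QuotientGroup.mk b))
      (projInvariant K b (j (stdOrthonormalBasis ℝ V i))) : ℝ) • stdOrthonormalBasis ℝ V i := by
    rw [h.lift_eq_sum, Finset.sum_fn]
  rw [this]
  refine MDifferentiableAt.sum fun i _ ↦ ((ContinuousLinearMap.toSpanSingleton ℝ
    (stdOrthonormalBasis ℝ V i)).contMDiff.mdifferentiable one_ne_zero _).comp a ?_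
  exact MDifferentiableAt.inner_bundle (F := F) (E := fun x : G ⧸ K ↦ TangentSpace 𝓘(ℝ, F) x)
    (b := fun b : G ↦ (QuotientGroup.mk b : G ⧸ K))
    (hU.comp a (mdifferentiableAt_quotientMk hπ a))
    ((contMDiff_projInvariant hπ _ a).mdifferentiableAt (by simp))

variable {W : Π x : G ⧸ K, TangentSpace 𝓘(ℝ, F) x}

/-- Horizontal lifts are projection-related to the original fields, and the vertical part [𝔭, 𝔭] ⊆ 𝔥
of their bracket projects to zero. -/
theorem mlieBracket_eq_projInvariant (hU : MDiffAt (T% U) (QuotientGroup.mk a))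
    (hW : MDiffAt (T% W) (QuotientGroup.mk a)) :
    mlieBracket 𝓘(ℝ, F) U W (QuotientGroup.mk a) = projInvariant K a
      (j (mvfderiv 𝓘(ℝ, E) (h.lift W) a (horizontalField j (h.lift U) a) -
        mvfderiv 𝓘(ℝ, E) (h.lift U) a (horizontalField j (h.lift W) a))) := by
  have h1 := mfderiv_mlieBracket_of_related
    ((contMDiff_quotientMk hπ a).of_le ENat.LEInfty.out)
    (mdifferentiableAt_horizontalField (j := j) (h.mdifferentiableAt_lift hπ hU))
    (mdifferentiableAt_horizontalField (j := j) (h.mdifferentiableAt_lift hπ hW)) hU hW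
    (.of_forall (h.projInvariant_lift U)) (.of_forall (h.projInvariant_lift W))
  rw [← h1, mlieBracket_horizontalField (h.mdifferentiableAt_lift hπ hU)
    (h.mdifferentiableAt_lift hπ hW)]
  change projInvariant K a _ = _
  rw [map_add, h.projInvariant_eq_zero a _ (h.pair.lie_mem _ _), zero_add]

omit [FiniteDimensional ℝ F] in
theorem mvfderiv_inner_eq (hU : MDiffAt (T% U) (QuotientGroup.mk a))
    (hW : MDiffAt (T% W) (QuotientGroup.mk a)) (u : V) :
    mvfderiv 𝓘(ℝ, F) (fun y : G ⧸ K ↦ (inner ℝ (U y) (W y) : ℝ)) (QuotientGroup.mk a)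
        (projInvariant K a (j u)) =
      inner ℝ (mvfderiv 𝓘(ℝ, E) (h.lift U) a (mulInvariantVectorField (j u) a)) (h.lift W a) +
      inner ℝ (h.lift U a) (mvfderiv 𝓘(ℝ, E) (h.lift W) a (mulInvariantVectorField (j u) a)) := by
  have hd : MDiffAt (fun y : G ⧸ K ↦ (inner ℝ (U y) (W y) : ℝ)) (QuotientGroup.mk a) :=
    MDifferentiableAt.inner_bundle (F := F) hU hW
  have h1 := mfderiv_comp_apply a hd (mdifferentiableAt_quotientMk hπ a)
    (mulInvariantVectorField (j u) a)
  have h2 : (fun y : G ⧸ K ↦ (inner ℝ (U y) (W y) : ℝ)) ∘ (QuotientGroup.mk : G → G ⧸ K) =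
      fun b ↦ inner ℝ (h.lift U b) (h.lift W b) := by
    ext b
    exact ((h.frame b).symm.inner_map_map _ _).symm
  rw [h2] at h1
  refine h1.symm.trans ?_
  have h3 := (h.mdifferentiableAt_lift hπ hU).hasMFDerivAt.prodMk
    (h.mdifferentiableAt_lift hπ hW).hasMFDerivAt
  have h4 : HasFDerivAt (fun p : V × V ↦ (inner ℝ p.1 p.2 : ℝ)) _ (h.lift U a, h.lift W a) :=
    hasFDerivAt_fst.inner ℝ hasFDerivAt_snd
  have h5 := (h4.hasMFDerivAt.comp a h3).mfderiv
  refine (congrArg (fun f ↦ f (mulInvariantVectorField (j u) a)) h5).trans ?_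
  exact add_comm _ _

/-- The Levi-Civita connection of `G ⧸ K`, read in the frame over `G`. -/
theorem covariantDerivative_eq_projInvariant
    {cov : CovariantDerivative 𝓘(ℝ, F) F (TangentSpace 𝓘(ℝ, F) : G ⧸ K → Type _)}
    (hcov : IsLeviCivita cov) (hU : MDiffAt (T% U) (QuotientGroup.mk a))
    (hW : MDiffAt (T% W) (QuotientGroup.mk a)) :
    cov W (QuotientGroup.mk a) (U (QuotientGroup.mk a)) = projInvariant K a
      (j (mvfderiv 𝓘(ℝ, E) (h.lift W) a (horizontalField j (h.lift U) a))) := by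
  -- S is the difference of the two connections. It is symmetric because both are torsion free and
  -- skew in its last two slots because both are metric, so it vanishes.
  let S : (Π x : G ⧸ K, TangentSpace 𝓘(ℝ, F) x) → (Π x : G ⧸ K, TangentSpace 𝓘(ℝ, F) x) →
      TangentSpace 𝓘(ℝ, F) (QuotientGroup.mk a : G ⧸ K) := fun X Y ↦
    cov Y (QuotientGroup.mk a) (X (QuotientGroup.mk a)) - projInvariant K a
      (j (mvfderiv 𝓘(ℝ, E) (h.lift Y) a (horizontalField j (h.lift X) a)))
  have hcomm : ∀ X Y, MDiffAt (T% X) (QuotientGroup.mk a) → MDiffAt (T% Y) (QuotientGroup.mk a) →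
      S X Y = S Y X := by
    intro X Y hX hY
    have h1 := hcov.torsion_free _ X Y hX hY
    rw [h.mlieBracket_eq_projInvariant hπ hX hY, map_sub, map_sub] at h1
    exact sub_eq_sub_iff_sub_eq_sub.2 h1
  have hskew : ∀ X Y Z, MDiffAt (T% X) (QuotientGroup.mk a) →
      MDiffAt (T% Y) (QuotientGroup.mk a) → MDiffAt (T% Z) (QuotientGroup.mk a) →
      (inner ℝ (S X Y) (Z (QuotientGroup.mk a)) : ℝ) =
        -inner ℝ (Y (QuotientGroup.mk a)) (S X Z) := by
    intro X Y Z hX hY hZ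
    have h1 := hcov.metric _ X Y Z hX hY hZ
    have h2 := h.mvfderiv_inner_eq hπ hY hZ (h.lift X a)
    rw [h.projInvariant_lift, h1, ← h.inner_projInvariant a, ← h.inner_projInvariant a,
      h.projInvariant_lift, h.projInvariant_lift] at h2
    simp only [S, inner_sub_left, inner_sub_right]
    change _ = inner ℝ (projInvariant K a (j (mvfderiv 𝓘(ℝ, E) (h.lift Y) a
      (horizontalField j (h.lift X) a)))) _ + inner ℝ _ (projInvariant K a
        (j (mvfderiv 𝓘(ℝ, E) (h.lift Z) a (horizontalField j (h.lift X) a)))) at h2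
    linarith
  rw [← sub_eq_zero]
  change S U W = 0
  set Z : Π x : G ⧸ K, TangentSpace 𝓘(ℝ, F) x := FiberBundle.extend F (S U W) with hZdef
  have hZ : MDiffAt (T% Z) (QuotientGroup.mk a) := FiberBundle.mdifferentiableAt_extend ..
  have hZa : Z (QuotientGroup.mk a) = S U W := FiberBundle.extend_apply_self _ _
  -- Alternating the skewness and symmetry relations three times gives ⟨S U W, Z⟩ = -⟨S U W, Z⟩,
  -- where Z takes the value S U W at the point.
  have h1 := hskew U W Z hU hW hZ
  have h2 := hskew Z W U hZ hW hU
  have h3 := hskew W U Z hW hU hZ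
  rw [hcomm U Z hU hZ] at h1
  rw [hcomm Z W hZ hW] at h2
  rw [hcomm W U hW hU] at h3
  rw [real_inner_comm] at h2
  rw [hZa] at h1 h3
  rw [← inner_self_eq_zero (𝕜 := ℝ)]
  linarith

end IsSymmetricFrame

end Lift

/-! ### The curvature tensor of the symmetric space -/

section CurvatureOfQuotient

open VectorField Set Filter Topology

variable {E : Type*} [NormedAddCommGroup E] [NormedSpace ℝ E] [FiniteDimensional ℝ E]
  {G : Type*} [TopologicalSpace G] [ChartedSpace E G] [Group G] [LieGroup 𝓘(ℝ, E) ∞ G]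
  {F : Type*} [NormedAddCommGroup F] [NormedSpace ℝ F] [FiniteDimensional ℝ F]
  {K : Subgroup G} [ChartedSpace F (G ⧸ K)] [IsManifold 𝓘(ℝ, F) ∞ (G ⧸ K)]
  {V : Type*} [NormedAddCommGroup V] [InnerProductSpace ℝ V] [FiniteDimensional ℝ V]
  (hπ : Manifold.IsSubmersion 𝓘(ℝ, E) 𝓘(ℝ, F) ∞ (QuotientGroup.mk : G → G ⧸ K))
  [RiemannianBundle (fun x : G ⧸ K ↦ TangentSpace 𝓘(ℝ, F) x)]
  {𝔥 : LieSubalgebra ℝ (GroupLieAlgebra 𝓘(ℝ, E) G)}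
  {j : V →ₗ[ℝ] GroupLieAlgebra 𝓘(ℝ, E) G} (h : IsSymmetricFrame (F := F) K 𝔥 j)
  [IsContMDiffRiemannianBundle 𝓘(ℝ, F) ∞ F (fun x : G ⧸ K ↦ TangentSpace 𝓘(ℝ, F) x)]
  {U W : Π x : G ⧸ K, TangentSpace 𝓘(ℝ, F) x} {a : G}
  {cov : CovariantDerivative 𝓘(ℝ, F) F (TangentSpace 𝓘(ℝ, F) : G ⧸ K → Type _)}

namespace IsSymmetricFrame

include hπ

omit [FiniteDimensional ℝ E] [FiniteDimensional ℝ F]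
  [RiemannianBundle (fun x : G ⧸ K ↦ TangentSpace 𝓘(ℝ, F) x)]
  [IsContMDiffRiemannianBundle 𝓘(ℝ, F) ∞ F (fun x : G ⧸ K ↦ TangentSpace 𝓘(ℝ, F) x)] in
/-- A vector field whose lift is differentiable at `a` is differentiable at `a K`. -/
theorem mdifferentiableAt_of_lift {x : G → V} (hx : MDiffAt x a)
    (hU : ∀ᶠ b in 𝓝 a, U (QuotientGroup.mk b) = projInvariant K b (j (x b))) :
    MDiffAt (T% U) (QuotientGroup.mk a) := by
  obtain ⟨s, hsa, hs, hπs⟩ := (hπ.isSubmersionAt a).exists_local_section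
  have hs' : MDifferentiableAt 𝓘(ℝ, F) 𝓘(ℝ, E) s (QuotientGroup.mk a) :=
    hs.mdifferentiableAt (by simp)
  have h1 : MDifferentiableAt 𝓘(ℝ, F) 𝓘(ℝ, F).tangent
      ((fun b : G ↦ (⟨QuotientGroup.mk b, projInvariant K b (j (x b))⟩ :
        TangentBundle 𝓘(ℝ, F) (G ⧸ K))) ∘ s) (QuotientGroup.mk a) := by
    refine MDifferentiableAt.comp _ ?_ hs'
    rw [hsa]
    exact mdifferentiableAt_projInvariant hπ hx
  refine h1.congr_of_eventuallyEq ?_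
  have hsU : ∀ᶠ y in 𝓝 (QuotientGroup.mk a : G ⧸ K),
      U (QuotientGroup.mk (s y)) = projInvariant K (s y) (j (x (s y))) := by
    refine hs'.continuousAt.eventually
      (p := fun b ↦ U (QuotientGroup.mk b) = projInvariant K b (j (x b))) ?_
    rwa [hsa]
  filter_upwards [hπs, hsU] with y hy hy'
  rw [Function.comp_apply, ← hy', hy]

/-- The lift of a vector field is equivariant for the isotropy action. -/
theorem j_mvfderiv_lift (hU : MDiffAt (T% U) (QuotientGroup.mk a))
    {Z : GroupLieAlgebra 𝓘(ℝ, E) G} (hZ : Z ∈ 𝔥) :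
    j (mvfderiv 𝓘(ℝ, E) (h.lift U) a (mulInvariantVectorField Z a)) = -⁅Z, j (h.lift U a)⁆ := by
  -- The left-invariant field of Z is related to the zero field and the horizontal lift to U, so
  -- their bracket projects to [0, U] = 0.
  have h1 := mfderiv_mlieBracket_of_related
    ((contMDiff_quotientMk hπ a).of_le ENat.LEInfty.out)
    (mdifferentiableAt_mulInvariantVectorField Z)
    (mdifferentiableAt_horizontalField (j := j) (h.mdifferentiableAt_lift hπ hU))
    (X' := 0) (Y' := U) (contMDiff_zeroSection ℝ _ _ |>.mdifferentiableAt one_ne_zero) hU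
    (.of_forall fun b ↦ h.projInvariant_eq_zero b Z hZ) (.of_forall (h.projInvariant_lift U))
  rw [mlieBracket_zero_left, mlieBracket_mulInvariantVectorField_horizontalField _
    (h.mdifferentiableAt_lift hπ hU)] at h1
  change projInvariant K a _ = 0 at h1
  obtain ⟨v, hv⟩ := h.pair.lie_mem_range Z hZ (h.lift U a)
  rw [← hv, ← map_add] at h1
  have h2 : v + mvfderiv 𝓘(ℝ, E) (h.lift U) a (mulInvariantVectorField Z a) = 0 :=
    (h.frame a).injective (h1.trans (map_zero _).symm)
  rw [← hv, ← map_neg, eq_neg_of_add_eq_zero_right h2]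

/-- On lifts, ∇ is differentiation along horizontal fields. The commutator of two such derivatives
is the derivative along their bracket; subtracting ∇ along [X, Y] leaves the vertical part, whose
action is minus the isotropy bracket. -/
theorem curvatureField_eq_projInvariant (hcov : IsLeviCivita cov)
    {X Y Z : Π x : G ⧸ K, TangentSpace 𝓘(ℝ, F) x}
    (hX : CMDiffAt ∞ (T% X) (QuotientGroup.mk a)) (hY : CMDiffAt ∞ (T% Y) (QuotientGroup.mk a))
    (hZ : CMDiffAt ∞ (T% Z) (QuotientGroup.mk a)) :
    curvatureField cov X Y Z (QuotientGroup.mk a) = projInvariant K a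
      (-⁅⁅j (h.lift X a), j (h.lift Y a)⁆, j (h.lift Z a)⁆) := by
  have hd : ∀ {W : Π x : G ⧸ K, TangentSpace 𝓘(ℝ, F) x}, CMDiffAt ∞ (T% W) (QuotientGroup.mk a) →
      ∀ᶠ b : G in 𝓝 a, MDiffAt (T% W) (QuotientGroup.mk b) := by
    intro W hW
    refine (mdifferentiableAt_quotientMk hπ a).continuousAt.eventually
      (p := fun y ↦ MDiffAt (T% W) y) ?_
    filter_upwards [(contMDiffAt_iff_contMDiffAt_nhds (by simp)).1 (hW.of_le
      (n := ∞) (m := 1) (by simp))] with y hy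
    exact hy.mdifferentiableAt one_ne_zero
  have hz := (h.contMDiffAt_lift hπ hZ).of_le (m := 2) ENat.LEInfty.out
  have hN : ∀ {W : Π x : G ⧸ K, TangentSpace 𝓘(ℝ, F) x}, CMDiffAt ∞ (T% W) (QuotientGroup.mk a) →
      ∀ {S : Π x : G ⧸ K, TangentSpace 𝓘(ℝ, F) x}, CMDiffAt ∞ (T% S) (QuotientGroup.mk a) →
      cov (fun y ↦ cov Z y (W y)) (QuotientGroup.mk a) (S (QuotientGroup.mk a)) =
        projInvariant K a (j (mvfderiv 𝓘(ℝ, E) (fun b ↦ mvfderiv 𝓘(ℝ, E) (h.lift Z) b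
          (horizontalField j (h.lift W) b)) a (horizontalField j (h.lift S) a))) := by
    intro W hW S hS
    have hx := mdifferentiableAt_mvfderiv_apply hz (mdifferentiableAt_horizontalField (j := j)
      (h.mdifferentiableAt_lift hπ (hW.mdifferentiableAt (by simp))))
    have hNW : ∀ᶠ b : G in 𝓝 a, cov Z (QuotientGroup.mk b) (W (QuotientGroup.mk b)) =
        projInvariant K b (j (mvfderiv 𝓘(ℝ, E) (h.lift Z) b
          (horizontalField j (h.lift W) b))) := by
      filter_upwards [hd hZ, hd hW] with b hb hb'
      exact h.covariantDerivative_eq_projInvariant hπ hcov hb' hb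
    rw [h.covariantDerivative_eq_projInvariant hπ hcov (hS.mdifferentiableAt (by simp))
      (mdifferentiableAt_of_lift hπ hx hNW)]
    have hlift : h.lift (fun y ↦ cov Z y (W y)) =ᶠ[𝓝 a] fun b ↦ mvfderiv 𝓘(ℝ, E) (h.lift Z) b
        (horizontalField j (h.lift W) b) := by
      filter_upwards [hNW] with b hb
      rw [lift, hb]
      exact (h.frame b).symm_apply_apply _
    exact congrArg (fun f : E →L[ℝ] V ↦ projInvariant K a (j (f (horizontalField j (h.lift S) a))))
      hlift.mfderiv_eq
  have hX' := h.mdifferentiableAt_lift hπ (hX.mdifferentiableAt (n := ∞) (by simp))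
  have hY' := h.mdifferentiableAt_lift hπ (hY.mdifferentiableAt (n := ∞) (by simp))
  set w : V := mvfderiv 𝓘(ℝ, E) (h.lift Y) a (horizontalField j (h.lift X) a) -
    mvfderiv 𝓘(ℝ, E) (h.lift X) a (horizontalField j (h.lift Y) a) with hw
  have hB := h.mlieBracket_eq_projInvariant hπ (hX.mdifferentiableAt (n := ∞) (by simp))
    (hY.mdifferentiableAt (n := ∞) (by simp))
  rw [← hw] at hB
  -- The connection depends only on the value of its direction at the point, so the bracket field is
  -- replaced there by a smooth extension of that value.
  have hNB : cov Z (QuotientGroup.mk a) (mlieBracket 𝓘(ℝ, F) X Y (QuotientGroup.mk a)) =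
      projInvariant K a (j (mvfderiv 𝓘(ℝ, E) (h.lift Z) a (leftTranslation a (j w)))) := by
    have h1 := h.covariantDerivative_eq_projInvariant hπ hcov
      (U := FiberBundle.extend F (mlieBracket 𝓘(ℝ, F) X Y (QuotientGroup.mk a)))
      (FiberBundle.mdifferentiableAt_extend ..) (hZ.mdifferentiableAt (n := ∞) (by simp))
    have h2 : h.lift (FiberBundle.extend F (mlieBracket 𝓘(ℝ, F) X Y (QuotientGroup.mk a))) a =
        w := by
      rw [lift, FiberBundle.extend_apply_self, hB]
      exact (h.frame a).symm_apply_apply w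
    rw [FiberBundle.extend_apply_self, horizontalField, h2] at h1
    exact h1
  have hcomm := mvfderiv_mlieBracket hz (mdifferentiableAt_horizontalField (j := j) hX')
    (mdifferentiableAt_horizontalField (j := j) hY')
  rw [mlieBracket_horizontalField hX' hY', map_add, ← hw] at hcomm
  have hvert := h.j_mvfderiv_lift hπ (hZ.mdifferentiableAt (n := ∞) (by simp))
    (h.pair.lie_mem (h.lift X a) (h.lift Y a))
  rw [curvatureField, hN hY hX, hN hX hY, hNB, ← map_sub, ← map_sub, ← map_sub, ← map_sub,
    ← hcomm, ← hvert]
  refine congrArg (fun v ↦ projInvariant K a (j v)) (sub_eq_of_eq_add ?_)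
  exact map_add (mvfderiv 𝓘(ℝ, E) (h.lift Z) a) _ _

/-- The curvature tensor of a symmetric space at `a K`. -/
theorem riemannTensor_eq_killingForm (hcov : IsLeviCivita cov)
    (X Y Z W : TangentSpace 𝓘(ℝ, F) (QuotientGroup.mk a : G ⧸ K)) :
    riemannTensor cov (QuotientGroup.mk a) X Y Z W =
      killingForm ℝ (GroupLieAlgebra 𝓘(ℝ, E) G)
        ⁅⁅j ((h.frame a).symm X), j ((h.frame a).symm Y)⁆, j ((h.frame a).symm W)⁆
        (j ((h.frame a).symm Z)) := by
  have hext : ∀ v : TangentSpace 𝓘(ℝ, F) (QuotientGroup.mk a : G ⧸ K),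
      h.lift (FiberBundle.extend F v) a = (h.frame a).symm v := fun v ↦ by
    rw [lift, FiberBundle.extend_apply_self]
  rw [riemannTensor, h.curvatureField_eq_projInvariant hπ hcov
    (FiberBundle.contMDiffAt_extend ..) (FiberBundle.contMDiffAt_extend ..)
    (FiberBundle.contMDiffAt_extend ..), hext, hext, hext]
  obtain ⟨v, hv⟩ := h.pair.lie_mem_range _
    (h.pair.lie_mem ((h.frame a).symm X) ((h.frame a).symm Y)) ((h.frame a).symm W)
  rw [← hv, ← map_neg j]
  have h1 := (h.frame a).symm.inner_map_map (h.frame a (-v)) Z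
  rw [LinearIsometryEquiv.symm_apply_apply] at h1
  refine h1.symm.trans ?_
  rw [h.pair.inner_eq, map_neg, map_neg, LinearMap.neg_apply, neg_neg]

end IsSymmetricFrame

end CurvatureOfQuotient

/-! ### Ricci and scalar curvature -/

section Einstein

variable {E : Type*} [NormedAddCommGroup E] [NormedSpace ℝ E] [FiniteDimensional ℝ E]
  {G : Type*} [TopologicalSpace G] [ChartedSpace E G] [Group G] [LieGroup 𝓘(ℝ, E) ∞ G]
  {F : Type*} [NormedAddCommGroup F] [NormedSpace ℝ F] [FiniteDimensional ℝ F]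
  {K : Subgroup G} [ChartedSpace F (G ⧸ K)] [IsManifold 𝓘(ℝ, F) ∞ (G ⧸ K)]
  {V : Type*} [NormedAddCommGroup V] [InnerProductSpace ℝ V] [FiniteDimensional ℝ V]
  (hπ : Manifold.IsSubmersion 𝓘(ℝ, E) 𝓘(ℝ, F) ∞ (QuotientGroup.mk : G → G ⧸ K))
  [RiemannianBundle (fun x : G ⧸ K ↦ TangentSpace 𝓘(ℝ, F) x)]
  {𝔥 : LieSubalgebra ℝ (GroupLieAlgebra 𝓘(ℝ, E) G)}
  {j : V →ₗ[ℝ] GroupLieAlgebra 𝓘(ℝ, E) G} (h : IsSymmetricFrame (F := F) K 𝔥 j)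
  [IsContMDiffRiemannianBundle 𝓘(ℝ, F) ∞ F (fun x : G ⧸ K ↦ TangentSpace 𝓘(ℝ, F) x)]
  {cov : CovariantDerivative 𝓘(ℝ, F) F (TangentSpace 𝓘(ℝ, F) : G ⧸ K → Type _)}

namespace IsSymmetricFrame

include hπ h

theorem ricciTensor_eq_inner (hcov : IsLeviCivita cov) (x : G ⧸ K)
    (X Y : TangentSpace 𝓘(ℝ, F) x) : ricciTensor cov x X Y = 1 / 2 * inner ℝ X Y := by
  obtain ⟨a, rfl⟩ := QuotientGroup.mk_surjective x
  have : FiniteDimensional ℝ (TangentSpace 𝓘(ℝ, F) (QuotientGroup.mk a : G ⧸ K)) :=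
    inferInstanceAs (FiniteDimensional ℝ F)
  rw [← (h.isOrthogonalSymmetricPair_tangentSpace a).sum_killingForm_eq_inner
    (stdOrthonormalBasis ℝ _) X Y]
  exact Finset.sum_congr rfl fun i _ ↦ h.riemannTensor_eq_killingForm hπ hcov _ _ _ _

theorem scalarCurvature_eq_finrank (hcov : IsLeviCivita cov) (x : G ⧸ K) :
    scalarCurvature cov x = 1 / 2 * (Module.finrank ℝ F : ℝ) := by
  have : FiniteDimensional ℝ (TangentSpace 𝓘(ℝ, F) x) :=
    inferInstanceAs (FiniteDimensional ℝ F)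
  simp only [scalarCurvature, h.ricciTensor_eq_inner hπ hcov, OrthonormalBasis.inner_eq_one]
  rw [Finset.sum_const, Finset.card_univ, Fintype.card_fin, nsmul_eq_mul, mul_one, mul_comm]
  rfl

end IsSymmetricFrame

end Einstein

theorem mainTheorem7
    -- a compact semisimple Lie group `G` with an involutive automorphism `σ`
    {E : Type*} [NormedAddCommGroup E] [NormedSpace ℝ E] [FiniteDimensional ℝ E]
    {G : Type*} [TopologicalSpace G] [ChartedSpace E G] [Group G] [LieGroup 𝓘(ℝ, E) ∞ G]
    [IsTopologicalGroup G] [CompactSpace G] [T2Space G]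
    [LieAlgebra.IsSemisimple ℝ (GroupLieAlgebra 𝓘(ℝ, E) G)]
    (σ : G →* G) (hσ : ContMDiff 𝓘(ℝ, E) 𝓘(ℝ, E) ∞ σ) (hσσ : ∀ g, σ (σ g) = g)
    -- the subgroup `K` and its Lie algebra `𝔥`
    (K : Subgroup G) (hK : K = fixedSubgroupComponent σ)
    (𝔥 : LieSubalgebra ℝ (GroupLieAlgebra 𝓘(ℝ, E) G)) (h𝔥 : 𝔥 = lieAlgebraOfSubgroup K)
    -- almost effectiveness of the action
    (heff : ∀ J : LieIdeal ℝ (GroupLieAlgebra 𝓘(ℝ, E) G),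
      J.toSubmodule ≤ 𝔥.toSubmodule → J = ⊥)
    -- the smooth structure and the metric of `G ⧸ K`, and its Levi-Civita connection
    {F : Type*} [NormedAddCommGroup F] [NormedSpace ℝ F] [FiniteDimensional ℝ F]
    [ChartedSpace F (G ⧸ K)] [IsManifold 𝓘(ℝ, F) ∞ (G ⧸ K)]
    (hπ : Manifold.IsSubmersion 𝓘(ℝ, E) 𝓘(ℝ, F) ∞ (QuotientGroup.mk : G → G ⧸ K))
    [RiemannianBundle (fun x : G ⧸ K ↦ TangentSpace 𝓘(ℝ, F) x)]
    [IsContMDiffRiemannianBundle 𝓘(ℝ, F) ∞ F (fun x : G ⧸ K ↦ TangentSpace 𝓘(ℝ, F) x)]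
    (hg : IsKillingSubmersionMetric (E := E) (F := F) K)
    (cov : CovariantDerivative 𝓘(ℝ, F) F (TangentSpace 𝓘(ℝ, F) : G ⧸ K → Type _))
    (hcov : IsLeviCivita cov) :
    -- the metric is Einstein with Einstein constant `1 / 2`
    (∀ (x : G ⧸ K) (X Y : TangentSpace 𝓘(ℝ, F) x), ricciTensor cov x X Y = 1 / 2 * inner ℝ X Y) ∧
    -- the identification `ι` of `𝔥` with a subspace of `𝔰𝔬(T_o M)`
    ∃ ι : 𝔥 →ₗ[ℝ] soTangent (TangentSpace 𝓘(ℝ, F) (QuotientGroup.mk (1 : G) : G ⧸ K)),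
      (∀ (Z : 𝔥), ∀ X ∈ killingOrthogonal 𝔥,
        (ι Z).1 (projDeriv K 1 X) = projDeriv K 1 ⁅(Z : GroupLieAlgebra 𝓘(ℝ, E) G), X⁆) ∧
      Function.Injective ι ∧
    -- the curvature operator `𝔯` at `o`
    ∃ 𝔯 : soTangent (TangentSpace 𝓘(ℝ, F) (QuotientGroup.mk (1 : G) : G ⧸ K)) →ₗ[ℝ]
        soTangent (TangentSpace 𝓘(ℝ, F) (QuotientGroup.mk (1 : G) : G ⧸ K)),
      (∀ 𝔯', IsCurvatureOperator cov (QuotientGroup.mk (1 : G)) 𝔯' ↔ 𝔯' = 𝔯) ∧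
    -- the simple ideals `𝔩 i` of `𝔥`; together with the centre they decompose `𝔥`
    ∃ (n : ℕ) (𝔩 : Fin n → LieIdeal ℝ 𝔥) (eig : Fin n → ℝ),
      Function.Injective 𝔩 ∧
      (∀ J : LieIdeal ℝ 𝔥, LieAlgebra.IsSimple ℝ J ↔ ∃ i, 𝔩 i = J) ∧
      DirectSum.IsInternal (fun j : Option (Fin n) ↦
        (j.elim (LieAlgebra.center ℝ 𝔥) 𝔩).toSubmodule) ∧
      -- the eigenvalues and the eigenspaces of `𝔯`
      (∀ i, 0 < eig i ∧ eig i < 1 / 2) ∧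
      (∀ Z ∈ LieAlgebra.center ℝ 𝔥, 𝔯 (ι Z) = (1 / 2 : ℝ) • ι Z) ∧
      (∀ i, ∀ Z ∈ 𝔩 i, 𝔯 (ι Z) = eig i • ι Z) ∧
      Module.End.eigenspace 𝔯 (1 / 2) = (LieAlgebra.center ℝ 𝔥).toSubmodule.map ι ∧
      (∀ i, Module.End.eigenspace 𝔯 (eig i) =
        (⨆ j : {j : Fin n // eig j = eig i}, (𝔩 j).toSubmodule).map ι) ∧
      (∀ A, A ∈ Module.End.eigenspace 𝔯 0 ↔ ∀ Z : 𝔥, soInner A (ι Z) = 0) ∧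
      (∀ μ : ℝ, Module.End.HasEigenvalue 𝔯 μ → μ = 0 ∨ μ = 1 / 2 ∨ ∃ i, μ = eig i) ∧
      -- the scalar curvature
      (∀ x : G ⧸ K, scalarCurvature cov x = 1 / 2 * (Module.finrank ℝ F : ℝ)) ∧
      (∀ x : G ⧸ K, scalarCurvature cov x = 2 * LinearMap.trace ℝ _ 𝔯) ∧
      2 * LinearMap.trace ℝ _ 𝔯 =
        (Module.finrank ℝ (LieAlgebra.center ℝ 𝔥) : ℝ)
          + 2 * ∑ i, eig i * (Module.finrank ℝ (𝔩 i) : ℝ) := by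
  obtain ⟨d, j, hj, h⟩ := exists_isSymmetricFrame (F := F) σ hσ hσσ hK 𝔥 h𝔥 heff hπ hg
  have : FiniteDimensional ℝ (TangentSpace 𝓘(ℝ, F) (QuotientGroup.mk (1 : G) : G ⧸ K)) :=
    inferInstanceAs (FiniteDimensional ℝ F)
  have hpair := h.isOrthogonalSymmetricPair_tangentSpace (1 : G)
  obtain ⟨ι, hι, hinj, 𝔯, h𝔯, n, 𝔩, eig, h𝔩, hsimple, hint, heig, hcen, hideal, hhalf, hspace,
    hker, hval, htr, htr'⟩ := hpair.exists_curvatureOperator_spectrum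
      (riemannTensor cov (QuotientGroup.mk (1 : G))) fun X Y Z W ↦
        h.riemannTensor_eq_killingForm hπ hcov X Y Z W
  have hscal := h.scalarCurvature_eq_finrank hπ hcov
  refine ⟨h.ricciTensor_eq_inner hπ hcov, ι, fun Z X hX ↦ ?_, hinj, 𝔯, h𝔯, n, 𝔩, eig, h𝔩, hsimple,
    hint, heig, hcen, hideal, hhalf, hspace, hker, hval, hscal, fun x ↦ (hscal x).trans htr, htr'⟩
  -- The algebraic theorem describes ι through j and the inverse frame at 1. For X = j u this is
  -- undone by the frame, since left translation at 1 is the identity.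
  rw [← hj] at hX
  obtain ⟨u, rfl⟩ := hX
  have hD : ∀ X : GroupLieAlgebra 𝓘(ℝ, E) G,
      projDeriv (F := F) K 1 X = projInvariant (F := F) K 1 X := fun X ↦
    congrArg (projDeriv (F := F) K 1) (mulInvariantVectorField_one X).symm
  have h1 := hι Z (h.frame 1 u)
  change j ((h.frame 1).symm _) = ⁅_, j ((h.frame 1).symm _)⁆ at h1
  rw [LinearIsometryEquiv.symm_apply_apply] at h1
  have h2 := (h.frame 1).apply_symm_apply ((ι Z).1 (h.frame 1 u))
  rw [h.frame_apply, h1] at h2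
  rw [hD, hD]
  exact h2.symm
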